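/- Call a dynamic path network a path with vertices $v_1,\dots,v_n$ ($n\ge 1$, from left to right), positive integral weights $w_i$ (number of evacuees at $v_i$), and edges $e_i=(v_i,v_{i+1})$ with length $l_i\ge 0$ and capacity $c_i>0$ ($1\le i<n$; lengths and capacities are real), together with a transit time $\tau>0$ per unit distance. Evacuees move as a fluid: at most $c_i$ units can enter $e_i$ per unit time, it takes time $l_i\tau$ to traverse $e_i$, evacuees may wait at vertices, and lengths are prorated on partial edges. A sink may be any point of the path, at a vertex or in the interior of an edge; evacuees at the sink need no time, and those arriving at it from the left and from the right do not interfere. The evacuation time of $k$ sinks is the least $T$ such that the path can be divided into vertex-disjoint contiguous subpaths (possibly empty, one for each sink) so that, for each nonempty subpath, its sink lies on it and all evacuees of the subpath can reach this sink within time $T$. A $k$-sink is optimal if its evacuation time is minimum among all choices of $k$ points of the path. Theorem. There is a single real-RAM program (unit-cost field operations and order comparisons on real numbers; unit-cost arithmetic, comparison and indirect addressing on integer words of $O(\log (n+k))$ bits; no conversion of reals to integers) which, for every dynamic path network with general edge capacities, given by $n$, $\tau$, the $w_i$, the $l_i$ and the $c_i$, and every $k\ge 1$, halts with an optimal $k$-sink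 as output (each sink as an edge or vertex index together with a fraction of the edge). For $n\ge 2$ its running time is $O(n\log n+k^2\log^4 n)$, with an absolute constant. -/

import Mathlib

/-! ## Real RAM

Unit-cost random access machine with finitely many named registers (a program is a finite list
of instructions and mentions only finitely many of them) and unbounded memory arrays, for natural
numbers (used for counting and addressing) and for real numbers.  Real numbers are only
manipulated by field operations and order comparisons; they are never converted to integers. -/

namespace RealRAM

inductive Instr where
  /-- `ireg d := c` -/
  | iconst (d c : ℕ)
  /-- `ireg d := ireg a + ireg b` -/
  | iadd (d a b : ℕ)
  /-- `ireg d := ireg a - ireg b` (truncated) -/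
  | isub (d a b : ℕ)
  /-- `ireg d := ireg a * ireg b` -/
  | imul (d a b : ℕ)
  /-- `ireg d := ⌊ireg a / ireg b⌋` -/
  | idiv (d a b : ℕ)
  /-- `ireg d := imem (ireg a)` -/
  | iload (d a : ℕ)
  /-- `imem (ireg a) := ireg b` -/
  | istore (a b : ℕ)
  /-- `rreg d := q`; only rational constants may occur in a program -/
  | rconst (d : ℕ) (q : ℚ)
  /-- `rreg d := rreg a + rreg b` -/
  | radd (d a b : ℕ)
  /-- `rreg d := rreg a - rreg b` -/
  | rsub (d a b : ℕ)
  /-- `rreg d := rreg a * rreg b` -/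
  | rmul (d a b : ℕ)
  /-- `rreg d := rreg a / rreg b` -/
  | rdiv (d a b : ℕ)
  /-- `rreg d := rmem (ireg a)` -/
  | rload (d a : ℕ)
  /-- `rmem (ireg a) := rreg b` -/
  | rstore (a b : ℕ)
  /-- jump to instruction number `target` if `ireg a ≤ ireg b` -/
  | ijumpLe (a b target : ℕ)
  /-- jump to instruction number `target` if `rreg a ≤ rreg b` -/
  | rjumpLe (a b target : ℕ)

abbrev Program := List Instr

structure State where
  /-- number of the next instruction -/
  pc : ℕ
  /-- integer registers -/
  ireg : ℕ → ℕ
  /-- integer memory -/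
  imem : ℕ → ℕ
  /-- real registers -/
  rreg : ℕ → ℝ
  /-- real memory -/
  rmem : ℕ → ℝ

namespace State

def setIReg (s : State) (d v : ℕ) : State :=
  { s with pc := s.pc + 1, ireg := Function.update s.ireg d v }

noncomputable def setRReg (s : State) (d : ℕ) (v : ℝ) : State :=
  { s with pc := s.pc + 1, rreg := Function.update s.rreg d v }

end State

open Classical in
/-- The effect of one instruction. -/
noncomputable def exec (s : State) : Instr → State
  | .iconst d c => s.setIReg d c
  | .iadd d a b => s.setIReg d (s.ireg a + s.ireg b)
  | .isub d a b => s.setIReg d (s.ireg a - s.ireg b)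
  | .imul d a b => s.setIReg d (s.ireg a * s.ireg b)
  | .idiv d a b => s.setIReg d (s.ireg a / s.ireg b)
  | .iload d a => s.setIReg d (s.imem (s.ireg a))
  | .istore a b => { s with pc := s.pc + 1, imem := Function.update s.imem (s.ireg a) (s.ireg b) }
  | .rconst d q => s.setRReg d (q : ℝ)
  | .radd d a b => s.setRReg d (s.rreg a + s.rreg b)
  | .rsub d a b => s.setRReg d (s.rreg a - s.rreg b)
  | .rmul d a b => s.setRReg d (s.rreg a * s.rreg b)
  | .rdiv d a b => s.setRReg d (s.rreg a / s.rreg b)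
  | .rload d a => s.setRReg d (s.rmem (s.ireg a))
  | .rstore a b => { s with pc := s.pc + 1, rmem := Function.update s.rmem (s.ireg a) (s.rreg b) }
  | .ijumpLe a b target => { s with pc := if s.ireg a ≤ s.ireg b then target else s.pc + 1 }
  | .rjumpLe a b target => { s with pc := if s.rreg a ≤ s.rreg b then target else s.pc + 1 }

/-- One step of the machine.  The machine halts when it leaves the program. -/
noncomputable def step (P : Program) (s : State) : State :=
  match P[s.pc]? with
  | none => s
  | some i => exec s i

/-- The state after `t` steps. -/
noncomputable def run (P : Program) (s : State) (t : ℕ) : State := (step P)^[t] s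

def Halted (P : Program) (s : State) : Prop := P.length ≤ s.pc

/-- All integers held by the machine are at most `B`. -/
def State.WordsLe (s : State) (B : ℕ) : Prop := ∀ a, s.ireg a ≤ B ∧ s.imem a ≤ B

end RealRAM

/-! ## Dynamic path networks -/

/-- A dynamic path network with vertices `0, …, n - 1` from left to right; edge `e` joins the
vertices `e` and `e + 1`, for `e + 1 < n`.  Values at other indices are irrelevant. -/
structure PathNetwork where
  /-- number of vertices -/
  n : ℕ
  n_pos : 1 ≤ n
  /-- number of evacuees at each vertex -/
  weight : ℕ → ℕ
  weight_pos : ∀ v, v < n → 0 < weight v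
  /-- length of each edge -/
  len : ℕ → ℝ
  len_nonneg : ∀ e, e + 1 < n → 0 ≤ len e
  /-- capacity of each edge: amount that can enter it per unit time -/
  cap : ℕ → ℝ
  cap_pos : ∀ e, e + 1 < n → 0 < cap e
  /-- transit time per unit distance -/
  τ : ℝ
  τ_pos : 0 < τ

/-- The point on edge `idx` at the fraction `frac` of the way from vertex `idx` to vertex
`idx + 1`; it is the vertex `idx` if `frac = 0`. -/
structure Location where
  idx : ℕ
  frac : ℝ

noncomputable def Location.coord (s : Location) : ℝ := s.idx + s.frac

/-- A fluid, one-directional evacuation along a line of stations `0, …, q - 1` followed by a sink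
(as station `q`).  Station `p` initially holds the amount `ω p`; the link from `p` to `p + 1`
admits at most `κ p` per unit time at its entrance and takes `δ p` time to traverse.  `F p t` is the
total amount that has entered the link leaving `p` up to time `t`; waiting at stations is allowed.
The plan is required to have brought everything to the sink by time `T`. -/
structure IsEvacuationPlan (q : ℕ) (ω κ δ : ℕ → ℝ) (T : ℝ) (F : ℕ → ℝ → ℝ) : Prop where
  start : ∀ p < q, ∀ t ≤ 0, F p t = 0
  mono : ∀ p < q, Monotone (F p)
  capacity : ∀ p < q, ∀ t t', t ≤ t' → F p t' - F p t ≤ κ p * (t' - t)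
  first : 0 < q → ∀ t, F 0 t ≤ ω 0
  next : ∀ p, p + 1 < q → ∀ t, F (p + 1) t ≤ ω (p + 1) + F p (t - δ p)
  complete : ∀ p, p + 1 = q → F p (T - δ p) = ∑ h ∈ Finset.range q, ω h

namespace PathNetwork

variable (N : PathNetwork)

/-- `s` is a point of the path. -/
def OnPath (s : Location) : Prop :=
  s.idx < N.n ∧ 0 ≤ s.frac ∧ s.frac < 1 ∧ (s.frac ≠ 0 → s.idx + 1 < N.n)

open Classical in
/-- The evacuees on the vertices `a, a + 1, …` strictly to the left of `s` can reach `s` within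
time `T`, moving to the right.  The edge containing `s` in its interior is prorated. -/
def LeftEvacuates (a : ℕ) (s : Location) (T : ℝ) : Prop :=
  ∃ F, IsEvacuationPlan (if s.frac = 0 then s.idx - a else s.idx + 1 - a)
    (fun p => (N.weight (a + p) : ℝ))
    (fun p => N.cap (a + p))
    (fun p => N.τ * (if a + p = s.idx then s.frac * N.len (a + p) else N.len (a + p)))
    T F

open Classical in
/-- The evacuees on the vertices `b, b - 1, …` strictly to the right of `s` can reach `s` within
time `T`, moving to the left (vertex `b - p` is left through edge `b - p - 1`). -/
def RightEvacuates (b : ℕ) (s : Location) (T : ℝ) : Prop :=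
  ∃ F, IsEvacuationPlan (b - s.idx)
    (fun p => (N.weight (b - p) : ℝ))
    (fun p => N.cap (b - p - 1))
    (fun p => N.τ * (if b - p - 1 = s.idx then (1 - s.frac) * N.len (b - p - 1)
      else N.len (b - p - 1)))
    T F

/-- The sink `s` lies on the subpath from vertex `a` to vertex `b`, and all evacuees of this
subpath can reach `s` within time `T`.  Those arriving from the left and from the right do not
interfere, and those who are at `s` from the beginning need no time. -/
def Evacuates (a b : ℕ) (s : Location) (T : ℝ) : Prop :=
  0 ≤ T ∧ (a : ℝ) ≤ s.coord ∧ s.coord ≤ b ∧ N.LeftEvacuates a s T ∧ N.RightEvacuates b s T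

/-- The path can be divided into subpaths `[a j, b j]` (empty if `b j < a j`), one for each sink,
such that for every `j` the evacuees of the `j`-th subpath can reach the sink `S j`, which lies on
this subpath, within time `T`. -/
def SinksEvacuate {k : ℕ} (S : Fin k → Location) (T : ℝ) : Prop :=
  ∃ a b : Fin k → ℕ,
    (∀ v < N.n, ∃! j, a j ≤ v ∧ v ≤ b j) ∧
    ∀ j, a j ≤ b j → b j < N.n ∧ N.Evacuates (a j) (b j) (S j) T

/-- `T` is the evacuation time of the sinks `S`. -/
def IsEvacTime {k : ℕ} (S : Fin k → Location) (T : ℝ) : Prop :=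
  IsLeast {T' | N.SinksEvacuate S T'} T

/-- `S` is an optimal `k`-sink: `k` points of the path with minimum evacuation time. -/
def IsOptimalSink {k : ℕ} (S : Fin k → Location) : Prop :=
  (∀ j, N.OnPath (S j)) ∧
  ∃ T, N.IsEvacTime S T ∧
    ∀ S' : Fin k → Location, (∀ j, N.OnPath (S' j)) → ∀ T', N.IsEvacTime S' T' → T ≤ T'

/-- Initial state of the machine: integer registers `0`, `1` hold `n`, `k`; real register `0` holds
`τ`; the real memory holds the `n` weights, then the `n - 1` lengths, then the `n - 1`
capacities.  Everything else is `0`. -/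
noncomputable def input (k : ℕ) : RealRAM.State where
  pc := 0
  ireg := fun a => if a = 0 then N.n else if a = 1 then k else 0
  imem := fun _ => 0
  rreg := fun a => if a = 0 then N.τ else 0
  rmem := fun a =>
    if a < N.n then (N.weight a : ℝ)
    else if a < N.n + (N.n - 1) then N.len (a - N.n)
    else if a < N.n + (N.n - 1) + (N.n - 1) then N.cap (a - (N.n + (N.n - 1)))
    else 0

end PathNetwork

/-- The `k` points read off from the cells `0, …, k - 1` of the two memories. -/
def RealRAM.State.output (s : RealRAM.State) (k : ℕ) : Fin k → Location :=
  fun j => ⟨s.imem j, s.rmem j⟩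

/-! The fluid model has a closed form (`exists_plan_iff`). The evacuees of `a, …, m - 1` can reach
`m` within time `T` iff for every pair `p ≤ r` the weight of `a, …, p`, squeezed through edge `r` at
its capacity, plus the transit time from `p` to `m`, is at most `T`. So evacuation times to vertices
are maxima over pairs (`Lt`, and `Rt` by reflection). A sink inside an edge shifts these maxima by
the part of the edge that is saved.

For a fixed time `T`, it is optimal to let each sink in turn serve the longest possible subpath. No
served subpath that starts at or before a greedy one ends after it (`GStep.le`), and counting
subpaths shows that `k` greedy steps cover the path iff `k` sinks suffice (`Reach.not_feas`,
`Reach.feas`). A greedy step consists of two binary searches. The first compares `Lt` with `T` and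
finds the last vertex `m` that the left part reaches in time. The second compares `Vt`, which also
accounts for sinks between `m` and `m + 1`, and finds the last vertex served.

`Lt` is evaluated in time `O(log² n)`. The interval is cut into `O(log n)` dyadic blocks, taken from
right to left. For `p` in a block, the best partner `r` lies either in the same block or to its
right. In both cases the maximum over `p` is an upper envelope of lines, evaluated at a number that
does not depend on `p` (`lineA`, `lineC`, `Acc.block`). The slopes come sorted, so a stack builds
every envelope in linear time, and all blocks of all levels take `O(n log n)`.

A greedy step therefore takes `O(log³ n)` and the test whether `T` suffices takes `O(k log³ n)`. The
optimal time is found by parametric search: the greedy algorithm is run for the unknown times just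
below the optimum, and each of its `O(k log n)` comparisons is settled by such a test, in total
`O(k² log⁴ n)`. To treat the concrete and the parametric run at once, `wp_greedyLoop` is proved for
a comparison procedure that decides for a whole set of times and may shrink this set (`CmpSpec`). A
last greedy run at the optimal time writes the sinks.

The program is written in a small structured language with arrays. Weakest preconditions for it keep
track of exact running times and of word sizes, and the compilation to the machine preserves both
(`Cmd.code_spec`, `realize`). -/

namespace SinkRAM

open RealRAM

/-! ## A structured language with arrays

States have registers and, for each `j`, an integer array and a real array with number `j`.
Programs are compiled to the real RAM. -/

structure VState where
  ir : ℕ → ℕ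
  rr : ℕ → ℝ
  im : ℕ → ℕ → ℕ
  rm : ℕ → ℕ → ℝ

inductive IExp where
  | c (n : ℕ)
  | r (d : ℕ)
  | add (a b : IExp)
  | sub (a b : IExp)
  | mul (a b : IExp)
  | div (a b : IExp)
  | ld (j : ℕ) (a : IExp)

inductive RExp where
  | c (q : ℚ)
  | r (d : ℕ)
  | add (a b : RExp)
  | sub (a b : RExp)
  | mul (a b : RExp)
  | div (a b : RExp)
  | ld (j : ℕ) (a : IExp)

namespace IExp

@[simp] def eval (v : VState) : IExp → ℕ
  | c n => n
  | r d => v.ir d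
  | add a b => a.eval v + b.eval v
  | sub a b => a.eval v - b.eval v
  | mul a b => a.eval v * b.eval v
  | div a b => a.eval v / b.eval v
  | ld j a => v.im j (a.eval v)

/-- All words occurring in the evaluation are at most `V`, and all accesses are legal. -/
@[simp] def Ok (off V : ℕ) (v : VState) : IExp → Prop
  | c n => n ≤ V
  | r _ => True
  | add a b => a.Ok off V v ∧ b.Ok off V v ∧ a.eval v + b.eval v ≤ V
  | sub a b => a.Ok off V v ∧ b.Ok off V v
  | mul a b => a.Ok off V v ∧ b.Ok off V v ∧ a.eval v * b.eval v ≤ V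
  | div a b => a.Ok off V v ∧ b.Ok off V v
  | ld j a => a.Ok off V v ∧ j < 32 ∧ a.eval v ≤ V ∧ (j = 0 → a.eval v < off)

end IExp

namespace RExp

@[simp] noncomputable def eval (v : VState) : RExp → ℝ
  | c q => (q : ℝ)
  | r d => v.rr d
  | add a b => a.eval v + b.eval v
  | sub a b => a.eval v - b.eval v
  | mul a b => a.eval v * b.eval v
  | div a b => a.eval v / b.eval v
  | ld j a => v.rm j (a.eval v)

@[simp] def Ok (off V : ℕ) (v : VState) : RExp → Prop
  | c _ => True
  | r _ => True
  | add a b => a.Ok off V v ∧ b.Ok off V v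
  | sub a b => a.Ok off V v ∧ b.Ok off V v
  | mul a b => a.Ok off V v ∧ b.Ok off V v
  | div a b => a.Ok off V v ∧ b.Ok off V v
  | ld j a => a.Ok off V v ∧ j < 32 ∧ a.eval v ≤ V ∧ (j = 0 → a.eval v < off)

end RExp

inductive Cond where
  | ile (a b : IExp)
  | rle (a b : RExp)

namespace Cond

@[simp] def Holds (v : VState) : Cond → Prop
  | ile a b => a.eval v ≤ b.eval v
  | rle a b => a.eval v ≤ b.eval v

@[simp] def Ok (off V : ℕ) (v : VState) : Cond → Prop
  | ile a b => a.Ok off V v ∧ b.Ok off V v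
  | rle a b => a.Ok off V v ∧ b.Ok off V v

end Cond

inductive Cmd where
  | skip
  | iset (d : ℕ) (e : IExp)
  | rset (d : ℕ) (e : RExp)
  | ist (j : ℕ) (i e : IExp)
  | rst (j : ℕ) (i : IExp) (e : RExp)
  | seq (a b : Cmd)
  | ite (b : Cond) (x y : Cmd)
  | whl (b : Cond) (x : Cmd)

/-! ### Compilation -/

/-- Temporary registers. -/
def tmp (t : ℕ) : ℕ := 2 * t + 3

/-- Physical address of the cell `i` of array `j`. -/
def addr (off j i : ℕ) : ℕ := if j = 0 then i else off + 32 * i + j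

/-- Array `0` occupies the cells below `off`, where input and output live. The other arrays are
interleaved above with stride 32, so the residue modulo 32 tells them apart. -/
lemma addr_inj {off j j' i i' : ℕ} (hj : j < 32) (hj' : j' < 32) (h : j = 0 → i < off)
    (h' : j' = 0 → i' < off) (e : addr off j i = addr off j' i') : j = j' ∧ i = i' := by
  unfold addr at e
  split_ifs at e <;> constructor <;> omega

/-- Machine registers with even numbers hold program variables and odd ones from 3 on are
temporaries. Register 1 holds `off` all the time, and `tmp (t + 1)` is free for scratch here. -/
def addrCode (j t : ℕ) : Program :=
  if j = 0 then []
  else [.iconst (tmp (t + 1)) 32, .imul (tmp t) (tmp t) (tmp (t + 1)), .iadd (tmp t) (tmp t) 1,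
    .iconst (tmp (t + 1)) j, .iadd (tmp t) (tmp t) (tmp (t + 1))]

def addrLen (j : ℕ) : ℕ := if j = 0 then 0 else 5

/-- Temporaries are used as a stack: the value is left in `tmp t`, and nothing below is touched. A
register is copied by adding zero, since the machine has no move instruction. -/
def IExp.code : IExp → ℕ → Program
  | c n, t => [.iconst (tmp t) n]
  | r d, t => [.iconst (tmp t) 0, .iadd (tmp t) (2 * d) (tmp t)]
  | add a b, t => a.code t ++ (b.code (t + 1) ++ [.iadd (tmp t) (tmp t) (tmp (t + 1))])
  | sub a b, t => a.code t ++ (b.code (t + 1) ++ [.isub (tmp t) (tmp t) (tmp (t + 1))])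
  | mul a b, t => a.code t ++ (b.code (t + 1) ++ [.imul (tmp t) (tmp t) (tmp (t + 1))])
  | div a b, t => a.code t ++ (b.code (t + 1) ++ [.idiv (tmp t) (tmp t) (tmp (t + 1))])
  | ld j a, t => a.code t ++ (addrCode j t ++ [.iload (tmp t) (tmp t)])

@[simp] def IExp.len : IExp → ℕ
  | c _ => 1
  | r _ => 2
  | add a b => a.len + (b.len + 1)
  | sub a b => a.len + (b.len + 1)
  | mul a b => a.len + (b.len + 1)
  | div a b => a.len + (b.len + 1)
  | ld j a => a.len + ((if j = 0 then 0 else 5) + 1)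

/-- Values are stacked in the real temporaries from `t` on, addresses are computed in the integer
temporaries from `u` on. The index `u` need not grow, because an address is dead after its load. -/
def RExp.code : RExp → ℕ → ℕ → Program
  | c q, _, t => [.rconst (tmp t) q]
  | r d, _, t => [.rconst (tmp t) 0, .radd (tmp t) (2 * d) (tmp t)]
  | add a b, u, t => a.code u t ++ (b.code u (t + 1) ++ [.radd (tmp t) (tmp t) (tmp (t + 1))])
  | sub a b, u, t => a.code u t ++ (b.code u (t + 1) ++ [.rsub (tmp t) (tmp t) (tmp (t + 1))])
  | mul a b, u, t => a.code u t ++ (b.code u (t + 1) ++ [.rmul (tmp t) (tmp t) (tmp (t + 1))])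
  | div a b, u, t => a.code u t ++ (b.code u (t + 1) ++ [.rdiv (tmp t) (tmp t) (tmp (t + 1))])
  | ld j a, u, t => a.code u ++ (addrCode j u ++ [.rload (tmp t) (tmp u)])

@[simp] def RExp.len : RExp → ℕ
  | c _ => 1
  | r _ => 2
  | add a b => a.len + (b.len + 1)
  | sub a b => a.len + (b.len + 1)
  | mul a b => a.len + (b.len + 1)
  | div a b => a.len + (b.len + 1)
  | ld j a => a.len + ((if j = 0 then 0 else 5) + 1)

def Cond.code : Cond → ℕ → Program
  | ile a b, l => a.code 0 ++ (b.code 1 ++ [.ijumpLe (tmp 0) (tmp 1) l])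
  | rle a b, l => a.code 0 0 ++ (b.code 0 1 ++ [.rjumpLe (tmp 0) (tmp 1) l])

@[simp] def Cond.len : Cond → ℕ
  | ile a b => a.len + (b.len + 1)
  | rle a b => a.len + (b.len + 1)

def Cmd.len : Cmd → ℕ
  | skip => 0
  | iset _ e => e.len + 2
  | rset _ e => e.len + 2
  | ist j i e => i.len + (addrLen j + (e.len + 1))
  | rst j i e => i.len + (addrLen j + (e.len + 1))
  | seq a b => a.len + b.len
  | ite b x y => b.len + (y.len + (1 + x.len))
  | whl b x => b.len + (1 + (x.len + 1))

/-- Conditions jump when they hold, so the code of the false branch comes first and pays for one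
more jump. The instruction `.ijumpLe 1 1` is the unconditional jump. -/
def Cmd.code : Cmd → ℕ → Program
  | skip, _ => []
  | iset d e, _ => e.code 0 ++ [.iconst (tmp 1) 0, .iadd (2 * d) (tmp 0) (tmp 1)]
  | rset d e, _ => e.code 0 0 ++ [.rconst (tmp 1) 0, .radd (2 * d) (tmp 0) (tmp 1)]
  | ist j i e, _ => i.code 0 ++ (addrCode j 0 ++ (e.code 1 ++ [.istore (tmp 0) (tmp 1)]))
  | rst j i e, _ => i.code 0 ++ (addrCode j 0 ++ (e.code 1 0 ++ [.rstore (tmp 0) (tmp 0)]))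
  | seq a b, l => a.code l ++ b.code (l + a.len)
  | ite b x y, l => b.code (l + b.len + y.len + 1) ++ (y.code (l + b.len) ++
      ([.ijumpLe 1 1 (l + b.len + y.len + 1 + x.len)] ++ x.code (l + b.len + y.len + 1)))
  | whl b x, l => b.code (l + b.len + 1) ++ ([.ijumpLe 1 1 (l + b.len + 1 + x.len + 1)] ++
      (x.code (l + b.len + 1) ++ [.ijumpLe 1 1 l]))

lemma addrCode_length (j t : ℕ) : (addrCode j t).length = addrLen j := by
  unfold addrCode addrLen; split_ifs <;> rfl

lemma IExp.code_length (e : IExp) : ∀ t, (e.code t).length = e.len := by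
  induction e <;> intro t <;>
    simp_all [IExp.code, IExp.len, addrCode_length, addrLen]

lemma RExp.code_length (e : RExp) : ∀ u t, (e.code u t).length = e.len := by
  induction e <;> intro u t <;>
    simp_all [RExp.code, RExp.len, addrCode_length, IExp.code_length, addrLen]

lemma Cond.code_length (b : Cond) (l : ℕ) : (b.code l).length = b.len := by
  cases b <;> simp [Cond.code, Cond.len, IExp.code_length, RExp.code_length]

lemma Cmd.code_length (c : Cmd) : ∀ l, (c.code l).length = c.len := by
  induction c <;> intro l <;>
    simp_all [Cmd.code, Cmd.len, addrCode_length, IExp.code_length, RExp.code_length,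
      Cond.code_length] <;> omega

/-! ### Semantics -/

open Function in
/-- `Exec off V c v t v'`: from state `v`, the command `c` ends in state `v'` after `t` steps. -/
inductive Exec (off V : ℕ) : Cmd → VState → ℕ → VState → Prop
  | skip (v) : Exec off V .skip v 0 v
  | iset (v d e) (h : e.Ok off V v) :
      Exec off V (.iset d e) v (e.len + 2) { v with ir := update v.ir d (e.eval v) }
  | rset (v d e) (h : e.Ok off V v) :
      Exec off V (.rset d e) v (e.len + 2) { v with rr := update v.rr d (e.eval v) }
  | ist (v j i e) (hi : i.Ok off V v) (he : e.Ok off V v) (hj : j < 32) (hV : i.eval v ≤ V)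
      (h0 : j = 0 → i.eval v < off) :
      Exec off V (.ist j i e) v (i.len + (addrLen j + (e.len + 1)))
        { v with im := update v.im j (update (v.im j) (i.eval v) (e.eval v)) }
  | rst (v j i e) (hi : i.Ok off V v) (he : e.Ok off V v) (hj : j < 32) (hV : i.eval v ≤ V)
      (h0 : j = 0 → i.eval v < off) :
      Exec off V (.rst j i e) v (i.len + (addrLen j + (e.len + 1)))
        { v with rm := update v.rm j (update (v.rm j) (i.eval v) (e.eval v)) }
  | seq (a b v v₁ v₂ t₁ t₂) (h₁ : Exec off V a v t₁ v₁) (h₂ : Exec off V b v₁ t₂ v₂) :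
      Exec off V (.seq a b) v (t₁ + t₂) v₂
  | iteT (b x y v v' t) (hb : b.Ok off V v) (h : b.Holds v) (hx : Exec off V x v t v') :
      Exec off V (.ite b x y) v (b.len + t) v'
  | iteF (b x y v v' t) (hb : b.Ok off V v) (h : ¬ b.Holds v) (hy : Exec off V y v t v') :
      Exec off V (.ite b x y) v (b.len + (t + 1)) v'
  | whlF (b x v) (hb : b.Ok off V v) (h : ¬ b.Holds v) : Exec off V (.whl b x) v (b.len + 1) v
  | whlT (b x v v₁ v₂ t₁ t₂) (hb : b.Ok off V v) (h : b.Holds v) (hx : Exec off V x v t₁ v₁)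
      (hw : Exec off V (.whl b x) v₁ t₂ v₂) :
      Exec off V (.whl b x) v (b.len + (t₁ + (1 + t₂))) v₂

/-! ### Correctness of the compilation -/

/-- `s'` is reached from `s` in `n` steps, and no word exceeds `B` on the way. -/
def Steps (P : Program) (B : ℕ) (s : State) (n : ℕ) (s' : State) : Prop :=
  run P s n = s' ∧ ∀ m ≤ n, (run P s m).WordsLe B

variable {P : Program} {B : ℕ}

lemma Steps.refl {s : State} (h : s.WordsLe B) : Steps P B s 0 s :=
  ⟨rfl, fun m hm => by obtain rfl : m = 0 := by omega
                       exact h⟩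

lemma Steps.trans {s s₁ s₂ : State} {n m : ℕ} (h₁ : Steps P B s n s₁) (h₂ : Steps P B s₁ m s₂) :
    Steps P B s (n + m) s₂ := by
  have key : ∀ i, run P s (n + i) = run P s₁ i := fun i => by
    rw [← h₁.1]; unfold run; rw [Nat.add_comm, Function.iterate_add_apply]
  refine ⟨by rw [key, h₂.1], fun i hi => ?_⟩
  by_cases h : i ≤ n
  · exact h₁.2 i h
  · obtain ⟨j, rfl⟩ : ∃ j, i = n + j := ⟨i - n, by omega⟩
    rw [key]; exact h₂.2 j (by omega)

lemma Steps.words {s s' : State} {n : ℕ} (h : Steps P B s n s') : s'.WordsLe B := by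
  rw [← h.1]; exact h.2 n le_rfl

lemma Steps.one {s : State} {i : Instr} (hi : P[s.pc]? = some i) (h : s.WordsLe B)
    (h' : (exec s i).WordsLe B) : Steps P B s 1 (exec s i) := by
  have e : run P s 1 = exec s i := by simp [run, step, hi]
  refine ⟨e, fun m hm => ?_⟩
  interval_cases m
  · exact h
  · rw [e]; exact h'

/-- The program `P` contains `L` at position `l`. -/
def At (P : Program) (l : ℕ) (L : Program) : Prop := ∀ i (h : i < L.length), P[l + i]? = some L[i]

lemma At.append {l : ℕ} {L L' : Program} (h : At P l (L ++ L')) :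
    At P l L ∧ At P (l + L.length) L' := by
  constructor
  · intro i hi
    rw [h i (by simp; omega), List.getElem_append_left hi]
  · intro i hi
    have := h (L.length + i) (by simp; omega)
    rw [List.getElem_append_right (by omega)] at this
    simpa [Nat.add_assoc] using this

lemma At.cons {l : ℕ} {i : Instr} {L : Program} (h : At P l (i :: L)) :
    P[l]? = some i ∧ At P (l + 1) L := by
  constructor
  · have := h 0 (by simp)
    rwa [List.getElem_cons_zero, Nat.add_zero] at this
  · intro k hk
    have := h (k + 1) (by simpa using hk)
    simpa [Nat.add_assoc, Nat.add_comm 1 k] using this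

/-- Correspondence between the states of the structured language and those of the machine. -/
structure Rel (off V : ℕ) (v : VState) (s : State) : Prop where
  ir : ∀ d, s.ireg (2 * d) = v.ir d
  offReg : s.ireg 1 = off
  rr : ∀ d, s.rreg (2 * d) = v.rr d
  im : ∀ j < 32, ∀ i, (j = 0 → i < off) → s.imem (addr off j i) = v.im j i
  rm : ∀ j < 32, ∀ i, (j = 0 → i < off) → s.rmem (addr off j i) = v.rm j i
  -- Addresses are at most `off + 32 * V + 31`. The remaining slack covers the constants of the
  -- address computation.
  words : s.WordsLe (off + 32 * V + 64)

lemma wordsLe_setIReg {s : State} {d x : ℕ} (h : s.WordsLe B) (hx : x ≤ B) :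
    (s.setIReg d x).WordsLe B := fun a => by
  refine ⟨?_, (h a).2⟩
  simp only [State.setIReg, Function.update_apply]
  split_ifs
  · exact hx
  · exact (h a).1

lemma wordsLe_setRReg {s : State} {d : ℕ} {x : ℝ} (h : s.WordsLe B) :
    (s.setRReg d x).WordsLe B := fun a => h a

/-- `s'` differs from `s` only in the program counter and the integer temporaries from `t` on. -/
structure SameI (t : ℕ) (s s' : State) : Prop where
  ireg : ∀ a, a % 2 = 0 ∨ a < 2 * t + 3 → s'.ireg a = s.ireg a
  imem : s'.imem = s.imem
  rreg : s'.rreg = s.rreg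
  rmem : s'.rmem = s.rmem

lemma SameI.refl (t : ℕ) (s : State) : SameI t s s := ⟨fun _ _ => rfl, rfl, rfl, rfl⟩

lemma SameI.trans {t t' : ℕ} {s s₁ s₂ : State} (h₁ : SameI t s s₁) (h₂ : SameI t' s₁ s₂)
    (h : t ≤ t') : SameI t s s₂ :=
  ⟨fun a ha => by rw [h₂.ireg a (by omega), h₁.ireg a ha], h₂.imem.trans h₁.imem,
    h₂.rreg.trans h₁.rreg, h₂.rmem.trans h₁.rmem⟩

lemma sameI_setIReg {t : ℕ} {s : State} {x : ℕ} : SameI t s (s.setIReg (tmp t) x) := by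
  refine ⟨fun a ha => ?_, rfl, rfl, rfl⟩
  simp only [State.setIReg, Function.update_apply, tmp]
  rw [if_neg (by omega)]

lemma Rel.of_sameI {off V t : ℕ} {v : VState} {s s' : State} (h : Rel off V v s)
    (hs : SameI t s s') (hw : s'.WordsLe (off + 32 * V + 64)) : Rel off V v s' where
  ir d := by rw [hs.ireg _ (by omega), h.ir]
  offReg := by rw [hs.ireg _ (by omega), h.offReg]
  rr d := by rw [hs.rreg, h.rr]
  im j hj i hi := by rw [hs.imem, h.im j hj i hi]
  rm j hj i hi := by rw [hs.rmem, h.rm j hj i hi]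
  words := hw

@[simp] lemma setIReg_pc (s : State) (d x : ℕ) : (s.setIReg d x).pc = s.pc + 1 := rfl
@[simp] lemma setRReg_pc (s : State) (d : ℕ) (x : ℝ) : (s.setRReg d x).pc = s.pc + 1 := rfl
@[simp] lemma setIReg_self (s : State) (d x : ℕ) : (s.setIReg d x).ireg d = x := by
  simp [State.setIReg]
@[simp] lemma setRReg_self (s : State) (d : ℕ) (x : ℝ) : (s.setRReg d x).rreg d = x := by
  simp [State.setRReg]

lemma setIReg_ireg_ne {s : State} {d x a : ℕ} (h : a ≠ d) : (s.setIReg d x).ireg a = s.ireg a := by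
  simp [State.setIReg, h]

lemma setRReg_rreg_ne {s : State} {d : ℕ} {x : ℝ} {a : ℕ} (h : a ≠ d) :
    (s.setRReg d x).rreg a = s.rreg a := by
  simp [State.setRReg, h]

/-- One instruction that sets an integer temporary. -/
lemma Steps.tmp {s : State} {i : Instr} {t x : ℕ} (hi : P[s.pc]? = some i) (h : s.WordsLe B)
    (he : exec s i = s.setIReg (tmp t) x) (hx : x ≤ B) :
    ∃ s', Steps P B s 1 s' ∧ s'.pc = s.pc + 1 ∧ SameI t s s' ∧ s'.ireg (SinkRAM.tmp t) = x :=
  ⟨_, Steps.one hi h (he ▸ wordsLe_setIReg h hx), by rw [he]; rfl, by rw [he]; exact sameI_setIReg,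
    by rw [he]; simp⟩

lemma addrCode_spec {off V : ℕ} {v : VState} {j t i : ℕ} {s : State}
    (hP : At P s.pc (addrCode j t)) (h : Rel off V v s) (hj : j < 32) (hi : s.ireg (tmp t) = i)
    (hV : i ≤ V) :
    ∃ s', Steps P (off + 32 * V + 64) s (addrLen j) s' ∧ s'.pc = s.pc + addrLen j ∧
      SameI t s s' ∧ s'.ireg (tmp t) = addr off j i := by
  unfold addrCode at hP
  unfold addrLen addr
  split_ifs at hP ⊢ with hj0
  · exact ⟨s, Steps.refl h.words, rfl, SameI.refl _ _, hi⟩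
  · obtain ⟨g1, hP⟩ := hP.cons
    obtain ⟨g2, hP⟩ := hP.cons
    obtain ⟨g3, hP⟩ := hP.cons
    obtain ⟨g4, hP⟩ := hP.cons
    obtain ⟨g5, -⟩ := hP.cons
    have ne : tmp t ≠ tmp (t + 1) := by unfold tmp; omega
    have lt : tmp t < 2 * (t + 1) + 3 := by unfold tmp; omega
    have o : ∀ {s₁}, SameI t s s₁ → s₁.ireg 1 = off := fun hs => by
      rw [hs.ireg 1 (by omega), h.offReg]
    obtain ⟨s1, k1, p1, m1, e1⟩ := Steps.tmp (x := 32) g1 h.words rfl (by omega)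
    have m1' : SameI t s s1 := (SameI.refl t s).trans m1 (by omega)
    obtain ⟨s2, k2, p2, m2, e2⟩ := Steps.tmp (t := t) (x := i * 32) (p1 ▸ g2) k1.words
      (by simp only [exec]; rw [m1.ireg _ (Or.inr lt), hi, e1]) (by omega)
    have m2' := m1'.trans m2 le_rfl
    obtain ⟨s3, k3, p3, m3, e3⟩ := Steps.tmp (t := t) (x := i * 32 + off)
      (by rw [p2, p1]; exact g3) k2.words (by simp only [exec]; rw [e2, o m2']) (by omega)
    have m3' := m2'.trans m3 le_rfl
    obtain ⟨s4, k4, p4, m4, e4⟩ := Steps.tmp (t := t + 1) (x := j)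
      (by rw [p3, p2, p1]; exact g4) k3.words rfl (by omega)
    have m4' := m3'.trans m4 (by omega)
    obtain ⟨s5, k5, p5, m5, e5⟩ := Steps.tmp (t := t) (x := i * 32 + off + j)
      (by rw [p4, p3, p2, p1]; exact g5) k4.words
      (by simp only [exec]; rw [e4, m4.ireg _ (Or.inr lt), e3]) (by omega)
    exact ⟨s5, (((k1.trans k2).trans k3).trans k4).trans k5, by omega, m4'.trans m5 le_rfl,
      by rw [e5]; omega⟩

lemma Rel.imem_le {off V : ℕ} {v : VState} {s : State} (h : Rel off V v s) (a : ℕ) :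
    s.imem a ≤ off + 32 * V + 64 := (h.words a).2

/-- Two operands followed by an instruction. -/
lemma code_binop {off V : ℕ} {v : VState} {a b : IExp} {t : ℕ} {i : Instr} {f : ℕ → ℕ → ℕ}
    {s : State} (hP : At P s.pc (a.code t ++ (b.code (t + 1) ++ [i])))
    (hrel : Rel off V v s)
    (iha : ∀ s : State, At P s.pc (a.code t) → Rel off V v s →
      ∃ s', Steps P (off + 32 * V + 64) s a.len s' ∧ s'.pc = s.pc + a.len ∧
        SameI t s s' ∧ s'.ireg (tmp t) = a.eval v)
    (ihb : ∀ s : State, At P s.pc (b.code (t + 1)) → Rel off V v s →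
      ∃ s', Steps P (off + 32 * V + 64) s b.len s' ∧ s'.pc = s.pc + b.len ∧
        SameI (t + 1) s s' ∧ s'.ireg (tmp (t + 1)) = b.eval v)
    (hi : ∀ s, exec s i = s.setIReg (tmp t) (f (s.ireg (tmp t)) (s.ireg (tmp (t + 1)))))
    -- Differences and quotients never exceed their first operand, so they need no bound of their
    -- own.
    (hf : f (a.eval v) (b.eval v) ≤ off + 32 * V + 64 ∨
      f (a.eval v) (b.eval v) ≤ a.eval v) :
    ∃ s', Steps P (off + 32 * V + 64) s (a.len + (b.len + 1)) s' ∧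
      s'.pc = s.pc + (a.len + (b.len + 1)) ∧ SameI t s s' ∧
      s'.ireg (tmp t) = f (a.eval v) (b.eval v) := by
  obtain ⟨h1, h2⟩ := hP.append
  obtain ⟨h2, h3⟩ := h2.append
  rw [IExp.code_length] at h2 h3
  rw [IExp.code_length] at h3
  obtain ⟨s1, k1, p1, m1, e1⟩ := iha s h1 hrel
  obtain ⟨s2, k2, p2, m2, e2⟩ := ihb s1 (p1 ▸ h2) (hrel.of_sameI m1 k1.words)
  have ea : s2.ireg (tmp t) = a.eval v := by
    rw [m2.ireg _ (Or.inr (by unfold tmp; omega)), e1]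
  have hle : f (a.eval v) (b.eval v) ≤ off + 32 * V + 64 := by
    rcases hf with hf | hf
    · exact hf
    · refine hf.trans ?_
      rw [← ea]; exact (k2.words _).1
  obtain ⟨s3, k3, p3, m3, e3⟩ := Steps.tmp (t := t) (x := f (a.eval v) (b.eval v))
    (by rw [p2, p1]; exact h3.cons.1) k2.words (by rw [hi, ea, e2]) hle
  exact ⟨s3, by rw [← Nat.add_assoc]; exact (k1.trans k2).trans k3, by omega,
    (m1.trans m2 (by omega)).trans m3 le_rfl, e3⟩

lemma IExp.code_spec {off V : ℕ} {v : VState} (e : IExp) : ∀ (t : ℕ) (s : State),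
    At P s.pc (e.code t) → Rel off V v s → e.Ok off V v →
    ∃ s', Steps P (off + 32 * V + 64) s e.len s' ∧ s'.pc = s.pc + e.len ∧
      SameI t s s' ∧ s'.ireg (tmp t) = e.eval v := by
  induction e with
  | c n =>
    intro t s hP hrel hok
    exact Steps.tmp hP.cons.1 hrel.words rfl (by simp only [IExp.Ok] at hok; simp only [eval]; omega)
  | r d =>
    intro t s hP hrel hok
    obtain ⟨g1, g2⟩ := hP.cons
    obtain ⟨s1, k1, p1, m1, e1⟩ := Steps.tmp (t := t) (x := 0) g1 hrel.words rfl (by omega)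
    obtain ⟨s2, k2, p2, m2, e2⟩ := Steps.tmp (t := t) (x := v.ir d) (by rw [p1]; exact g2.cons.1)
      k1.words (by simp only [exec]; rw [e1, m1.ireg _ (by omega), hrel.ir]; simp)
      (by rw [← hrel.ir]; exact (hrel.words _).1)
    exact ⟨s2, k1.trans k2, by simp; omega, m1.trans m2 le_rfl, e2⟩
  | add a b iha ihb =>
    intro t s hP hrel hok
    exact code_binop (f := fun x y => x + y) hP hrel (fun s h h' => iha t s h h' hok.1)
      (fun s h h' => ihb _ s h h' hok.2.1) (fun _ => rfl) (Or.inl (by have := hok.2.2; omega))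
  | sub a b iha ihb =>
    intro t s hP hrel hok
    exact code_binop (f := fun x y => x - y) hP hrel (fun s h h' => iha t s h h' hok.1)
      (fun s h h' => ihb _ s h h' hok.2) (fun _ => rfl) (Or.inr (Nat.sub_le _ _))
  | mul a b iha ihb =>
    intro t s hP hrel hok
    exact code_binop (f := fun x y => x * y) hP hrel (fun s h h' => iha t s h h' hok.1)
      (fun s h h' => ihb _ s h h' hok.2.1) (fun _ => rfl) (Or.inl (by have := hok.2.2; omega))
  | div a b iha ihb =>
    intro t s hP hrel hok
    exact code_binop (f := fun x y => x / y) hP hrel (fun s h h' => iha t s h h' hok.1)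
      (fun s h h' => ihb _ s h h' hok.2) (fun _ => rfl) (Or.inr (Nat.div_le_self _ _))
  | ld j a iha =>
    intro t s hP hrel hok
    obtain ⟨hoka, hj, hV, h0⟩ := hok
    obtain ⟨h1, h2⟩ := hP.append
    obtain ⟨h2, h3⟩ := h2.append
    rw [IExp.code_length] at h2 h3
    rw [addrCode_length] at h3
    obtain ⟨s1, k1, p1, m1, e1⟩ := iha t s h1 hrel hoka
    have r1 := hrel.of_sameI m1 k1.words
    obtain ⟨s2, k2, p2, m2, e2⟩ := addrCode_spec (p1 ▸ h2) r1 hj e1 hV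
    have r2 := r1.of_sameI m2 k2.words
    obtain ⟨s3, k3, p3, m3, e3⟩ := Steps.tmp (t := t) (x := v.im j (a.eval v))
      (by rw [p2, p1]; exact h3.cons.1) k2.words
      (by simp only [exec]; rw [e2, r2.im j hj _ h0]) (by rw [← r2.im j hj _ h0]; exact r2.imem_le _)
    exact ⟨s3, by rw [len, ← Nat.add_assoc]; exact (k1.trans k2).trans k3,
      by simp only [len]; unfold addrLen at p2; omega, (m1.trans m2 le_rfl).trans m3 le_rfl, e3⟩

/-- `s'` differs from `s` only in the program counter, the integer temporaries from `u` on and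
the real temporaries from `t` on. -/
structure SameR (u t : ℕ) (s s' : State) : Prop where
  ireg : ∀ a, a % 2 = 0 ∨ a < 2 * u + 3 → s'.ireg a = s.ireg a
  rreg : ∀ a, a % 2 = 0 ∨ a < 2 * t + 3 → s'.rreg a = s.rreg a
  imem : s'.imem = s.imem
  rmem : s'.rmem = s.rmem

lemma SameR.trans {u t t' : ℕ} {s s₁ s₂ : State} (h₁ : SameR u t s s₁) (h₂ : SameR u t' s₁ s₂)
    (h : t ≤ t') : SameR u t s s₂ :=
  ⟨fun a ha => by rw [h₂.ireg a ha, h₁.ireg a ha], fun a ha => by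
    rw [h₂.rreg a (by omega), h₁.rreg a ha], h₂.imem.trans h₁.imem, h₂.rmem.trans h₁.rmem⟩

lemma SameI.toR {u t : ℕ} {s s' : State} (h : SameI u s s') : SameR u t s s' :=
  ⟨h.ireg, fun a _ => by rw [h.rreg], h.imem, h.rmem⟩

lemma Rel.of_sameR {off V u t : ℕ} {v : VState} {s s' : State} (h : Rel off V v s)
    (hs : SameR u t s s') (hw : s'.WordsLe (off + 32 * V + 64)) : Rel off V v s' where
  ir d := by rw [hs.ireg _ (by omega), h.ir]
  offReg := by rw [hs.ireg _ (by omega), h.offReg]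
  rr d := by rw [hs.rreg _ (by omega), h.rr]
  im j hj i hi := by rw [hs.imem, h.im j hj i hi]
  rm j hj i hi := by rw [hs.rmem, h.rm j hj i hi]
  words := hw

/-- One instruction that sets a real temporary. -/
lemma Steps.rtmp {s : State} {i : Instr} {u t : ℕ} {x : ℝ} (hi : P[s.pc]? = some i)
    (h : s.WordsLe B) (he : exec s i = s.setRReg (SinkRAM.tmp t) x) :
    ∃ s', Steps P B s 1 s' ∧ s'.pc = s.pc + 1 ∧ SameR u t s s' ∧ s'.rreg (SinkRAM.tmp t) = x := by
  refine ⟨_, Steps.one hi h (he ▸ wordsLe_setRReg h), by rw [he]; rfl, ?_, by rw [he]; simp⟩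
  rw [he]
  refine ⟨fun _ _ => rfl, fun a ha => setRReg_rreg_ne ?_, rfl, rfl⟩
  unfold SinkRAM.tmp; omega

lemma code_rbinop {off V : ℕ} {v : VState} {a b : RExp} {u t : ℕ} {i : Instr} {f : ℝ → ℝ → ℝ}
    {s : State} (hP : At P s.pc (a.code u t ++ (b.code u (t + 1) ++ [i])))
    (hrel : Rel off V v s)
    (iha : ∀ s : State, At P s.pc (a.code u t) → Rel off V v s →
      ∃ s', Steps P (off + 32 * V + 64) s a.len s' ∧ s'.pc = s.pc + a.len ∧
        SameR u t s s' ∧ s'.rreg (tmp t) = a.eval v)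
    (ihb : ∀ s : State, At P s.pc (b.code u (t + 1)) → Rel off V v s →
      ∃ s', Steps P (off + 32 * V + 64) s b.len s' ∧ s'.pc = s.pc + b.len ∧
        SameR u (t + 1) s s' ∧ s'.rreg (tmp (t + 1)) = b.eval v)
    (hi : ∀ s, exec s i = s.setRReg (tmp t) (f (s.rreg (tmp t)) (s.rreg (tmp (t + 1))))) :
    ∃ s', Steps P (off + 32 * V + 64) s (a.len + (b.len + 1)) s' ∧
      s'.pc = s.pc + (a.len + (b.len + 1)) ∧ SameR u t s s' ∧
      s'.rreg (tmp t) = f (a.eval v) (b.eval v) := by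
  obtain ⟨h1, h2⟩ := hP.append
  obtain ⟨h2, h3⟩ := h2.append
  rw [RExp.code_length] at h2 h3
  rw [RExp.code_length] at h3
  obtain ⟨s1, k1, p1, m1, e1⟩ := iha s h1 hrel
  obtain ⟨s2, k2, p2, m2, e2⟩ := ihb s1 (p1 ▸ h2) (hrel.of_sameR m1 k1.words)
  have ea : s2.rreg (tmp t) = a.eval v := by
    rw [m2.rreg _ (Or.inr (by unfold tmp; omega)), e1]
  obtain ⟨s3, k3, p3, m3, e3⟩ := Steps.rtmp (u := u) (t := t) (x := f (a.eval v) (b.eval v))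
    (by rw [p2, p1]; exact h3.cons.1) k2.words (by rw [hi, ea, e2])
  exact ⟨s3, by rw [← Nat.add_assoc]; exact (k1.trans k2).trans k3, by omega,
    (m1.trans m2 (by omega)).trans m3 le_rfl, e3⟩

lemma RExp.code_spec {off V : ℕ} {v : VState} (e : RExp) (u : ℕ) : ∀ (t : ℕ) (s : State),
    At P s.pc (e.code u t) → Rel off V v s → e.Ok off V v →
    ∃ s', Steps P (off + 32 * V + 64) s e.len s' ∧ s'.pc = s.pc + e.len ∧
      SameR u t s s' ∧ s'.rreg (tmp t) = e.eval v := by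
  induction e with
  | c q =>
    intro t s hP hrel hok
    exact Steps.rtmp hP.cons.1 hrel.words rfl
  | r d =>
    intro t s hP hrel hok
    obtain ⟨g1, g2⟩ := hP.cons
    obtain ⟨s1, k1, p1, m1, e1⟩ := Steps.rtmp (u := u) (t := t) (x := ((0 : ℚ) : ℝ)) g1 hrel.words
      rfl
    obtain ⟨s2, k2, p2, m2, e2⟩ := Steps.rtmp (u := u) (t := t) (x := v.rr d)
      (by rw [p1]; exact g2.cons.1)
      k1.words (by simp only [exec]; rw [e1, m1.rreg _ (by omega), hrel.rr]; simp)
    exact ⟨s2, k1.trans k2, by simp; omega, m1.trans m2 le_rfl, e2⟩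
  | add a b iha ihb =>
    intro t s hP hrel hok
    exact code_rbinop (f := fun x y => x + y) hP hrel (fun s h h' => iha t s h h' hok.1)
      (fun s h h' => ihb _ s h h' hok.2) (fun _ => rfl)
  | sub a b iha ihb =>
    intro t s hP hrel hok
    exact code_rbinop (f := fun x y => x - y) hP hrel (fun s h h' => iha t s h h' hok.1)
      (fun s h h' => ihb _ s h h' hok.2) (fun _ => rfl)
  | mul a b iha ihb =>
    intro t s hP hrel hok
    exact code_rbinop (f := fun x y => x * y) hP hrel (fun s h h' => iha t s h h' hok.1)
      (fun s h h' => ihb _ s h h' hok.2) (fun _ => rfl)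
  | div a b iha ihb =>
    intro t s hP hrel hok
    exact code_rbinop (f := fun x y => x / y) hP hrel (fun s h h' => iha t s h h' hok.1)
      (fun s h h' => ihb _ s h h' hok.2) (fun _ => rfl)
  | ld j a =>
    intro t s hP hrel hok
    obtain ⟨hoka, hj, hV, h0⟩ := hok
    obtain ⟨h1, h2⟩ := hP.append
    obtain ⟨h2, h3⟩ := h2.append
    rw [IExp.code_length] at h2 h3
    rw [addrCode_length] at h3
    obtain ⟨s1, k1, p1, m1, e1⟩ := a.code_spec u s h1 hrel hoka
    have r1 := hrel.of_sameI m1 k1.words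
    obtain ⟨s2, k2, p2, m2, e2⟩ := addrCode_spec (p1 ▸ h2) r1 hj e1 hV
    have r2 := r1.of_sameI m2 k2.words
    obtain ⟨s3, k3, p3, m3, e3⟩ := Steps.rtmp (u := u) (t := t) (x := v.rm j (a.eval v))
      (by rw [p2, p1]; exact h3.cons.1) k2.words
      (by simp only [exec]; rw [e2, r2.rm j hj _ h0])
    exact ⟨s3, by rw [len, ← Nat.add_assoc]; exact (k1.trans k2).trans k3,
      by simp only [len]; unfold addrLen at p2; omega,
      ((m1.trans m2 le_rfl).toR).trans m3 le_rfl, e3⟩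

lemma Cond.code_spec {off V : ℕ} {v : VState} (b : Cond) (l : ℕ) (s : State)
    (hP : At P s.pc (b.code l)) (hrel : Rel off V v s) (hok : b.Ok off V v) :
    ∃ s', Steps P (off + 32 * V + 64) s b.len s' ∧ Rel off V v s' ∧
      (b.Holds v → s'.pc = l) ∧ (¬ b.Holds v → s'.pc = s.pc + b.len) := by
  cases b with
  | ile a b =>
    obtain ⟨h1, h2⟩ := hP.append
    obtain ⟨h2, h3⟩ := h2.append
    rw [IExp.code_length] at h2 h3
    rw [IExp.code_length] at h3
    obtain ⟨s1, k1, p1, m1, e1⟩ := a.code_spec 0 s h1 hrel hok.1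
    have r1 := hrel.of_sameI m1 k1.words
    obtain ⟨s2, k2, p2, m2, e2⟩ := b.code_spec 1 s1 (p1 ▸ h2) r1 hok.2
    have r2 := r1.of_sameI m2 k2.words
    have ea : s2.ireg (tmp 0) = a.eval v := by
      rw [m2.ireg _ (Or.inr (by unfold tmp; omega)), e1]
    have k3 := Steps.one (P := P) (s := s2) (i := .ijumpLe (tmp 0) (tmp 1) l)
      (by rw [p2, p1]; exact h3.cons.1) k2.words (fun a => k2.words a)
    refine ⟨_, by rw [len, ← Nat.add_assoc]; exact (k1.trans k2).trans k3,
      r2.of_sameI (t := 0) (s' := exec s2 (.ijumpLe (tmp 0) (tmp 1) l)) ⟨fun _ _ => rfl, rfl, rfl, rfl⟩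
        k3.words, fun h => ?_, fun h => ?_⟩
    · simp only [exec, ea, e2]; exact if_pos h
    · simp only [exec, ea, e2, len, ← Nat.add_assoc]; rw [← p1, ← p2]; exact if_neg h
  | rle a b =>
    obtain ⟨h1, h2⟩ := hP.append
    obtain ⟨h2, h3⟩ := h2.append
    rw [RExp.code_length] at h2 h3
    rw [RExp.code_length] at h3
    obtain ⟨s1, k1, p1, m1, e1⟩ := a.code_spec 0 0 s h1 hrel hok.1
    have r1 := hrel.of_sameR m1 k1.words
    obtain ⟨s2, k2, p2, m2, e2⟩ := b.code_spec 0 1 s1 (p1 ▸ h2) r1 hok.2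
    have r2 := r1.of_sameR m2 k2.words
    have ea : s2.rreg (tmp 0) = a.eval v := by
      rw [m2.rreg _ (Or.inr (by unfold tmp; omega)), e1]
    have k3 := Steps.one (P := P) (s := s2) (i := .rjumpLe (tmp 0) (tmp 1) l)
      (by rw [p2, p1]; exact h3.cons.1) k2.words (fun a => k2.words a)
    refine ⟨_, by rw [len, ← Nat.add_assoc]; exact (k1.trans k2).trans k3,
      r2.of_sameI (t := 0) (s' := exec s2 (.rjumpLe (tmp 0) (tmp 1) l)) ⟨fun _ _ => rfl, rfl, rfl, rfl⟩
        k3.words, fun h => ?_, fun h => ?_⟩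
    · simp only [exec, ea, e2]; exact if_pos h
    · simp only [exec, ea, e2, len, ← Nat.add_assoc]; rw [← p1, ← p2]; exact if_neg h

lemma Steps.jump {off V : ℕ} {v : VState} {s : State} {l : ℕ} (h : P[s.pc]? = some (.ijumpLe 1 1 l))
    (hrel : Rel off V v s) :
    ∃ s', Steps P (off + 32 * V + 64) s 1 s' ∧ Rel off V v s' ∧ s'.pc = l := by
  have k := Steps.one (P := P) h hrel.words (fun a => hrel.words a)
  exact ⟨_, k, hrel.of_sameI (t := 0) ⟨fun _ _ => rfl, rfl, rfl, rfl⟩ k.words, by simp [exec]⟩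

open Function in
-- Times agree exactly: `t` in `Exec` counts machine instructions. All later time bounds can
-- therefore be proved for structured programs. The induction is on the derivation and not on the
-- command, since a loop executes the same code again.
theorem Cmd.code_spec {off V : ℕ} {c : Cmd} {v v' : VState} {t : ℕ} (hx : Exec off V c v t v') :
    ∀ s : State, At P s.pc (c.code s.pc) → Rel off V v s →
    ∃ s', Steps P (off + 32 * V + 64) s t s' ∧ Rel off V v' s' ∧ s'.pc = s.pc + c.len := by
  induction hx with
  | skip v => exact fun s _ h => ⟨s, Steps.refl h.words, h, rfl⟩
  | iset v d e hok =>
    intro s hP hrel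
    obtain ⟨h1, h2⟩ := hP.append
    rw [IExp.code_length] at h2
    obtain ⟨h2, h3⟩ := h2.cons
    obtain ⟨s1, k1, p1, m1, e1⟩ := e.code_spec 0 s h1 hrel hok
    have r1 := hrel.of_sameI m1 k1.words
    obtain ⟨s2, k2, p2, m2, e2⟩ := Steps.tmp (t := 1) (x := 0) (p1 ▸ h2) k1.words rfl (by omega)
    have r2 := r1.of_sameI m2 k2.words
    have ee : s2.ireg (tmp 0) + s2.ireg (tmp 1) = e.eval v := by
      rw [m2.ireg _ (Or.inr (by unfold tmp; omega)), e1, e2]; rfl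
    have w : e.eval v ≤ off + 32 * V + 64 := by rw [← e1]; exact (k1.words _).1
    have k3 := Steps.one (P := P) (s := s2) (by rw [p2, p1]; exact h3.cons.1) k2.words
      (by simp only [exec, ee]; exact wordsLe_setIReg k2.words w)
    refine ⟨_, (k1.trans k2).trans k3, ?_, by simp only [exec, setIReg_pc, len]; omega⟩
    have w3 := k3.words
    simp only [exec, ee] at w3 ⊢
    refine ⟨fun a => ?_, ?_, r2.rr, r2.im, r2.rm, w3⟩
    · by_cases h : a = d
      · subst h; simp
      · rw [setIReg_ireg_ne (by omega), r2.ir]; simp [h]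
    · rw [setIReg_ireg_ne (by omega), r2.offReg]
  | rset v d e hok =>
    intro s hP hrel
    obtain ⟨h1, h2⟩ := hP.append
    rw [RExp.code_length] at h2
    obtain ⟨h2, h3⟩ := h2.cons
    obtain ⟨s1, k1, p1, m1, e1⟩ := e.code_spec 0 0 s h1 hrel hok
    have r1 := hrel.of_sameR m1 k1.words
    obtain ⟨s2, k2, p2, m2, e2⟩ := Steps.rtmp (u := 0) (t := 1) (x := ((0 : ℚ) : ℝ)) (p1 ▸ h2)
      k1.words rfl
    have r2 := r1.of_sameR m2 k2.words
    have ee : s2.rreg (tmp 0) + s2.rreg (tmp 1) = e.eval v := by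
      rw [m2.rreg _ (Or.inr (by unfold tmp; omega)), e1, e2]; simp
    have k3 := Steps.one (P := P) (s := s2) (i := .radd (2 * d) (tmp 0) (tmp 1))
      (by rw [p2, p1]; exact h3.cons.1) k2.words (fun a => k2.words a)
    refine ⟨_, (k1.trans k2).trans k3, ?_, by simp only [exec, setRReg_pc, len]; omega⟩
    simp only [exec, ee]
    refine ⟨r2.ir, r2.offReg, fun a => ?_, r2.im, r2.rm, k2.words⟩
    by_cases h : a = d
    · subst h; simp
    · rw [setRReg_rreg_ne (by omega), r2.rr]; simp [h]
  | ist v j i e hi he hj hV h0 =>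
    intro s hP hrel
    obtain ⟨h1, h2⟩ := hP.append
    obtain ⟨h2, h3⟩ := h2.append
    obtain ⟨h3, h4⟩ := h3.append
    simp only [IExp.code_length, addrCode_length] at h2 h3 h4
    obtain ⟨s1, k1, p1, m1, e1⟩ := i.code_spec 0 s h1 hrel hi
    have r1 := hrel.of_sameI m1 k1.words
    obtain ⟨s2, k2, p2, m2, e2⟩ := addrCode_spec (p1 ▸ h2) r1 hj e1 hV
    have r2 := r1.of_sameI m2 k2.words
    obtain ⟨s3, k3, p3, m3, e3⟩ := e.code_spec 1 s2 (by rw [p2, p1]; exact h3) r2 he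
    have r3 := r2.of_sameI m3 k3.words
    have ea : s3.ireg (tmp 0) = addr off j (i.eval v) := by
      rw [m3.ireg _ (Or.inr (by unfold tmp; omega)), e2]
    have w4 : (exec s3 (.istore (tmp 0) (tmp 1))).WordsLe (off + 32 * V + 64) := fun a => by
      refine ⟨(k3.words a).1, ?_⟩
      simp only [exec, update_apply]
      split_ifs
      · exact (k3.words _).1
      · exact (k3.words a).2
    have k4 := Steps.one (P := P) (s := s3) (by rw [p3, p2, p1]; exact h4.cons.1) k3.words w4
    refine ⟨_, by simpa only [Nat.add_assoc] using ((k1.trans k2).trans k3).trans k4, ?_,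
      by simp only [exec, len]; omega⟩
    simp only [exec, ea, e3] at w4 ⊢
    refine ⟨r3.ir, r3.offReg, r3.rr, fun j' hj' i' hi' => ?_, r3.rm, w4⟩
    simp only [update_apply]
    by_cases hc : addr off j' i' = addr off j (i.eval v)
    · obtain ⟨rfl, rfl⟩ := addr_inj hj' hj hi' h0 hc
      simp
    · rw [if_neg hc, r3.im j' hj' i' hi']
      split_ifs with h5
      · subst h5
        rw [update_of_ne]
        rintro rfl; exact hc rfl
      · rfl
  | rst v j i e hi he hj hV h0 =>
    intro s hP hrel
    obtain ⟨h1, h2⟩ := hP.append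
    obtain ⟨h2, h3⟩ := h2.append
    obtain ⟨h3, h4⟩ := h3.append
    simp only [IExp.code_length, RExp.code_length, addrCode_length] at h2 h3 h4
    obtain ⟨s1, k1, p1, m1, e1⟩ := i.code_spec 0 s h1 hrel hi
    have r1 := hrel.of_sameI m1 k1.words
    obtain ⟨s2, k2, p2, m2, e2⟩ := addrCode_spec (p1 ▸ h2) r1 hj e1 hV
    have r2 := r1.of_sameI m2 k2.words
    obtain ⟨s3, k3, p3, m3, e3⟩ := e.code_spec 1 0 s2 (by rw [p2, p1]; exact h3) r2 he
    have r3 := r2.of_sameR m3 k3.words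
    have ea : s3.ireg (tmp 0) = addr off j (i.eval v) := by
      rw [m3.ireg _ (Or.inr (by unfold tmp; omega)), e2]
    have k4 := Steps.one (P := P) (s := s3) (i := .rstore (tmp 0) (tmp 0))
      (by rw [p3, p2, p1]; exact h4.cons.1) k3.words (fun a => k3.words a)
    refine ⟨_, by simpa only [Nat.add_assoc] using ((k1.trans k2).trans k3).trans k4, ?_,
      by simp only [exec, len]; omega⟩
    simp only [exec, ea, e3]
    refine ⟨r3.ir, r3.offReg, r3.rr, r3.im, fun j' hj' i' hi' => ?_, k3.words⟩
    simp only [update_apply]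
    by_cases hc : addr off j' i' = addr off j (i.eval v)
    · obtain ⟨rfl, rfl⟩ := addr_inj hj' hj hi' h0 hc
      simp
    · rw [if_neg hc, r3.rm j' hj' i' hi']
      split_ifs with h5
      · subst h5
        rw [update_of_ne]
        rintro rfl; exact hc rfl
      · rfl
  | seq a b v v₁ v₂ t₁ t₂ _ _ ih₁ ih₂ =>
    intro s hP hrel
    obtain ⟨h1, h2⟩ := hP.append
    rw [Cmd.code_length] at h2
    obtain ⟨s1, k1, r1, p1⟩ := ih₁ s h1 hrel
    obtain ⟨s2, k2, r2, p2⟩ := ih₂ s1 (by rw [p1]; exact h2) r1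
    exact ⟨s2, k1.trans k2, r2, by simp only [len]; omega⟩
  | iteT b x y v v' t hb h _ ih =>
    intro s hP hrel
    obtain ⟨h1, h2⟩ := hP.append
    obtain ⟨h2, h3⟩ := h2.append
    obtain ⟨h3, h4⟩ := h3.append
    simp only [Cond.code_length, Cmd.code_length, List.length_singleton] at h2 h3 h4
    obtain ⟨s1, k1, r1, p1, -⟩ := b.code_spec _ s h1 hrel hb
    specialize p1 h
    obtain ⟨s2, k2, r2, p2⟩ := ih s1 (by rw [p1]; exact h4) r1
    exact ⟨s2, k1.trans k2, r2, by simp only [len]; omega⟩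
  | iteF b x y v v' t hb h _ ih =>
    intro s hP hrel
    obtain ⟨h1, h2⟩ := hP.append
    obtain ⟨h2, h3⟩ := h2.append
    obtain ⟨h3, h4⟩ := h3.append
    simp only [Cond.code_length, Cmd.code_length, List.length_singleton] at h2 h3 h4
    obtain ⟨s1, k1, r1, -, p1⟩ := b.code_spec _ s h1 hrel hb
    specialize p1 h
    obtain ⟨s2, k2, r2, p2⟩ := ih s1 (by rw [p1]; exact h2) r1
    obtain ⟨s3, k3, r3, p3⟩ := Steps.jump (by rw [p2, p1]; exact h3.cons.1) r2
    exact ⟨s3, by simpa only [Nat.add_assoc] using (k1.trans k2).trans k3, r3,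
      by simp only [len]; omega⟩
  | whlF b x v hb h =>
    intro s hP hrel
    obtain ⟨h1, h2⟩ := hP.append
    obtain ⟨h2, h3⟩ := h2.append
    simp only [Cond.code_length] at h2
    obtain ⟨s1, k1, r1, -, p1⟩ := b.code_spec _ s h1 hrel hb
    specialize p1 h
    obtain ⟨s3, k3, r3, p3⟩ := Steps.jump (by rw [p1]; exact h2.cons.1) r1
    exact ⟨s3, k1.trans k3, r3, by simp only [len]; omega⟩
  | whlT b x v v₁ v₂ t₁ t₂ hb h _ _ ih₁ ih₂ =>
    intro s hP hrel
    have hP' := hP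
    obtain ⟨h1, h2⟩ := hP.append
    obtain ⟨h2, h3⟩ := h2.append
    obtain ⟨h3, h4⟩ := h3.append
    simp only [Cond.code_length, Cmd.code_length, List.length_singleton] at h2 h3 h4
    obtain ⟨s1, k1, r1, p1, -⟩ := b.code_spec _ s h1 hrel hb
    specialize p1 h
    obtain ⟨s2, k2, r2, p2⟩ := ih₁ s1 (by rw [p1]; exact h3) r1
    obtain ⟨s3, k3, r3, p3⟩ := Steps.jump (by rw [p2, p1]; exact h4.cons.1) r2
    obtain ⟨s4, k4, r4, p4⟩ := ih₂ s3 (by rw [p3]; exact hP') r3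
    exact ⟨s4, by simpa only [Nat.add_assoc] using ((k1.trans k2).trans k3).trans k4, r4,
      by rw [p4, p3]⟩

end SinkRAM

/-! ### Program logic for the structured language, and its transfer to the machine. -/

namespace SinkRAM

open RealRAM

/-! ### Weakest preconditions -/

namespace VState

def setI (v : VState) (d x : ℕ) : VState := { v with ir := Function.update v.ir d x }
noncomputable def setR (v : VState) (d : ℕ) (x : ℝ) : VState :=
  { v with rr := Function.update v.rr d x }
def stI (v : VState) (j i x : ℕ) : VState :=
  { v with im := Function.update v.im j (Function.update (v.im j) i x) }
noncomputable def stR (v : VState) (j i : ℕ) (x : ℝ) : VState :=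
  { v with rm := Function.update v.rm j (Function.update (v.rm j) i x) }

variable (v : VState) (d x j i : ℕ) (y : ℝ)

@[simp] lemma setI_ir (e : ℕ) : (v.setI d x).ir e = if e = d then x else v.ir e := by
  simp [setI, Function.update_apply]
@[simp] lemma setI_rr : (v.setI d x).rr = v.rr := rfl
@[simp] lemma setI_im : (v.setI d x).im = v.im := rfl
@[simp] lemma setI_rm : (v.setI d x).rm = v.rm := rfl
@[simp] lemma setR_rr (e : ℕ) : (v.setR d y).rr e = if e = d then y else v.rr e := by
  simp [setR, Function.update_apply]
@[simp] lemma setR_ir : (v.setR d y).ir = v.ir := rfl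
@[simp] lemma setR_im : (v.setR d y).im = v.im := rfl
@[simp] lemma setR_rm : (v.setR d y).rm = v.rm := rfl
@[simp] lemma stI_im (e f : ℕ) :
    (v.stI j i x).im e f = if e = j ∧ f = i then x else v.im e f := by
  by_cases h : e = j
  · subst h; simp [stI, Function.update_apply]
  · simp [stI, h]
@[simp] lemma stI_ir : (v.stI j i x).ir = v.ir := rfl
@[simp] lemma stI_rr : (v.stI j i x).rr = v.rr := rfl
@[simp] lemma stI_rm : (v.stI j i x).rm = v.rm := rfl
@[simp] lemma stR_rm (e f : ℕ) :
    (v.stR j i y).rm e f = if e = j ∧ f = i then y else v.rm e f := by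
  by_cases h : e = j
  · subst h; simp [stR, Function.update_apply]
  · simp [stR, h]
@[simp] lemma stR_ir : (v.stR j i y).ir = v.ir := rfl
@[simp] lemma stR_rr : (v.stR j i y).rr = v.rr := rfl
@[simp] lemma stR_im : (v.stR j i y).im = v.im := rfl

end VState

/-- `c` terminates from `v`, and `Q` holds for the number of steps and the final state. -/
def Wp (off V : ℕ) (c : Cmd) (v : VState) (Q : ℕ → VState → Prop) : Prop :=
  ∃ t v', Exec off V c v t v' ∧ Q t v'

variable {off V : ℕ} {v v' : VState} {Q : ℕ → VState → Prop}

@[simp] lemma wp_skip : Wp off V .skip v Q ↔ Q 0 v :=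
  ⟨fun ⟨_, _, h, hQ⟩ => by cases h; exact hQ, fun h => ⟨_, _, .skip v, h⟩⟩

@[simp] lemma wp_iset {d : ℕ} {e : IExp} : Wp off V (.iset d e) v Q ↔
    e.Ok off V v ∧ Q (e.len + 2) (v.setI d (e.eval v)) :=
  ⟨fun ⟨_, _, h, hQ⟩ => by cases h with | iset _ _ _ h => exact ⟨h, hQ⟩,
    fun h => ⟨_, _, .iset v d e h.1, h.2⟩⟩

@[simp] lemma wp_rset {d : ℕ} {e : RExp} : Wp off V (.rset d e) v Q ↔
    e.Ok off V v ∧ Q (e.len + 2) (v.setR d (e.eval v)) :=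
  ⟨fun ⟨_, _, h, hQ⟩ => by cases h with | rset _ _ _ h => exact ⟨h, hQ⟩,
    fun h => ⟨_, _, .rset v d e h.1, h.2⟩⟩

@[simp] lemma wp_ist {j : ℕ} {i e : IExp} : Wp off V (.ist j i e) v Q ↔
    (i.Ok off V v ∧ e.Ok off V v ∧ j < 32 ∧ i.eval v ≤ V ∧ (j = 0 → i.eval v < off)) ∧
      Q (i.len + ((if j = 0 then 0 else 5) + (e.len + 1))) (v.stI j (i.eval v) (e.eval v)) :=
  ⟨fun ⟨_, _, h, hQ⟩ => by
    cases h with | ist _ _ _ _ h1 h2 h3 h4 h5 => exact ⟨⟨h1, h2, h3, h4, h5⟩, hQ⟩,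
    fun ⟨⟨h1, h2, h3, h4, h5⟩, hQ⟩ => ⟨_, _, .ist v j i e h1 h2 h3 h4 h5, hQ⟩⟩

@[simp] lemma wp_rst {j : ℕ} {i : IExp} {e : RExp} : Wp off V (.rst j i e) v Q ↔
    (i.Ok off V v ∧ e.Ok off V v ∧ j < 32 ∧ i.eval v ≤ V ∧ (j = 0 → i.eval v < off)) ∧
      Q (i.len + ((if j = 0 then 0 else 5) + (e.len + 1))) (v.stR j (i.eval v) (e.eval v)) :=
  ⟨fun ⟨_, _, h, hQ⟩ => by
    cases h with | rst _ _ _ _ h1 h2 h3 h4 h5 => exact ⟨⟨h1, h2, h3, h4, h5⟩, hQ⟩,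
    fun ⟨⟨h1, h2, h3, h4, h5⟩, hQ⟩ => ⟨_, _, .rst v j i e h1 h2 h3 h4 h5, hQ⟩⟩

@[simp] lemma wp_seq {a b : Cmd} : Wp off V (.seq a b) v Q ↔
    Wp off V a v (fun t₁ v₁ => Wp off V b v₁ (fun t₂ v₂ => Q (t₁ + t₂) v₂)) :=
  ⟨fun ⟨_, _, h, hQ⟩ => by
    cases h with | seq _ _ _ _ _ _ _ h1 h2 => exact ⟨_, _, h1, _, _, h2, hQ⟩,
    fun ⟨_, _, h1, _, _, h2, hQ⟩ => ⟨_, _, .seq _ _ _ _ _ _ _ h1 h2, hQ⟩⟩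

@[simp] lemma wp_ite {b : Cond} {x y : Cmd} : Wp off V (.ite b x y) v Q ↔
    b.Ok off V v ∧ (b.Holds v → Wp off V x v (fun t => Q (b.len + t))) ∧
      (¬ b.Holds v → Wp off V y v (fun t => Q (b.len + (t + 1)))) := by
  constructor
  · rintro ⟨_, _, h, hQ⟩
    cases h with
    | iteT _ _ _ _ _ _ hb h hx => exact ⟨hb, fun _ => ⟨_, _, hx, hQ⟩, fun h' => (h' h).elim⟩
    | iteF _ _ _ _ _ _ hb h hx => exact ⟨hb, fun h' => (h h').elim, fun _ => ⟨_, _, hx, hQ⟩⟩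
  · rintro ⟨hb, h1, h2⟩
    by_cases h : b.Holds v
    · obtain ⟨_, _, hx, hQ⟩ := h1 h
      exact ⟨_, _, .iteT _ _ _ _ _ _ hb h hx, hQ⟩
    · obtain ⟨_, _, hx, hQ⟩ := h2 h
      exact ⟨_, _, .iteF _ _ _ _ _ _ hb h hx, hQ⟩

lemma Wp.mono {c : Cmd} {Q' : ℕ → VState → Prop} (h : Wp off V c v Q)
    (hQ : ∀ t v', Q t v' → Q' t v') : Wp off V c v Q' := by
  obtain ⟨t, v', hx, h⟩ := h
  exact ⟨t, v', hx, hQ _ _ h⟩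

/-! ### Frames -/

namespace Cmd

/-- Integer registers that may be changed. -/
@[simp] def wI : Cmd → List ℕ
  | skip => []
  | iset d _ => [d]
  | rset _ _ => []
  | ist _ _ _ => []
  | rst _ _ _ => []
  | seq a b => a.wI ++ b.wI
  | ite _ x y => x.wI ++ y.wI
  | whl _ x => x.wI

/-- Real registers that may be changed. -/
@[simp] def wR : Cmd → List ℕ
  | skip => []
  | iset _ _ => []
  | rset d _ => [d]
  | ist _ _ _ => []
  | rst _ _ _ => []
  | seq a b => a.wR ++ b.wR
  | ite _ x y => x.wR ++ y.wR
  | whl _ x => x.wR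

/-- Integer arrays that may be changed. -/
@[simp] def wIM : Cmd → List ℕ
  | skip => []
  | iset _ _ => []
  | rset _ _ => []
  | ist j _ _ => [j]
  | rst _ _ _ => []
  | seq a b => a.wIM ++ b.wIM
  | ite _ x y => x.wIM ++ y.wIM
  | whl _ x => x.wIM

/-- Real arrays that may be changed. -/
@[simp] def wRM : Cmd → List ℕ
  | skip => []
  | iset _ _ => []
  | rset _ _ => []
  | ist _ _ _ => []
  | rst j _ _ => [j]
  | seq a b => a.wRM ++ b.wRM
  | ite _ x y => x.wRM ++ y.wRM
  | whl _ x => x.wRM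

end Cmd

/-- `v` and `v'` differ only in what `c` may change. -/
structure Fr (c : Cmd) (v v' : VState) : Prop where
  ir : ∀ d, d ∉ c.wI → v'.ir d = v.ir d
  rr : ∀ d, d ∉ c.wR → v'.rr d = v.rr d
  im : ∀ j, j ∉ c.wIM → v'.im j = v.im j
  rm : ∀ j, j ∉ c.wRM → v'.rm j = v.rm j

lemma Fr.refl (c : Cmd) (v : VState) : Fr c v v :=
  ⟨fun _ _ => rfl, fun _ _ => rfl, fun _ _ => rfl, fun _ _ => rfl⟩

lemma Fr.trans {c : Cmd} {v₁ v₂ v₃ : VState} (h : Fr c v₁ v₂) (h' : Fr c v₂ v₃) : Fr c v₁ v₃ :=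
  ⟨fun d hd => (h'.ir d hd).trans (h.ir d hd), fun d hd => (h'.rr d hd).trans (h.rr d hd),
    fun d hd => (h'.im d hd).trans (h.im d hd), fun d hd => (h'.rm d hd).trans (h.rm d hd)⟩

lemma Fr.of_subset {c c' : Cmd} {v₁ v₂ : VState} (h : Fr c v₁ v₂) (h1 : c.wI ⊆ c'.wI)
    (h2 : c.wR ⊆ c'.wR) (h3 : c.wIM ⊆ c'.wIM) (h4 : c.wRM ⊆ c'.wRM) : Fr c' v₁ v₂ :=
  ⟨fun d hd => h.ir d fun h => hd (h1 h), fun d hd => h.rr d fun h => hd (h2 h),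
    fun d hd => h.im d fun h => hd (h3 h), fun d hd => h.rm d fun h => hd (h4 h)⟩

/-- Whatever is not written syntactically is preserved. With this, specifications only have to
mention results, and everything else is recovered through `Wp.frame`. -/
lemma Exec.fr {c : Cmd} {t : ℕ} (h : Exec off V c v t v') : Fr c v v' := by
  induction h with
  | skip v => exact Fr.refl _ _
  | iset v d e h =>
    exact ⟨fun a ha => Function.update_of_ne (by simpa using ha) _ _, fun _ _ => rfl,
      fun _ _ => rfl, fun _ _ => rfl⟩
  | rset v d e h =>
    exact ⟨fun _ _ => rfl, fun a ha => Function.update_of_ne (by simpa using ha) _ _,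
      fun _ _ => rfl, fun _ _ => rfl⟩
  | ist v j i e =>
    exact ⟨fun _ _ => rfl, fun _ _ => rfl,
      fun a ha => Function.update_of_ne (by simpa using ha) _ _, fun _ _ => rfl⟩
  | rst v j i e =>
    exact ⟨fun _ _ => rfl, fun _ _ => rfl, fun _ _ => rfl,
      fun a ha => Function.update_of_ne (by simpa using ha) _ _⟩
  | seq a b v v₁ v₂ t₁ t₂ _ _ ih₁ ih₂ =>
    exact (ih₁.of_subset (by simp) (by simp) (by simp) (by simp)).trans
      (ih₂.of_subset (by simp) (by simp) (by simp) (by simp))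
  | iteT b x y v v' t hb h _ ih => exact ih.of_subset (by simp) (by simp) (by simp) (by simp)
  | iteF b x y v v' t hb h _ ih => exact ih.of_subset (by simp) (by simp) (by simp) (by simp)
  | whlF b x v hb h => exact Fr.refl _ _
  | whlT b x v v₁ v₂ t₁ t₂ hb h _ _ ih₁ ih₂ =>
    exact (ih₁.of_subset (by simp) (by simp) (by simp) (by simp)).trans ih₂

lemma Wp.frame {c : Cmd} (h : Wp off V c v Q) : Wp off V c v (fun t v' => Q t v' ∧ Fr c v v') := by
  obtain ⟨t, v', hx, h⟩ := h
  exact ⟨t, v', hx, h, hx.fr⟩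

/-- Loops: `I j` is an invariant in which `j` decreases with each iteration. -/
theorem wp_whl {b : Cond} {x : Cmd} (I : ℕ → VState → Prop) (m tb : ℕ) (h0 : I m v)
    (hok : ∀ j v', Fr x v v' → I j v' → b.Ok off V v')
    (step : ∀ j v', Fr x v v' → I j v' → b.Holds v' →
      Wp off V x v' (fun t v'' => t ≤ tb ∧ ∃ j' < j, I j' v''))
    (post : ∀ t j v', Fr x v v' → I j v' → ¬ b.Holds v' →
      t ≤ m * (tb + b.len + 1) + b.len + 1 → Q t v') :
    Wp off V (.whl b x) v Q := by
  suffices h : ∀ m v₁, Fr x v v₁ → I m v₁ → Wp off V (.whl b x) v₁ (fun t v' => ∃ j, Fr x v v' ∧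
      I j v' ∧ ¬ b.Holds v' ∧ t ≤ m * (tb + b.len + 1) + b.len + 1) by
    refine (h m v (Fr.refl _ _) h0).mono ?_
    rintro t v' ⟨j, h1, h2, h3, h4⟩
    exact post t j v' h1 h2 h3 h4
  intro m
  induction m using Nat.strong_induction_on with
  | _ m ih =>
    intro v₁ hf hI
    by_cases hb : b.Holds v₁
    · obtain ⟨t₁, v₂, hx, ht, j, hj, hI'⟩ := step m v₁ hf hI hb
      obtain ⟨t₂, v₃, hx', j', h1, h2, h3, h4⟩ := ih j hj v₂ (hf.trans hx.fr) hI'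
      refine ⟨_, _, .whlT _ _ _ _ _ _ _ (hok m v₁ hf hI) hb hx hx', j', h1, h2, h3, ?_⟩
      have : (j + 1) * (tb + b.len + 1) ≤ m * (tb + b.len + 1) := Nat.mul_le_mul_right _ hj
      rw [Nat.add_mul] at this
      omega
    · exact ⟨_, _, .whlF _ _ _ (hok m v₁ hf hI) hb, m, hf, hI, hb, by omega⟩

/-! ### Binary search -/

/-- Binary search between the registers `L` and `R`, with the midpoint in `M`; `test` sets the
register `F` to `0` if the search has to go on to the left, otherwise to a positive number. -/
def bsearch (L R M F : ℕ) (test : Cmd) : Cmd :=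
  .whl (.ile (.add (.r L) (.c 2)) (.r R))
    (.seq (.iset M (.div (.add (.r L) (.r R)) (.c 2)))
      (.seq test (.ite (.ile (.c 1) (.r F)) (.iset L (.r M)) (.iset R (.r M)))))

/-- `J a b` records what is known about the two ends. No monotonicity of the tested property is
needed: a test only has to establish what `J` says about the end that the midpoint replaces, and the
original ends may be untested sentinels. The exponent `j` in `b ≤ a + 2 ^ j` is the variant, so
there are at most `g` rounds. -/
theorem wp_bsearch {L R M F : ℕ} {test : Cmd} (J : ℕ → ℕ → VState → Prop) (g tt : ℕ)
    {lo hi : ℕ} (hL : v.ir L = lo) (hR : v.ir R = hi) (hg : hi ≤ lo + 2 ^ g)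
    (hV : 2 * hi + 2 ≤ V) (hV' : 2 * lo + 2 ≤ V) (hLR : L ≠ R) (hLM : L ≠ M) (hRM : R ≠ M)
    (hJ : J lo hi v)
    (stable : ∀ a b w d x, (d = L ∨ d = R ∨ d = M) → J a b w → J a b (w.setI d x))
    (htest : ∀ a b w, lo ≤ a → a + 2 ≤ b → b ≤ hi → J a b w → w.ir L = a → w.ir R = b →
      w.ir M = (a + b) / 2 →
      Fr (.seq (.iset L (.c 0)) (.seq (.iset R (.c 0)) (.seq (.iset M (.c 0)) test))) v w →
      Wp off V test w (fun t w' => t ≤ tt ∧ w'.ir L = a ∧ w'.ir R = b ∧ w'.ir M = (a + b) / 2 ∧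
        (1 ≤ w'.ir F → J ((a + b) / 2) b w') ∧ (w'.ir F = 0 → J a ((a + b) / 2) w')))
    (post : ∀ t w a b, Fr (bsearch L R M F test) v w → w.ir L = a → w.ir R = b → lo ≤ a → b ≤ hi →
      (b ≤ a + 1) → (lo < hi → a < b) → (hi ≤ lo → a = lo ∧ b = hi) →
      J a b w → t ≤ g * (tt + 26) + 8 → Q t w) :
    Wp off V (bsearch L R M F test) v Q := by
  refine wp_whl (fun j w => ∃ a b, w.ir L = a ∧ w.ir R = b ∧ lo ≤ a ∧ b ≤ hi ∧ b ≤ a + 2 ^ j ∧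
    (lo < hi → a < b) ∧ (hi ≤ lo → a = lo ∧ b = hi) ∧ J a b w) g (tt + 18) ?_ ?_ ?_ ?_
  · exact ⟨lo, hi, hL, hR, le_rfl, le_rfl, hg, id, fun _ => ⟨rfl, rfl⟩, hJ⟩
  · rintro j w - ⟨a, b, rfl, rfl, h1, h2, h3, h4, h5, h6⟩
    simp only [Cond.Ok, IExp.Ok, IExp.eval, and_true, true_and]
    by_cases h : lo < hi
    · have := h4 h; omega
    · have := h5 (by omega); omega
  · rintro j w hf ⟨a, b, ha, hb, h1, h2, h3, h4, h5, h6⟩ hc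
    simp only [Cond.Holds, IExp.eval, ha, hb] at hc
    have hjp : 0 < j := by
      rcases Nat.eq_zero_or_pos j with rfl | h
      · simp at h3; omega
      · exact h
    have hj2 : 2 ^ j = 2 * 2 ^ (j - 1) := by
      rw [← pow_succ']; congr 1; omega
    simp only [wp_seq, wp_iset, IExp.Ok, IExp.eval, ha, hb, IExp.len]
    refine ⟨⟨⟨trivial, trivial, by omega⟩, by omega⟩, ?_⟩
    refine (htest a b (w.setI M ((a + b) / 2)) h1 hc h2 (stable _ _ _ _ _ (by simp) h6)
      (by simp [hLM, ha]) (by simp [hRM, hb]) (by simp) ?_).mono ?_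
    · have hf' : Fr (.seq (.iset L (.c 0)) (.seq (.iset R (.c 0)) (.seq (.iset M (.c 0)) test))) v
          w := by
        refine hf.of_subset ?_ ?_ ?_ ?_ <;> simp [List.subset_def] <;> grind
      refine hf'.trans ⟨fun d hd => ?_, fun _ _ => rfl, fun _ _ => rfl, fun _ _ => rfl⟩
      simp at hd
      simp [hd]
    · rintro t w' ⟨ht, hL', hR', hM', k1, k2⟩
      simp only [wp_ite, Cond.Ok, IExp.Ok, IExp.eval, wp_iset, Cond.Holds, IExp.len, Cond.len]
      refine ⟨⟨by omega, trivial⟩, fun hF => ⟨trivial, by omega, j - 1, by omega, (a + b) / 2, b, ?_, ?_, ?_⟩,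
        fun hF => ⟨trivial, by omega, j - 1, by omega, a, (a + b) / 2, ?_, ?_, ?_⟩⟩
      · simp [hM']
      · simp [hLR.symm, hR']
      · exact ⟨by omega, by omega, by omega, by omega, by omega, stable _ _ _ _ _ (by simp) (k1 hF)⟩
      · simp [hLR, hL']
      · simp [hM']
      · exact ⟨by omega, by omega, by omega, by omega, by omega,
          stable _ _ _ _ _ (by simp) (k2 (by omega))⟩
  · rintro t j w hf ⟨a, b, ha, hb, h1, h2, h3, h4, h5, h6⟩ hc ht
    simp only [Cond.Holds, IExp.eval, ha, hb] at hc
    refine post t w a b (hf.of_subset (by simp [bsearch]) (by simp [bsearch]) (by simp [bsearch])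
      (by simp [bsearch])) ha hb h1 h2 (by omega) h4 h5 h6 ?_
    simp only [Cond.len, IExp.len] at ht
    have e : tt + 18 + (2 + (1 + 1) + (2 + 1)) + 1 = tt + 26 := by omega
    rw [e] at ht
    omega

/-! ### The machine program -/

/-- The start of the program: `k` is moved to the register of the variable `1`, and the offset of
the arrays is computed. -/
def prelude : Program := [.iadd 2 1 3, .iadd 1 0 1, .iadd 1 1 0, .iadd 1 1 0]

/-- The initial state of the structured program. -/
noncomputable def initState (N : PathNetwork) (k : ℕ) : VState where
  ir := fun d => if d = 0 then N.n else if d = 1 then k else 0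
  rr := fun d => if d = 0 then N.τ else 0
  im := fun _ _ => 0
  rm := fun j i => (N.input k).rmem (addr (3 * N.n + k) j i)

/-- The offset `3 * n + k` reserves enough cells for the input (`3 * n - 2` of them) and for the
output (`k` of them), which both are in array `0`. -/
theorem realize {N : PathNetwork} {k : ℕ} {c : Cmd}
    (h : Wp (3 * N.n + k) V c (initState N k) Q) :
    ∃ t v', Q t v' ∧
      (∀ m ≤ t + 4, (run (prelude ++ c.code 4) (N.input k) m).WordsLe
        (3 * N.n + k + 32 * V + 64)) ∧
      Halted (prelude ++ c.code 4) (run (prelude ++ c.code 4) (N.input k) (t + 4)) ∧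
      (run (prelude ++ c.code 4) (N.input k) (t + 4)).output k =
        fun j => ⟨v'.im 0 j, v'.rm 0 j⟩ := by
  obtain ⟨t, v', hx, hQ⟩ := h
  set P := prelude ++ c.code 4 with hP
  set off := 3 * N.n + k with hoff
  set B := off + 32 * V + 64
  have w0 : (N.input k).WordsLe B := fun a => by
    simp only [PathNetwork.input]
    refine ⟨?_, Nat.zero_le _⟩
    split_ifs <;> omega
  -- Register 3 is still zero, so this copies `k`.
  have k1 : Steps P B (N.input k) 1 (exec (N.input k) (.iadd 2 1 3)) :=
    Steps.one rfl w0 (wordsLe_setIReg w0 (by simp [PathNetwork.input]; omega))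
  have k2 := Steps.one (P := P) (i := .iadd 1 0 1) rfl k1.words (wordsLe_setIReg k1.words (by
    simp [PathNetwork.input, exec, State.setIReg]; omega))
  have k3 := Steps.one (P := P) (i := .iadd 1 1 0) rfl k2.words (wordsLe_setIReg k2.words (by
    simp [PathNetwork.input, exec, State.setIReg]; omega))
  have k4 := Steps.one (P := P) (i := .iadd 1 1 0) rfl k3.words (wordsLe_setIReg k3.words (by
    simp [PathNetwork.input, exec, State.setIReg]; omega))
  have K := ((k1.trans k2).trans k3).trans k4
  obtain ⟨s4, hs4⟩ : ∃ s4, s4 = exec (exec (exec (exec (N.input k) (.iadd 2 1 3)) (.iadd 1 0 1))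
    (.iadd 1 1 0)) (.iadd 1 1 0) := ⟨_, rfl⟩
  rw [← hs4] at K
  have hrel : Rel off V (initState N k) s4 := by
    refine ⟨fun d => ?_, ?_, fun d => ?_, fun j _ i _ => ?_, fun j _ i _ => ?_, K.words⟩
    · rw [hs4]
      simp only [exec, State.setIReg, Function.update_apply, PathNetwork.input, initState]
      have a1 : 2 * d ≠ 1 := by omega
      simp only [a1, if_false]
      rcases d with _ | _ | d
      · simp
      · simp
      · have : 2 * (d + 1 + 1) ≠ 2 := by omega
        simp
    · rw [hs4]
      simp [exec, State.setIReg, PathNetwork.input]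
      omega
    · rw [hs4]
      simp [exec, State.setIReg, PathNetwork.input, initState]
    · rw [hs4]
      simp [exec, State.setIReg, PathNetwork.input, initState]
    · rw [hs4]
      simp [exec, State.setIReg, initState, hoff]
  have hpc : s4.pc = 4 := by rw [hs4]; rfl
  obtain ⟨s5, k5, r5, p5⟩ := Cmd.code_spec (P := P) hx s4 (by
    rw [hpc]
    intro i hi
    rw [hP, List.getElem?_append_right (by simp [prelude])]
    simp [prelude, hi]) hrel
  have K' := K.trans k5
  have e : 1 + 1 + 1 + 1 + t = t + 4 := by omega
  rw [e] at K'
  refine ⟨t, v', hQ, K'.2, ?_, ?_⟩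
  · rw [K'.1, Halted, p5, hpc, hP]
    simp [prelude, Cmd.code_length]; omega
  · rw [K'.1]
    funext j
    have hj : (j : ℕ) < off := by have := j.2; omega
    have h1 := r5.im 0 (by omega) j (fun _ => hj)
    have h2 := r5.rm 0 (by omega) j (fun _ => hj)
    simp only [addr, if_true] at h1 h2
    simp [State.output, h1, h2]

end SinkRAM

/-! ### The fluid model reduced to maxima over pairs of a vertex and an edge. -/

namespace SinkRAM

/-! ## Evacuation to a point -/

section Plan

variable {q : ℕ} {ω κ δ : ℕ → ℝ} {T : ℝ}

open Finset

/-- What starts at stations up to `p` cannot have entered link `r` by the transit time from `p` to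
`r`. Until then the link has seen at most what starts after `p`. -/
lemma plan_le_arrived {F : ℕ → ℝ → ℝ} (h : IsEvacuationPlan q ω κ δ T F) {p r : ℕ}
    (hpr : p ≤ r) : r < q → ∀ t ≤ ∑ i ∈ Ico p r, δ i,
      F r t ≤ ∑ i ∈ range (r + 1), ω i - ∑ i ∈ range (p + 1), ω i := by
  induction r, hpr using Nat.le_induction with
  | base => intro hq t ht; rw [h.start p hq t (by simpa using ht)]; simp
  | succ r hr ih =>
    intro hq t ht
    rw [sum_Ico_succ_top hr] at ht
    have h1 := h.next r hq t
    have h2 := ih (by omega) (t - δ r) (by linarith)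
    rw [sum_range_succ _ (r + 1)]
    linarith

/-- Going back from the sink: everything that enters link `r + 1` either starts there or has come
through link `r`, so link `r` must have taken all its load early enough for the remaining transit.
-/
lemma plan_ge_left {F : ℕ → ℝ → ℝ} (h : IsEvacuationPlan q ω κ δ T F) :
    ∀ i r : ℕ, r + (i + 1) = q →
      ∑ i ∈ range (r + 1), ω i ≤ F r (T - ∑ i ∈ Ico r q, δ i) := by
  intro i
  induction i with
  | zero =>
    intro r hr
    have := h.complete r hr
    subst hr
    simp only [sum_Ico_succ_top le_rfl, Ico_self, sum_empty, zero_add]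
    exact this.ge
  | succ i ih =>
    intro r hr
    have h1 := ih (r + 1) (by omega)
    have h2 := h.next r (by omega) (T - ∑ i ∈ Ico (r + 1) q, δ i)
    rw [sum_range_succ] at h1
    rw [sum_eq_sum_Ico_succ_bot (by omega : r < q)]
    have e : T - (δ r + ∑ i ∈ Ico (r + 1) q, δ i) = T - ∑ i ∈ Ico (r + 1) q, δ i - δ r := by ring
    rw [e]
    linarith

theorem exists_plan_iff (hω : ∀ p < q, 0 < ω p) (hκ : ∀ p < q, 0 < κ p) :
    (∃ F, IsEvacuationPlan q ω κ δ T F) ↔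
      ∀ p r, p ≤ r → r < q →
        ∑ i ∈ range (p + 1), ω i ≤ κ r * (T - ∑ i ∈ Ico p q, δ i) := by
  have hW : ∀ p < q, 0 < ∑ i ∈ range (p + 1), ω i := fun p hp =>
    sum_pos (fun i hi => hω i (by simp at hi; omega)) ⟨0, by simp⟩
  constructor
  · rintro ⟨F, h⟩ p r hpr hr
    have h1 := plan_le_arrived h hpr hr _ le_rfl
    have h2 := plan_ge_left h (q - r - 1) r (by omega)
    have h3 := hW p (by omega)
    have h4 := sum_Ico_consecutive δ hpr hr.le
    rcases le_total (∑ i ∈ Ico p r, δ i) (T - ∑ i ∈ Ico r q, δ i) with h5 | h5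
    · have h6 := h.capacity r hr _ _ h5
      have e : T - ∑ i ∈ Ico p q, δ i = T - ∑ i ∈ Ico r q, δ i - ∑ i ∈ Ico p r, δ i := by
        rw [← h4]; ring
      rw [e]
      linarith
    -- The window has no positive length. Monotonicity then forces the weight of `0, …, p` to be at
    -- most zero, which is false.
    · have h6 := h.mono r hr h5
      linarith
  · intro h
    set W : ℕ → ℝ := fun p => ∑ i ∈ range (p + 1), ω i with hWd
    set X : ℕ → ℝ := fun p => T - ∑ i ∈ Ico p q, δ i with hX
    -- The bottleneck from `p` on. The initial value `κ p` of the fold does no harm, since `p`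
    -- itself is in the range.
    set c : ℕ → ℝ := fun p => (Ico p q).fold min (κ p) κ with hc
    have cle : ∀ p r, p ≤ r → r < q → c p ≤ κ r := fun p r hpr hr =>
      ((le_fold_min _).1 le_rfl : c p ≤ κ p ∧ _).2 r (by simp [hpr, hr])
    have cmono : ∀ p, p + 1 < q → c p ≤ c (p + 1) := fun p hp =>
      (le_fold_min _).2 ⟨cle _ _ (by omega) hp, fun r hr => by
        simp at hr; exact cle _ _ (by omega) hr.2⟩
    have cpos : ∀ p < q, 0 < c p := fun p hp =>
      (lt_fold_min _).2 ⟨hκ p hp, fun r hr => by simp at hr; exact hκ r hr.2⟩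
    have Xpos : ∀ p < q, 0 < X p := fun p hp =>
      pos_of_mul_pos_right ((hW p hp).trans_le (h p p le_rfl hp)) (hκ p hp).le
    have Wle : ∀ p < q, W p ≤ c p * X p := fun p hp => by
      rw [← div_le_iff₀ (Xpos p hp)]
      refine (le_fold_min _).2 ⟨?_, fun r hr => ?_⟩
      · rw [div_le_iff₀ (Xpos p hp)]; exact h p p le_rfl hp
      · simp at hr
        rw [div_le_iff₀ (Xpos p hp)]; exact h p r hr.1 hr.2
    have Xs : ∀ p, p + 1 < q → X (p + 1) = X p + δ p := fun p hp => by
      simp only [hX]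
      rw [sum_eq_sum_Ico_succ_bot (by omega : p < q)]; ring
    have Ws : ∀ p, W (p + 1) = W p + ω (p + 1) := fun p => sum_range_succ _ _
    -- Link `p` is fed at the constant rate `c p`, so as to finish exactly at the latest departure
    -- time `X p`. By `Wle` this begins no earlier than time zero. Since `c` is nondecreasing along
    -- the path and the times `X` differ by the transit times, each link is supplied in time by its
    -- predecessor.
    refine ⟨fun p t => max 0 (W p - c p * max 0 (X p - t)), ?_, ?_, ?_, ?_, ?_, ?_⟩
    · intro p hp t ht
      have h1 := Xpos p hp
      have h2 : max 0 (X p - t) = X p - t := max_eq_right (by linarith)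
      simp only [h2]
      exact max_eq_left (by nlinarith [cpos p hp, Wle p hp])
    · intro p hp t t' htt'
      refine max_le_max le_rfl (sub_le_sub_left (mul_le_mul_of_nonneg_left
        (max_le_max le_rfl (by linarith)) (cpos p hp).le) _)
    · intro p hp t t' htt'
      have h1 := cle p p le_rfl hp
      have h2 := cpos p hp
      have h3 : max 0 (X p - t) ≤ max 0 (X p - t') + (t' - t) := by
        rcases le_total 0 (X p - t) with h | h
        · rw [max_eq_right h]; linarith [le_max_right 0 (X p - t')]
        · rw [max_eq_left h]; linarith [le_max_left 0 (X p - t')]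
      have h4 : c p * max 0 (X p - t) ≤ c p * max 0 (X p - t') + κ p * (t' - t) := by
        nlinarith
      have h5 : 0 ≤ κ p * (t' - t) := mul_nonneg (hκ p hp).le (by linarith)
      have h6 : max 0 (W p - c p * max 0 (X p - t')) ≤
          max 0 (W p - c p * max 0 (X p - t)) + κ p * (t' - t) := by
        refine max_le ?_ ?_
        · linarith [le_max_left 0 (W p - c p * max 0 (X p - t))]
        · linarith [le_max_right 0 (W p - c p * max 0 (X p - t))]
      linarith
    · intro hq t
      have h1 : W 0 = ω 0 := by simp [hWd]
      refine max_le (hω 0 hq).le ?_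
      rw [← h1]
      nlinarith [cpos 0 hq, le_max_left 0 (X 0 - t)]
    · intro p hp t
      have h1 : X (p + 1) - t = X p - (t - δ p) := by rw [Xs p hp]; ring
      simp only [h1]
      have h2 := le_max_left 0 (X p - (t - δ p))
      have h3 := le_max_left 0 (W p - c p * max 0 (X p - (t - δ p)))
      have h4 := le_max_right 0 (W p - c p * max 0 (X p - (t - δ p)))
      have h5 := mul_le_mul_of_nonneg_right (cmono p hp) h2
      refine max_le ?_ ?_
      · linarith [(hω (p + 1) hp).le]
      · rw [Ws]; linarith
    · intro p hp
      have h1 : X p = T - δ p := by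
        subst hp; simp [hX]
      have h2 := hW p (by omega)
      subst hp
      simp only [h1, sub_self, max_self, mul_zero, sub_zero]
      exact max_eq_right h2.le

end Plan

/-! ## The two directions of a path -/

section Sides

open Finset

variable (N : PathNetwork)

/-- Weights, read from the left (`d = 0`) or from the right. -/
def wt (d i : ℕ) : ℕ := if d = 0 then N.weight i else N.weight (N.n - 1 - i)

/-- Transit times of the edges, read from the left or from the right. -/
noncomputable def dl (d i : ℕ) : ℝ := N.τ * if d = 0 then N.len i else N.len (N.n - 2 - i)

/-- Inverse capacities, read from the left or from the right. -/
noncomputable def uc (d i : ℕ) : ℝ := 1 / if d = 0 then N.cap i else N.cap (N.n - 2 - i)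

noncomputable def Sw (d i : ℕ) : ℝ := ∑ v ∈ range i, (wt N d v : ℝ)

noncomputable def Dl (d i : ℕ) : ℝ := ∑ e ∈ range i, dl N d e

/-- Time to evacuate the vertices `a, …, m - 1` to the vertex `m` (in direction `d`). -/
noncomputable def Lt (d a m : ℕ) : ℝ :=
  ((range m ×ˢ range m).filter fun x => a ≤ x.1 ∧ x.1 ≤ x.2).fold max 0
    fun x => (Sw N d (x.1 + 1) - Sw N d a) * uc N d x.2 + (Dl N d m - Dl N d x.1)

lemma Lt_le_iff {d a m : ℕ} {T : ℝ} : Lt N d a m ≤ T ↔ 0 ≤ T ∧ ∀ p r, a ≤ p → p ≤ r → r < m →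
    (Sw N d (p + 1) - Sw N d a) * uc N d r + (Dl N d m - Dl N d p) ≤ T := by
  unfold Lt
  rw [fold_max_le]
  refine and_congr_right fun _ => ⟨fun h p r h1 h2 h3 => h (p, r) ?_, fun h x hx => ?_⟩
  · simp; omega
  · simp at hx
    exact h _ _ hx.2.1 hx.2.2 hx.1.2

/-- Time to evacuate the vertices `m + 1, …, b` to the vertex `m`. -/
noncomputable def Rt (m b : ℕ) : ℝ := Lt N 1 (N.n - 1 - b) (N.n - 1 - m)

lemma dl_nonneg {d i : ℕ} (h : i + 1 < N.n) : 0 ≤ dl N d i := by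
  unfold dl; split_ifs <;> exact mul_nonneg N.τ_pos.le (N.len_nonneg _ (by omega))

lemma uc_pos {d i : ℕ} (h : i + 1 < N.n) : 0 < uc N d i := by
  unfold uc; split_ifs <;> exact one_div_pos.2 (N.cap_pos _ (by omega))

lemma Sw_mono {d i j : ℕ} (h : i ≤ j) : Sw N d i ≤ Sw N d j :=
  sum_le_sum_of_subset_of_nonneg (range_mono h) (fun _ _ _ => by positivity)

lemma Dl_mono {d i j : ℕ} (h : i ≤ j) (hj : j < N.n) : Dl N d i ≤ Dl N d j :=
  sum_le_sum_of_subset_of_nonneg (range_mono h) (fun e he _ => by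
    simp at he; exact dl_nonneg N (by omega))

lemma sum_reverse (f : ℕ → ℝ) {M i : ℕ} (h : i ≤ M) :
    ∑ v ∈ range i, f (M - 1 - v) = ∑ v ∈ range M, f v - ∑ v ∈ range (M - i), f v := by
  induction i with
  | zero => simp
  | succ i ih =>
    rw [sum_range_succ, ih (by omega)]
    have : M - i = (M - (i + 1)) + 1 := by omega
    rw [this, sum_range_succ]
    have : M - 1 - i = M - (i + 1) := by omega
    rw [this]; ring

lemma Sw_one {i : ℕ} (h : i ≤ N.n) : Sw N 1 i = Sw N 0 N.n - Sw N 0 (N.n - i) :=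
  sum_reverse (fun v => (N.weight v : ℝ)) h

lemma Dl_one {i : ℕ} (h : i ≤ N.n - 1) :
    Dl N 1 i = Dl N 0 (N.n - 1) - Dl N 0 (N.n - 1 - i) :=
  sum_reverse (fun e => N.τ * N.len e) h

/-- The reflection sends vertex `i` to `n - 1 - i` and edge `i` to `n - 2 - i`. Prefix sums from the
right become differences of prefix sums from the left. -/
lemma Rt_le_iff {m b : ℕ} (hb : b < N.n) {T : ℝ} :
    Rt N m b ≤ T ↔ 0 ≤ T ∧ ∀ v e, m ≤ e → e < v → v ≤ b →
      (Sw N 0 (b + 1) - Sw N 0 v) * uc N 0 e + (Dl N 0 v - Dl N 0 m) ≤ T := by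
  unfold Rt
  rw [Lt_le_iff]
  refine and_congr_right fun _ => ⟨fun h v e h1 h2 h3 => ?_, fun h p r h1 h2 h3 => ?_⟩
  · have := h (N.n - 1 - v) (N.n - 2 - e) (by omega) (by omega) (by omega)
    rw [Sw_one N (by omega), Sw_one N (by omega), Dl_one N (by omega), Dl_one N (by omega)] at this
    have e1 : N.n - (N.n - 1 - v + 1) = v := by omega
    have e2 : N.n - (N.n - 1 - b) = b + 1 := by omega
    have e3 : N.n - 1 - (N.n - 1 - m) = m := by omega
    have e4 : N.n - 1 - (N.n - 1 - v) = v := by omega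
    have e5 : uc N 1 (N.n - 2 - e) = uc N 0 e := by
      unfold uc; simp; congr; omega
    rw [e1, e2, e3, e4, e5] at this
    linarith
  · have := h (N.n - 1 - p) (N.n - 2 - r) (by omega) (by omega) (by omega)
    rw [Sw_one N (by omega), Sw_one N (by omega), Dl_one N (by omega), Dl_one N (by omega)]
    have e1 : N.n - (p + 1) = N.n - 1 - p := by omega
    have e2 : N.n - (N.n - 1 - b) = b + 1 := by omega
    have e3 : N.n - 1 - (N.n - 1 - m) = m := by omega
    have e5 : uc N 1 r = uc N 0 (N.n - 2 - r) := by
      unfold uc; simp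
    rw [e1, e2, e3, e5]
    linarith

lemma Lt_nonneg {d a m : ℕ} : 0 ≤ Lt N d a m := ((Lt_le_iff N).1 le_rfl).1

lemma Rt_nonneg {m b : ℕ} : 0 ≤ Rt N m b := Lt_nonneg N

/-- Position of a point, measured by the transit time from the vertex `0`. -/
noncomputable def pos (s : Location) : ℝ := Dl N 0 s.idx + s.frac * dl N 0 s.idx

lemma le_cap_mul_iff {x y c : ℝ} (hc : 0 < c) : x ≤ c * y ↔ x * (1 / c) ≤ y := by
  rw [mul_one_div, div_le_iff₀ hc, mul_comm]

open Classical in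
-- A sink inside an edge adds this edge as a last link, with its full capacity and a prorated
-- transit time. Measured by `pos`, both kinds of sinks obey one formula and differ only in the
-- range of `r`.
lemma leftEvacuates_iff {a : ℕ} {s : Location} {T : ℝ} (hs : N.OnPath s) :
    N.LeftEvacuates a s T ↔ ∀ p r, a ≤ p → p ≤ r → r < (if s.frac = 0 then s.idx else s.idx + 1) →
      (Sw N 0 (p + 1) - Sw N 0 a) * uc N 0 r + (pos N s - Dl N 0 p) ≤ T := by
  obtain ⟨h1, h2, h3, h4⟩ := hs
  set q := if s.frac = 0 then s.idx - a else s.idx + 1 - a with hq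
  have hqn : ∀ p < q, a + p + 1 < N.n := fun p hp => by
    by_cases h : s.frac = 0
    · simp [hq, h] at hp; omega
    · simp [hq, h] at hp; have := h4 h; omega
  unfold PathNetwork.LeftEvacuates
  rw [exists_plan_iff (fun p hp => by exact_mod_cast N.weight_pos _ (by have := hqn p hp; omega))
    (fun p hp => N.cap_pos _ (hqn p hp))]
  have hS : ∀ p, ∑ i ∈ range (p + 1), (N.weight (a + i) : ℝ) = Sw N 0 (a + p + 1) - Sw N 0 a := by
    intro p
    have := sum_range_add (fun v => (wt N 0 v : ℝ)) a (p + 1)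
    simp only [Sw]
    rw [add_assoc, this]
    simp [wt]
  have hD : ∀ p < q, ∑ i ∈ Ico p q,
      N.τ * (if a + i = s.idx then s.frac * N.len (a + i) else N.len (a + i)) =
      pos N s - Dl N 0 (a + p) := by
    intro p hp
    have key : ∀ x y, x ≤ y → a + y ≤ s.idx → ∑ i ∈ Ico x y,
      N.τ * (if a + i = s.idx then s.frac * N.len (a + i) else N.len (a + i)) =
      Dl N 0 (a + y) - Dl N 0 (a + x) := by
      intro x y hxy hy
      induction y, hxy using Nat.le_induction with
      | base => simp
      | succ y hxy ih =>
        rw [sum_Ico_succ_top hxy, ih (by omega), if_neg (by omega), ← add_assoc]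
        simp only [Dl]
        rw [sum_range_succ _ (a + y)]
        simp only [dl, if_true]; ring
    by_cases h : s.frac = 0
    · simp only [hq, h, if_true] at hp ⊢
      have := key p (s.idx - a) hp.le (by omega)
      rw [h] at this
      rw [this]
      have : a + (s.idx - a) = s.idx := by omega
      simp [pos, h, this]
    · simp only [hq, h, if_false] at hp ⊢
      have e : s.idx + 1 - a = (s.idx - a) + 1 := by omega
      have e' : a + (s.idx - a) = s.idx := by omega
      rw [e, sum_Ico_succ_top (by omega), key p _ (by omega) (by omega), e']
      simp only [if_true, pos, dl]; ring
  constructor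
  · intro h p r hap hpr hr
    have hr' : r - a < q := by rw [hq]; split_ifs at hr ⊢ <;> omega
    have := h (p - a) (r - a) (by omega) hr'
    rw [hS, hD _ (by omega)] at this
    have e1 : a + (p - a) = p := by omega
    have e2 : a + (r - a) = r := by omega
    rw [e1, e2, le_cap_mul_iff (N.cap_pos _ (by have := hqn _ hr'; omega))] at this
    simp only [uc, if_true]
    linarith
  · intro h p r hpr hr
    have hr' : a + r < if s.frac = 0 then s.idx else s.idx + 1 := by
      rw [hq] at hr; split_ifs at hr ⊢ <;> omega
    have := h (a + p) (a + r) (by omega) (by omega) hr'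
    rw [hS, hD _ (by omega), le_cap_mul_iff (N.cap_pos _ (hqn _ hr))]
    simp only [uc, if_true] at this
    linarith

open Classical in
-- There is no case distinction as on the left: the edge `s.idx` is always the last link used, and
-- `1 - s.frac` is the whole edge if the sink is at its left end.
lemma rightEvacuates_iff {b : ℕ} {s : Location} {T : ℝ} (hb : b < N.n) :
    N.RightEvacuates b s T ↔ ∀ v e, s.idx ≤ e → e < v → v ≤ b →
      (Sw N 0 (b + 1) - Sw N 0 v) * uc N 0 e + (Dl N 0 v - pos N s) ≤ T := by
  unfold PathNetwork.RightEvacuates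
  rw [exists_plan_iff (fun p hp => by exact_mod_cast N.weight_pos _ (by omega))
    (fun p hp => N.cap_pos _ (by omega))]
  have hS : ∀ p ≤ b, ∑ i ∈ range (p + 1), (N.weight (b - i) : ℝ) =
      Sw N 0 (b + 1) - Sw N 0 (b - p) := by
    intro p hp
    have := sum_reverse (fun v => (N.weight v : ℝ)) (M := b + 1) (i := p + 1) (by omega)
    simp only [Nat.add_sub_cancel] at this
    rw [this]
    have : b + 1 - (p + 1) = b - p := by omega
    rw [this]
    simp [Sw, wt]
  have hD : ∀ p < b - s.idx, ∑ i ∈ Ico p (b - s.idx),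
      N.τ * (if b - i - 1 = s.idx then (1 - s.frac) * N.len (b - i - 1) else N.len (b - i - 1)) =
      Dl N 0 (b - p) - pos N s := by
    intro p hp
    have key : ∀ x y, x ≤ y → y < b - s.idx → ∑ i ∈ Ico x y,
        N.τ * (if b - i - 1 = s.idx then (1 - s.frac) * N.len (b - i - 1)
          else N.len (b - i - 1)) = Dl N 0 (b - x) - Dl N 0 (b - y) := by
      intro x y hxy hy
      induction y, hxy using Nat.le_induction with
      | base => simp
      | succ y hxy ih =>
        rw [sum_Ico_succ_top hxy, ih (by omega), if_neg (by omega)]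
        have e : b - y = (b - (y + 1)) + 1 := by omega
        simp only [Dl]
        rw [e, sum_range_succ _ (b - (y + 1))]
        simp only [dl, if_true, Nat.add_sub_cancel]; ring
    have e : b - s.idx = (b - s.idx - 1) + 1 := by omega
    have e' : b - (b - s.idx - 1) = s.idx + 1 := by omega
    rw [e, sum_Ico_succ_top (by omega), key p _ (by omega) (by omega), e']
    simp only [Nat.add_sub_cancel, if_true, pos, Dl]
    rw [sum_range_succ _ s.idx]
    simp only [dl, if_true]; ring
  constructor
  · intro h v e h1 h2 h3
    have := h (b - v) (b - 1 - e) (by omega) (by omega)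
    rw [hS _ (by omega), hD _ (by omega), le_cap_mul_iff (N.cap_pos _ (by omega))] at this
    have e1 : b - (b - v) = v := by omega
    have e2 : b - (b - 1 - e) - 1 = e := by omega
    rw [e1, e2] at this
    simp only [uc, if_true]
    linarith
  · intro h p r hpr hr
    have := h (b - p) (b - r - 1) (by omega) (by omega) (by omega)
    rw [hS _ (by omega), hD _ (by omega), le_cap_mul_iff (N.cap_pos _ (by omega))]
    simp only [uc, if_true] at this
    linarith

end Sides

end SinkRAM

namespace SinkRAM

/-! ## The greedy division of the path -/

section Greedy

variable (N : PathNetwork)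

/-- Bound for the time in which a sink between the vertices `m` and `m + 1` can serve `a, …, b`,
provided that the vertex `m + 1` cannot do so. -/
noncomputable def Vt (a m b : ℕ) : ℝ :=
  min (Rt N m b) ((Lt N 0 a (m + 1) + Rt N m b - (Dl N 0 (m + 1) - Dl N 0 m)) / 2)

/-- In time `T`, the longest subpath from `a` that can be served by one sink is `a, …, b`, and the
sink is at `m` or between `m` and `m + 1`. -/
structure GStep (T : ℝ) (a m b : ℕ) : Prop where
  am : a ≤ m
  mb : m ≤ b
  bn : b < N.n
  left : Lt N 0 a m ≤ T
  left' : m + 1 < N.n → T < Lt N 0 a (m + 1)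
  right : m < b → Vt N a m b ≤ T
  right' : b + 1 < N.n → T < Vt N a m (b + 1)

open Classical in
/-- The sink for the subpath `a, …, b`. -/
noncomputable def sinkAt (T : ℝ) (a m b : ℕ) : Location :=
  if Rt N m b ≤ T then ⟨m, 0⟩
  else ⟨m, (T - Lt N 0 a (m + 1) + (Dl N 0 (m + 1) - Dl N 0 m)) / (Dl N 0 (m + 1) - Dl N 0 m)⟩

variable {N}

lemma Dl_succ {d i : ℕ} : Dl N d (i + 1) = Dl N d i + dl N d i := by
  simp [Dl, Finset.sum_range_succ]

lemma Rt_self {m b : ℕ} {T : ℝ} (h : 0 ≤ T) (hb : b < N.n) (hm : b ≤ m) : Rt N m b ≤ T :=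
  (Rt_le_iff N hb).2 ⟨h, fun v e h1 h2 h3 => by omega⟩

/-- If the vertex `m` is too slow for the right part, the sink goes as far right of `m` as the left
part permits, namely to transit time `Lt N 0 a (m + 1) - T` before `m + 1`. The right part then
arrives in time because of the mean in `Vt`. -/
lemma GStep.onPath {T : ℝ} {a m b : ℕ} (h : GStep N T a m b) (hT : 0 ≤ T) :
    N.OnPath (sinkAt N T a m b) ∧ N.Evacuates a b (sinkAt N T a m b) T := by
  classical
  have hmn : m < N.n := lt_of_le_of_lt h.mb h.bn
  unfold sinkAt
  split_ifs with hR
  · have hon : N.OnPath ⟨m, 0⟩ := ⟨hmn, le_rfl, one_pos, fun h => (h rfl).elim⟩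
    refine ⟨hon, hT, ?_, ?_, ?_, ?_⟩
    · simp [Location.coord, h.am]
    · simp [Location.coord, h.mb]
    · rw [leftEvacuates_iff N hon]
      have := ((Lt_le_iff N).1 h.left).2
      simpa [pos] using this
    · rw [rightEvacuates_iff N h.bn]
      have := ((Rt_le_iff N h.bn).1 hR).2
      simpa [pos] using this
  · have hmb : m < b := by
      by_contra hc
      exact hR (Rt_self hT h.bn (by omega))
    have h1 := h.right hmb
    have h2 := h.left' (by have := h.bn; omega)
    rw [Vt, min_le_iff] at h1
    replace h1 := h1.resolve_left hR
    push Not at hR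
    set A := Lt N 0 a (m + 1)
    set lam := Dl N 0 (m + 1) - Dl N 0 m with hlam
    have hdl : dl N 0 m = lam := by rw [hlam, Dl_succ]; ring
    have h3 : A - lam < T := by linarith
    have hpos : 0 < lam := by linarith
    -- The point is strictly inside the edge: it is off `m` since `Rt` exceeds `T` while the mean in
    -- `Vt` does not, and off `m + 1` by `left'`.
    have f0 : 0 < (T - A + lam) / lam := div_pos (by linarith) hpos
    have f1 : (T - A + lam) / lam < 1 := by rw [div_lt_one hpos]; linarith
    have hp : pos N ⟨m, (T - A + lam) / lam⟩ = Dl N 0 (m + 1) + T - A := by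
      simp only [pos, hdl]
      rw [div_mul_cancel₀ _ hpos.ne']
      rw [hlam]; ring
    have hon : N.OnPath ⟨m, (T - A + lam) / lam⟩ :=
      ⟨hmn, f0.le, f1, fun _ => by have := h.bn; simp only; omega⟩
    refine ⟨hon, hT, ?_, ?_, ?_, ?_⟩
    · have : (a : ℝ) ≤ m := by exact_mod_cast h.am
      simp only [Location.coord]; linarith
    · have : (m : ℝ) + 1 ≤ b := by exact_mod_cast hmb
      simp only [Location.coord]; linarith
    · rw [leftEvacuates_iff N hon, hp]
      have := ((Lt_le_iff N (d := 0) (a := a) (m := m + 1) (T := A)).1 le_rfl).2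
      intro p r h4 h5 h6
      rw [if_neg f0.ne'] at h6
      have := this p r h4 h5 h6
      linarith
    · rw [rightEvacuates_iff N h.bn, hp]
      have := ((Rt_le_iff N h.bn (m := m) (T := Rt N m b)).1 le_rfl).2
      intro v e h4 h5 h6
      have := this v e h4 h5 h6
      linarith

lemma evacuates_mono {a b : ℕ} {s : Location} {T T' : ℝ} (hs : N.OnPath s) (hb : b < N.n)
    (h : N.Evacuates a b s T) (hT : T ≤ T') : N.Evacuates a b s T' := by
  obtain ⟨h0, h1, h2, h3, h4⟩ := h
  refine ⟨h0.trans hT, h1, h2, ?_, ?_⟩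
  · rw [leftEvacuates_iff N hs] at h3 ⊢
    exact fun p r a1 a2 a3 => (h3 p r a1 a2 a3).trans hT
  · rw [rightEvacuates_iff N hb] at h4 ⊢
    exact fun p r a1 a2 a3 => (h4 p r a1 a2 a3).trans hT

/-- No subpath that starts before `g` and can be served reaches farther than the greedy one. -/
lemma GStep.le {T : ℝ} {g m b : ℕ} (h : GStep N T g m b) {a b' : ℕ} {s : Location}
    (hs : N.OnPath s) (hb' : b' < N.n) (hag : a ≤ g) (he : N.Evacuates a b' s T) : b' ≤ b := by
  classical
  by_contra hbb
  push Not at hbb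
  have h1 := h.right' (by omega)
  rw [Vt, lt_min_iff] at h1
  obtain ⟨h1, h2⟩ := h1
  have hmb := h.mb
  have h3 := h.left' (by omega)
  obtain ⟨hT, he1, he2, he3, he4⟩ := he
  rw [leftEvacuates_iff N hs] at he3
  rw [rightEvacuates_iff N hb'] at he4
  obtain ⟨hs1, hs2, hs3, hs4⟩ := hs
  have hposle : s.idx + 1 < N.n → pos N s ≤ Dl N 0 (s.idx + 1) := fun h => by
    rw [Dl_succ, pos]
    nlinarith [dl_nonneg N (d := 0) h]
  have hposge : Dl N 0 s.idx ≤ pos N s := by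
    rw [pos]
    by_cases h : s.frac = 0
    · simp [h]
    · nlinarith [dl_nonneg N (d := 0) (hs4 h)]
  -- Evacuating to `m` instead of `s` costs at most `c` more. Forgetting the vertices beyond `b + 1`
  -- only reduces the load on every edge. On the left, `left_le` does the same with `m + 1` and with
  -- the vertices before `g`.
  have right_le : ∀ c, s.idx ≤ m → pos N s - Dl N 0 m ≤ c → 0 ≤ T + c →
      Rt N m (b + 1) ≤ T + c := by
    intro c h4 h5 h6
    rw [Rt_le_iff N (by omega)]
    refine ⟨h6, fun v e a1 a2 a3 => ?_⟩
    have := he4 v e (by omega) a2 (by omega)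
    have h7 : Sw N 0 (b + 1 + 1) ≤ Sw N 0 (b' + 1) := Sw_mono N (by omega)
    have h8 := mul_le_mul_of_nonneg_right (sub_le_sub_right h7 (Sw N 0 v))
      (uc_pos N (d := 0) (i := e) (by omega)).le
    linarith
  have left_le : ∀ c, (m < if s.frac = 0 then s.idx else s.idx + 1) →
      Dl N 0 (m + 1) - pos N s ≤ c → 0 ≤ T + c → Lt N 0 g (m + 1) ≤ T + c := by
    intro c h4 h5 h6
    rw [Lt_le_iff]
    refine ⟨h6, fun p r a1 a2 a3 => ?_⟩
    have := he3 p r (by omega) a2 (by omega)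
    have h7 : Sw N 0 a ≤ Sw N 0 g := Sw_mono N hag
    have h8 := mul_le_mul_of_nonneg_right (sub_le_sub_left h7 (Sw N 0 (p + 1)))
      (uc_pos N (d := 0) (i := r) (by omega)).le
    linarith
  -- Suppose vertex `b + 1` were served. A sink at or to the left of `m` would bound `Rt N m (b +
  -- 1)` by `T`. A sink inside edge `m` would bound the mean in `Vt`, since the two shifts add up to
  -- the whole edge. A sink at or beyond `m + 1` would bound `Lt N 0 g (m + 1)` by `T`.
  rcases lt_trichotomy s.idx m with h4 | h4 | h4
  · have h5 := hposle (by omega)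
    have h6 := Dl_mono N (d := 0) (show s.idx + 1 ≤ m by omega) (by omega)
    have := right_le 0 h4.le (by linarith) (by linarith)
    linarith
  · by_cases hf : s.frac = 0
    · have := right_le 0 h4.le (by rw [pos, hf, h4]; simp) (by linarith)
      linarith
    · have hd := dl_nonneg N (d := 0) (show m + 1 < N.n by omega)
      have hD : Dl N 0 (m + 1) = Dl N 0 m + dl N 0 m := Dl_succ
      have hp : pos N s = Dl N 0 m + s.frac * dl N 0 m := by rw [pos, h4]
      have h5 := right_le (s.frac * dl N 0 m) h4.le (by rw [hp]; linarith)
        (by nlinarith)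
      have h6 := left_le ((1 - s.frac) * dl N 0 m) (by rw [if_neg hf]; omega)
        (by rw [hp, hD]; linarith) (by nlinarith)
      linarith
  · have h5 := Dl_mono N (d := 0) (show m + 1 ≤ s.idx by omega) hs1
    have := left_le 0 (by split_ifs <;> omega) (by linarith) (by linarith)
    linarith

/-! ### Comparison of greedy and arbitrary divisions. -/

/-- After `j` greedy steps, the vertices before `a` are served. -/
inductive Reach (N : PathNetwork) (T : ℝ) : ℕ → ℕ → Prop
  | zero : Reach N T 0 0
  | step {j a m b : ℕ} (h : Reach N T j a) (g : GStep N T a m b) : Reach N T (j + 1) (b + 1)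
  | stay {j a : ℕ} (h : Reach N T j a) (g : N.n ≤ a) : Reach N T (j + 1) a

/-- `k` sinks can serve the path in time `T`. -/
def Feas (N : PathNetwork) (k : ℕ) (T : ℝ) : Prop :=
  ∃ S : Fin k → Location, (∀ j, N.OnPath (S j)) ∧ N.SinksEvacuate S T

lemma sinksEvacuate_mono {k : ℕ} {S : Fin k → Location} (hS : ∀ j, N.OnPath (S j)) {T T' : ℝ}
    (h : N.SinksEvacuate S T) (hT : T ≤ T') : N.SinksEvacuate S T' := by
  obtain ⟨a, b, h1, h2⟩ := h
  exact ⟨a, b, h1, fun j hj => ⟨(h2 j hj).1, evacuates_mono (hS j) (h2 j hj).1 (h2 j hj).2 hT⟩⟩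

lemma Feas.mono {k : ℕ} {T T' : ℝ} (h : Feas N k T) (hT : T ≤ T') : Feas N k T' := by
  obtain ⟨S, hS, h⟩ := h
  exact ⟨S, hS, sinksEvacuate_mono hS h hT⟩

lemma Feas.nonneg {k : ℕ} {T : ℝ} (h : Feas N k T) : 0 ≤ T := by
  obtain ⟨S, hS, a, b, h1, h2⟩ := h
  obtain ⟨j, ⟨h3, h4⟩, -⟩ := h1 0 N.n_pos
  exact (h2 j (h3.trans h4)).2.1

/-- By induction, when the greedy algorithm stands at a vertex `a` of the path after `j` steps, at
least `j` nonempty subpaths of any feasible division end before `a`: the subpath that contains the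
start of a greedy step is a new one, and by `GStep.le` it ends no later than the step. For `j = k`
all subpaths would end before `a`, and none could contain `a`. -/
lemma Reach.not_feas {k a : ℕ} {T : ℝ} (h : Reach N T k a) (ha : a < N.n) : ¬ Feas N k T := by
  classical
  rintro ⟨S, hS, A, B, h1, h2⟩
  have key : ∀ j a, Reach N T j a →
      j ≤ (Finset.univ.filter fun i => A i ≤ B i ∧ B i < a).card ∨ N.n ≤ a := by
    intro j a hr
    induction hr with
    | zero => left; simp
    | @step j a m b hr g ih =>
      left
      have ha : a < N.n := lt_of_le_of_lt (g.am.trans g.mb) g.bn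
      replace ih := ih.resolve_right (by omega)
      obtain ⟨i, ⟨hi1, hi2⟩, -⟩ := h1 a ha
      have h3 := h2 i (hi1.trans hi2)
      have h4 := g.le (hS i) h3.1 hi1 h3.2
      have h5 : insert i (Finset.univ.filter fun i => A i ≤ B i ∧ B i < a) ⊆
          Finset.univ.filter fun i => A i ≤ B i ∧ B i < b + 1 := by
        intro x hx
        have := g.am
        have := g.mb
        simp only [Finset.mem_insert, Finset.mem_filter, Finset.mem_univ, true_and] at hx ⊢
        rcases hx with rfl | hx <;> omega
      have h6 := Finset.card_le_card h5
      rw [Finset.card_insert_of_notMem (by simp; omega)] at h6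
      omega
    | @stay j a hr g ih => exact Or.inr g
  have h3 := (key k a h).resolve_right (by omega)
  have h4 : (Finset.univ.filter fun i => A i ≤ B i ∧ B i < a) = Finset.univ := by
    apply Finset.eq_univ_of_card
    rw [Fintype.card_fin]
    refine le_antisymm ?_ h3
    simpa using Finset.card_le_univ (Finset.univ.filter fun i => A i ≤ B i ∧ B i < a)
  obtain ⟨i, ⟨hi1, hi2⟩, -⟩ := h1 a ha
  have : i ∈ Finset.univ.filter fun i => A i ≤ B i ∧ B i < a := by rw [h4]; simp
  simp at this
  omega

/-- The sinks `loc 0, …, loc (j - 1)` serve the vertices before `a` in time `T`. -/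
inductive Chain (N : PathNetwork) (T : ℝ) (loc : ℕ → Location) : ℕ → ℕ → Prop
  | zero : Chain N T loc 0 0
  | step {j a b : ℕ} (h : Chain N T loc j a) (hab : a ≤ b) (hb : b < N.n)
      (hon : N.OnPath (loc j)) (he : N.Evacuates a b (loc j) T) : Chain N T loc (j + 1) (b + 1)
  | stay {j a : ℕ} (h : Chain N T loc j a) (hon : N.OnPath (loc j)) (ha : N.n ≤ a) :
      Chain N T loc (j + 1) a

lemma Chain.congr {T : ℝ} {loc loc' : ℕ → Location} {j a : ℕ} (h : Chain N T loc j a)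
    (hl : ∀ i < j, loc' i = loc i) : Chain N T loc' j a := by
  induction h with
  | zero => exact .zero
  | @step j a b h hab hb hon he ih =>
    have e := hl j (by omega)
    exact .step (ih fun i hi => hl i (by omega)) hab hb (e ▸ hon) (e ▸ he)
  | @stay j a h hon ha ih =>
    exact .stay (ih fun i hi => hl i (by omega)) (hl j (by omega) ▸ hon) ha

lemma Chain.exists_division {T : ℝ} {loc : ℕ → Location} {j a : ℕ} (h : Chain N T loc j a) :
    (∀ i < j, N.OnPath (loc i)) ∧ ∃ A B : ℕ → ℕ, (∀ v < a, ∃! i, i < j ∧ A i ≤ v ∧ v ≤ B i) ∧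
      ∀ i < j, A i ≤ B i → B i < a ∧ B i < N.n ∧ N.Evacuates (A i) (B i) (loc i) T := by
  induction h with
  | zero => exact ⟨by simp, fun _ => 0, fun _ => 0, by simp, by simp⟩
  | @step j a b h hab hb hon he ih =>
    obtain ⟨h0, A, B, h1, h2⟩ := ih
    refine ⟨fun i hi => ?_, Function.update A j a, Function.update B j b, fun v hv => ?_,
      fun i hi => ?_⟩
    · rcases Nat.lt_succ_iff_lt_or_eq.1 hi with hi | rfl
      · exact h0 i hi
      · exact hon
    · by_cases hva : v < a
      · obtain ⟨i, hi, hu⟩ := h1 v hva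
        refine ⟨i, ?_, fun i' hi' => ?_⟩
        · have : i ≠ j := by omega
          simp only [Function.update_of_ne this]; omega
        · have : i' ≠ j := by
            rintro rfl
            simp at hi'; omega
          simp only [Function.update_of_ne this] at hi'
          exact hu i' ⟨by omega, hi'.2⟩
      · refine ⟨j, by simp; omega, fun i' hi' => ?_⟩
        by_contra this
        simp only [Function.update_of_ne this] at hi'
        have := h2 i' (by omega) (by omega)
        omega
    · by_cases hij : i = j
      · subst hij
        simp only [Function.update_self]
        exact fun _ => ⟨by omega, hb, he⟩
      · simp only [Function.update_of_ne hij]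
        intro h
        have := h2 i (by omega) h
        exact ⟨by omega, this.2⟩
  | @stay j a h hon ha ih =>
    obtain ⟨h0, A, B, h1, h2⟩ := ih
    -- The bounds `1` and `0` describe an empty subpath for a superfluous sink.
    refine ⟨fun i hi => ?_, Function.update A j 1, Function.update B j 0, fun v hv => ?_,
      fun i hi => ?_⟩
    · rcases Nat.lt_succ_iff_lt_or_eq.1 hi with hi | rfl
      · exact h0 i hi
      · exact hon
    · obtain ⟨i, hi, hu⟩ := h1 v hv
      refine ⟨i, ?_, fun i' hi' => ?_⟩
      · have : i ≠ j := by omega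
        simp only [Function.update_of_ne this]; omega
      · have : i' ≠ j := by
          rintro rfl
          simp at hi'; omega
        simp only [Function.update_of_ne this] at hi'
        exact hu i' ⟨by omega, hi'.2⟩
    · by_cases hij : i = j
      · subst hij
        simp
      · simp only [Function.update_of_ne hij]
        exact h2 i (by omega)

lemma Chain.sinksEvacuate {T : ℝ} {loc : ℕ → Location} {k a : ℕ} (h : Chain N T loc k a)
    (ha : N.n ≤ a) : (∀ j : Fin k, N.OnPath (loc j)) ∧
      N.SinksEvacuate (fun j : Fin k => loc j) T := by
  obtain ⟨h0, A, B, h1, h2⟩ := h.exists_division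
  refine ⟨fun j => h0 j j.2, fun j => A j, fun j => B j, fun v hv => ?_, fun j hj => ?_⟩
  · obtain ⟨i, hi, hu⟩ := h1 v (by omega)
    exact ⟨⟨i, hi.1⟩, hi.2, fun j hj => Fin.ext (hu j ⟨j.2, hj⟩)⟩
  · exact (h2 j j.2 hj).2

lemma Reach.exists_chain {T : ℝ} (hT : 0 ≤ T) {j a : ℕ} (h : Reach N T j a) :
    ∃ loc, Chain N T loc j a := by
  induction h with
  | zero => exact ⟨fun _ => ⟨0, 0⟩, .zero⟩
  | @step j a m b h g ih =>
    obtain ⟨loc, hc⟩ := ih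
    refine ⟨Function.update loc j (sinkAt N T a m b), .step (hc.congr fun i hi => ?_)
      (g.am.trans g.mb) g.bn ?_ ?_⟩
    · rw [Function.update_of_ne (by omega)]
    · simpa using (g.onPath hT).1
    · simpa using (g.onPath hT).2
  | @stay j a h g ih =>
    obtain ⟨loc, hc⟩ := ih
    refine ⟨Function.update loc j ⟨0, 0⟩, .stay (hc.congr fun i hi => ?_) ?_ g⟩
    · rw [Function.update_of_ne (by omega)]
    · have := N.n_pos
      simp [PathNetwork.OnPath]; omega

lemma Reach.feas {k a : ℕ} {T : ℝ} (hT : 0 ≤ T) (h : Reach N T k a) (ha : N.n ≤ a) :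
    Feas N k T := by
  obtain ⟨loc, hc⟩ := h.exists_chain hT
  exact ⟨_, hc.sinksEvacuate ha⟩

lemma isOptimalSink_of {k : ℕ} {S : Fin k → Location} {T : ℝ} (hS : ∀ j, N.OnPath (S j))
    (h : N.SinksEvacuate S T) (hmin : ∀ T' < T, 0 ≤ T' → ¬ Feas N k T') : N.IsOptimalSink S := by
  have key : ∀ T', Feas N k T' → T ≤ T' := fun T' h' => by
    by_contra hc
    exact hmin T' (not_le.1 hc) h'.nonneg h'
  exact ⟨hS, T, ⟨h, fun T' h' => key T' ⟨S, hS, h'⟩⟩,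
    fun S' hS' T' h' => key T' ⟨S', hS', h'.1⟩⟩

/-- All vertices can be evacuated to the last one. -/
lemma feas_last {k : ℕ} (hk : 1 ≤ k) : Feas N k (Lt N 0 0 (N.n - 1)) := by
  have hn := N.n_pos
  have hT := Lt_nonneg N (d := 0) (a := 0) (m := N.n - 1)
  have g : GStep N (Lt N 0 0 (N.n - 1)) 0 (N.n - 1) (N.n - 1) :=
    ⟨by omega, le_rfl, by omega, le_rfl, fun h => by omega, fun h => by omega, fun h => by omega⟩
  have e : N.n - 1 + 1 = N.n := by omega
  have : ∀ j, Reach N (Lt N 0 0 (N.n - 1)) (j + 1) N.n := by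
    intro j
    induction j with
    | zero => simpa [e] using Reach.zero.step g
    | succ j ih => exact ih.stay le_rfl
  obtain ⟨j, rfl⟩ : ∃ j, k = j + 1 := ⟨k - 1, by omega⟩
  exact (this j).feas hT le_rfl

end Greedy

end SinkRAM

namespace SinkRAM

/-! ## Upper envelopes -/

/-- The cells `o, …, o + top - 1` of the arrays `al`, `be`, `xi` hold slopes, intercepts and
breakpoints of the upper envelope, to the right of `xm`, of the lines `p, …, e - 1` with slopes
`A` and intercepts `C`; to the right of the last breakpoint, the part of the envelope with the
property `E` may be missing. -/
structure Env (al be xi : ℕ → ℝ) (o top : ℕ) (A C : ℕ → ℝ) (p e : ℕ) (xm : ℝ)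
    (E : ℝ → ℝ → Prop) : Prop where
  size : top + p ≤ e
  mem : ∀ i < top, ∃ q, p ≤ q ∧ q < e ∧ al (o + i) = A q ∧ be (o + i) = C q
  bot : 0 < top → xi o = xm
  sorted : ∀ i j, i ≤ j → j < top → xi (o + i) ≤ xi (o + j)
  mid : ∀ i, i + 1 < top → ∀ x, xi (o + i) ≤ x → x ≤ xi (o + (i + 1)) → ∀ q, p ≤ q → q < e →
    A q * x + C q ≤ al (o + i) * x + be (o + i)
  last : ∀ x, xm ≤ x → (0 < top → xi (o + (top - 1)) ≤ x) → ∀ q, p ≤ q → q < e →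
    (0 < top ∧ A q * x + C q ≤ al (o + (top - 1)) * x + be (o + (top - 1))) ∨ E (A q * x + C q) x

section

variable {al be xi : ℕ → ℝ} {o top : ℕ} {A C : ℕ → ℝ} {p e : ℕ} {xm : ℝ} {E E' : ℝ → ℝ → Prop}

lemma Env.weaken (h : Env al be xi o top A C p e xm E) (hE : ∀ y x, E y x → E' y x) :
    Env al be xi o top A C p e xm E' :=
  ⟨h.size, h.mem, h.bot, h.sorted, h.mid, fun x h1 h2 q h3 h4 =>
    (h.last x h1 h2 q h3 h4).imp_right (hE _ _)⟩

lemma Env.congr (h : Env al be xi o top A C p e xm E) {al' be' xi' : ℕ → ℝ}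
    (h1 : ∀ i < top, al' (o + i) = al (o + i)) (h2 : ∀ i < top, be' (o + i) = be (o + i))
    (h3 : ∀ i < top, xi' (o + i) = xi (o + i)) : Env al' be' xi' o top A C p e xm E := by
  refine ⟨h.size, fun i hi => ?_, fun hi => ?_, fun i j hij hj => ?_, fun i hi x => ?_,
    fun x hx hl => ?_⟩
  · rw [h1 i hi, h2 i hi]; exact h.mem i hi
  · have := h3 0 hi
    rw [add_zero] at this
    rw [this]; exact h.bot hi
  · rw [h3 i (by omega), h3 j hj]; exact h.sorted i j hij hj
  · rw [h1 i (by omega), h2 i (by omega), h3 i (by omega), h3 _ hi]; exact h.mid i hi x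
  · rcases Nat.eq_zero_or_pos top with h0 | h0
    · subst h0
      simpa using h.last x hx (by simp)
    · rw [h1 _ (by omega), h2 _ (by omega)]
      refine h.last x hx fun h' => ?_
      rw [← h3 _ (by omega)]; exact hl h'

lemma Env.empty (p : ℕ) : Env al be xi o 0 A C p p xm E :=
  ⟨by omega, by simp, by simp, by simp, by simp, fun _ _ _ q h1 h2 => by omega⟩

/-- The line to be inserted is at least as steep as all others. If it is not below the top at the
left end of the top's piece, it stays above from there on, so the top is not needed. What is lost
lies below the new line, and the property `E` permits this. -/
lemma Env.pop {a b : ℝ} (h : Env al be xi o (top + 1) A C p e xm fun y x => y ≤ a * x + b)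
    (ha : ∀ q, p ≤ q → q < e → A q ≤ a)
    (hd : al (o + top) * xi (o + top) + be (o + top) ≤ a * xi (o + top) + b) :
    Env al be xi o top A C p e xm fun y x => y ≤ a * x + b := by
  have hdom : ∀ x, xi (o + top) ≤ x → ∀ q, p ≤ q → q < e → A q * x + C q ≤ a * x + b := by
    intro x hx q h1 h2
    have hxm : xm ≤ x := by
      rw [← h.bot (by omega)]
      exact (h.sorted 0 top (by omega) (by omega)).trans hx
    rcases h.last x hxm (fun _ => by simpa using hx) q h1 h2 with ⟨-, h3⟩ | h3
    · simp only [Nat.add_sub_cancel] at h3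
      obtain ⟨q', h4, h5, h6, h7⟩ := h.mem top (by omega)
      have h8 := ha q' h4 h5
      rw [← h6] at h8
      nlinarith
    · exact h3
  refine ⟨by have := h.size; omega, fun i hi => h.mem i (by omega), fun hi => h.bot (by omega),
    fun i j hij hj => h.sorted i j hij (by omega), fun i hi => h.mid i (by omega),
    fun x hx hl q h1 h2 => ?_⟩
  rcases le_total (xi (o + top)) x with h3 | h3
  · exact Or.inr (hdom x h3 q h1 h2)
  · rcases Nat.eq_zero_or_pos top with h0 | h0
    · subst h0
      have := h.bot (by omega)
      exact Or.inr (hdom x (by simpa [this] using hx) q h1 h2)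
    · refine Or.inl ⟨h0, h.mid (top - 1) (by omega) x (hl h0) ?_ q h1 h2⟩
      have : top - 1 + 1 = top := by omega
      rwa [this]

lemma Env.push_first (h : Env al be xi o 0 A C (p + 1) e xm fun y x => y ≤ A p * x + C p)
    (hal : al o = A p) (hbe : be o = C p) (hxi : xi o = xm) :
    Env al be xi o 1 A C p e xm fun _ _ => False := by
  refine ⟨by have := h.size; omega, fun i hi => ⟨p, le_rfl, by have := h.size; omega, ?_⟩,
    fun _ => hxi, fun i j hij hj => ?_, fun i hi => by omega, fun x hx _ q h1 h2 => ?_⟩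
  · obtain rfl : i = 0 := by omega
    exact ⟨hal, hbe⟩
  · obtain rfl : i = 0 := by omega
    obtain rfl : j = 0 := by omega
    exact le_rfl
  · left
    refine ⟨by omega, ?_⟩
    simp only [Nat.sub_self, add_zero, hal, hbe]
    rcases Nat.eq_or_lt_of_le h1 with rfl | h1
    · exact le_rfl
    · rcases h.last x hx (by simp) q h1 h2 with ⟨h3, -⟩ | h3
      · omega
      · exact h3

/-- The new line is strictly lower at the left end of the top's piece and strictly steeper. It
therefore crosses the top strictly further right, and the breakpoints remain sorted. -/
lemma Env.push (h : Env al be xi o (top + 1) A C (p + 1) e xm fun y x => y ≤ A p * x + C p)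
    (hs : al (o + top) < A p)
    (hd : A p * xi (o + top) + C p < al (o + top) * xi (o + top) + be (o + top))
    (hal : al (o + (top + 1)) = A p) (hbe : be (o + (top + 1)) = C p)
    (hxi : xi (o + (top + 1)) = (be (o + top) - C p) / (A p - al (o + top))) :
    Env al be xi o (top + 2) A C p e xm fun _ _ => False := by
  have hs' : 0 < A p - al (o + top) := by linarith
  set z := xi (o + (top + 1)) with hz
  have hcross : A p * z + C p = al (o + top) * z + be (o + top) := by
    have : z * (A p - al (o + top)) = be (o + top) - C p := by
      rw [hxi, div_mul_cancel₀ _ hs'.ne']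
    linarith
  have hlt : xi (o + top) < z := by
    by_contra hc
    push Not at hc
    nlinarith
  obtain ⟨q', h4, h5, h6, h7⟩ := h.mem top (by omega)
  refine ⟨by have := h.size; omega, fun i hi => ?_, fun _ => h.bot (by omega),
    fun i j hij hj => ?_, fun i hi x hx hx' q h1 h2 => ?_, fun x hx hl q h1 h2 => ?_⟩
  · rcases Nat.lt_succ_iff_lt_or_eq.1 hi with hi | rfl
    · obtain ⟨q, a1, a2, a3⟩ := h.mem i hi
      exact ⟨q, by omega, a2, a3⟩
    · exact ⟨p, le_rfl, by have := h.size; omega, hal, hbe⟩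
  · rcases Nat.lt_succ_iff_lt_or_eq.1 hj with hj | rfl
    · exact h.sorted i j hij hj
    · rcases Nat.lt_succ_iff_lt_or_eq.1 (Nat.lt_succ_of_le hij) with hi | rfl
      · exact (h.sorted i top (by omega) (by omega)).trans hlt.le
      · exact le_rfl
  · by_cases hit : i = top
    · subst hit
      have hle : A p * x + C p ≤ al (o + i) * x + be (o + i) := by nlinarith
      rcases Nat.eq_or_lt_of_le h1 with rfl | h1
      · exact hle
      · have hxm : xm ≤ x := by
          rw [← h.bot (by omega)]
          exact (h.sorted 0 i (by omega) (by omega)).trans hx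
        rcases h.last x hxm (fun _ => by simpa using hx) q h1 h2 with ⟨-, h3⟩ | h3
        · simpa using h3
        · exact h3.trans hle
    · rcases Nat.eq_or_lt_of_le h1 with rfl | h1
      · have h8 := h.mid i (by omega) x hx hx' q' h4 h5
        rw [← h6, ← h7] at h8
        have h9 : x ≤ xi (o + top) := hx'.trans (h.sorted _ _ (by omega) (by omega))
        nlinarith
      · exact h.mid i (by omega) x hx hx' q h1 h2
  · left
    refine ⟨by omega, ?_⟩
    have e1 : top + 2 - 1 = top + 1 := by omega
    rw [e1, hal, hbe]
    rw [e1] at hl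
    have hxz := hl (by omega)
    rcases Nat.eq_or_lt_of_le h1 with rfl | h1
    · exact le_rfl
    · rcases h.last x hx (fun _ => by simpa using hlt.le.trans hxz) q h1 h2 with ⟨-, h3⟩ | h3
      · simp only [Nat.add_sub_cancel] at h3
        nlinarith
      · exact h3

/-- As slopes come in order, equality must hold in `hs`. The new line is parallel to the top and
lower, hence redundant. -/
lemma Env.keep (h : Env al be xi o (top + 1) A C (p + 1) e xm fun y x => y ≤ A p * x + C p)
    (hs : A p ≤ al (o + top)) (hA : ∀ q, p + 1 ≤ q → q < e → A q ≤ A p)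
    (hd : A p * xi (o + top) + C p < al (o + top) * xi (o + top) + be (o + top)) :
    Env al be xi o (top + 1) A C p e xm fun _ _ => False := by
  obtain ⟨q', h4, h5, h6, h7⟩ := h.mem top (by omega)
  have heq : al (o + top) = A p := le_antisymm (h6 ▸ hA q' h4 h5) hs
  have hle : ∀ x, A p * x + C p ≤ al (o + top) * x + be (o + top) := fun x => by
    rw [heq] at hd ⊢; linarith
  refine ⟨by have := h.size; omega, fun i hi => ?_, fun _ => h.bot (by omega),
    h.sorted, fun i hi x hx hx' q h1 h2 => ?_, fun x hx hl q h1 h2 => ?_⟩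
  · obtain ⟨q, a1, a2, a3⟩ := h.mem i hi
    exact ⟨q, by omega, a2, a3⟩
  · rcases Nat.eq_or_lt_of_le h1 with rfl | h1
    · have h8 := h.mid i hi x hx hx' q' h4 h5
      rw [← h6, ← h7] at h8
      exact (hle x).trans h8
    · exact h.mid i hi x hx hx' q h1 h2
  · left
    refine ⟨by omega, ?_⟩
    simp only [Nat.add_sub_cancel]
    rcases Nat.eq_or_lt_of_le h1 with rfl | h1
    · exact hle x
    · rcases h.last x hx hl q h1 h2 with ⟨-, h3⟩ | h3
      · simpa using h3
      · exact h3.trans (hle x)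

lemma Env.top_pos (h : Env al be xi o top A C p e xm fun _ _ => False) (hpe : p < e) :
    0 < top := by
  by_contra hc
  rcases h.last xm le_rfl (fun h' => (hc h').elim) p le_rfl hpe with ⟨h1, -⟩ | h1
  · exact hc h1
  · exact h1

lemma Env.query (h : Env al be xi o top A C p e xm fun _ _ => False) {i : ℕ} (hi : i < top)
    {x : ℝ} (hx : xm ≤ x) (h1 : i = 0 ∨ xi (o + i) ≤ x) (h2 : i + 1 < top → x < xi (o + (i + 1))) :
    (∀ q, p ≤ q → q < e → A q * x + C q ≤ al (o + i) * x + be (o + i)) ∧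
      ∃ q, p ≤ q ∧ q < e ∧ al (o + i) * x + be (o + i) = A q * x + C q := by
  have h3 : xi (o + i) ≤ x := by
    rcases h1 with rfl | h1
    · rw [add_zero, h.bot (by omega)]; exact hx
    · exact h1
  refine ⟨fun q hq hq' => ?_, ?_⟩
  · by_cases hit : i + 1 < top
    · exact h.mid i hit x h3 (h2 hit).le q hq hq'
    · obtain rfl : i = top - 1 := by omega
      rcases h.last x hx (fun _ => h3) q hq hq' with ⟨-, h4⟩ | h4
      · exact h4
      · exact h4.elim
  · obtain ⟨q, a1, a2, a3, a4⟩ := h.mem i hi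
    exact ⟨q, a1, a2, by rw [a3, a4]⟩

end

/-! ## The lines of a block -/

section Lines

open Finset

variable (N : PathNetwork)

/-- The largest inverse capacity of the edges `q, …, e - 1`. -/
noncomputable def Um (d q e : ℕ) : ℝ := (Ico q e).fold max 0 (uc N d)

/-- The lines, together with `lineC`, express the pairs `(p, r)` with `p = q` in a block that ends
at `e`. Kind `0` is for `r` in the same block: at `-Sw N d a` it yields the best value over `q ≤ r <
e`. Kind `1` is for `r` beyond the block: at minus the largest inverse capacity `X` beyond, it
yields the value up to the summand `-Sw N d a * X`, which does not depend on `q`. -/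
noncomputable def lineA (d y e q : ℕ) : ℝ := if y = 0 then Um N d q e else - Sw N d (q + 1)

noncomputable def lineC (d y e q : ℕ) : ℝ :=
  if y = 0 then Sw N d (q + 1) * Um N d q e - Dl N d q else - Dl N d q

variable {N}

lemma Um_self {d q : ℕ} : Um N d q q = 0 := by simp [Um]

lemma Um_nonneg {d q e : ℕ} : 0 ≤ Um N d q e := ((fold_max_le (f := uc N d) _).1 le_rfl).1

lemma uc_le_Um {d q e r : ℕ} (h : q ≤ r) (h' : r < e) : uc N d r ≤ Um N d q e :=
  ((fold_max_le (f := uc N d) _).1 (le_refl (Um N d q e))).2 r (by simp [h, h'])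

lemma Um_succ {d q e : ℕ} (h : q < e) : Um N d q e = max (Um N d (q + 1) e) (uc N d q) := by
  refine eq_of_forall_ge_iff fun c => ?_
  rw [max_le_iff, Um, Um, fold_max_le, fold_max_le, and_assoc]
  refine and_congr_right fun _ => ⟨fun h' => ⟨fun x hx => h' x ?_, h' q (by simp [h])⟩,
    fun h' x hx => ?_⟩
  · simp at hx ⊢; omega
  · simp at hx
    rcases Nat.eq_or_lt_of_le hx.1 with rfl | h2
    · exact h'.2
    · exact h'.1 x (by simp; omega)

lemma Um_attained {d q e : ℕ} (he : e + 1 ≤ N.n) : ∀ i, q + (i + 1) = e →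
    ∃ r, q ≤ r ∧ r < e ∧ Um N d q e = uc N d r := by
  intro i
  induction i generalizing q with
  | zero =>
    intro h
    subst h
    refine ⟨q, le_rfl, by omega, ?_⟩
    rw [Um_succ (by omega), zero_add, Um_self]
    exact max_eq_right (uc_pos N (by omega)).le
  | succ i ih =>
    intro h
    obtain ⟨r, h1, h2, h3⟩ := ih (q := q + 1) (by omega)
    rw [Um_succ (by omega), h3]
    rcases le_total (uc N d r) (uc N d q) with h4 | h4
    · exact ⟨q, le_rfl, by omega, max_eq_right h4⟩
    · exact ⟨r, by omega, h2, max_eq_left h4⟩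

/-- Inserting the lines by decreasing index thus means by nondecreasing slope, as the stack
requires, and no sorting is necessary. -/
lemma lineA_anti {d y e q q' : ℕ} (h : q ≤ q') :
    lineA N d y e q' ≤ lineA N d y e q := by
  unfold lineA
  split_ifs
  · exact (fold_max_le _).2 ⟨Um_nonneg, fun r hr => by
      simp at hr; exact uc_le_Um (by omega) hr.2⟩
  · exact neg_le_neg (Sw_mono N (by omega))

/-- The part `e, …, m - 1` of the vertices `a, …, m - 1` has been taken into account. -/
structure Acc (N : PathNetwork) (d a m e : ℕ) (X acc : ℝ) : Prop where
  nonneg : 0 ≤ X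
  le : ∀ r, e ≤ r → r < m → uc N d r ≤ X
  att : X = 0 ∨ ∃ r, e ≤ r ∧ r < m ∧ X = uc N d r
  -- `-Dl N d m` stands for the value `0` in `Lt`. The summand `Dl N d m`, common to all terms, is
  -- added only at the end.
  iff : ∀ T, acc ≤ T ↔ -Dl N d m ≤ T ∧ ∀ p r, e ≤ p → p ≤ r → r < m →
    (Sw N d (p + 1) - Sw N d a) * uc N d r - Dl N d p ≤ T

lemma Acc.init {d a m : ℕ} : Acc N d a m m 0 (-Dl N d m) :=
  ⟨le_rfl, fun r h1 h2 => by omega, Or.inl rfl, fun T =>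
    ⟨fun h => ⟨h, fun p r h1 h2 h3 => by omega⟩, fun h => h.1⟩⟩

lemma Acc.final {d a m e : ℕ} {X acc : ℝ} (h : Acc N d a m e X acc) (he : e = a) :
    acc + Dl N d m = Lt N d a m := by
  subst he
  refine eq_of_forall_ge_iff fun T => ?_
  rw [Lt_le_iff, ← le_sub_iff_add_le, h.iff]
  refine and_congr (by constructor <;> intro <;> linarith) (forall₂_congr fun p r => ?_)
  refine imp_congr_right fun _ => imp_congr_right fun _ => imp_congr_right fun _ => ?_
  constructor <;> intro <;> linarith

/-- The new pairs have `p` in the block. If `r` is in the block too, only the largest inverse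
capacity between `p` and the end of the block matters, because the weight it multiplies is
nonnegative. If `r` lies beyond, only `X` matters. The envelope values `E₀` and `E₁` collect these
two maxima. -/
lemma Acc.block {d a m e s : ℕ} {X acc E₀ E₁ : ℝ} (h : Acc N d a m e X acc) (has : a ≤ s)
    (hse : s < e) (hem : e ≤ m) (hm : m < N.n)
    (h0 : (∀ q, s ≤ q → q < e → lineA N d 0 e q * (-Sw N d a) + lineC N d 0 e q ≤ E₀) ∧
      ∃ q, s ≤ q ∧ q < e ∧ E₀ = lineA N d 0 e q * (-Sw N d a) + lineC N d 0 e q)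
    (h1 : (∀ q, s ≤ q → q < e → lineA N d 1 e q * (-X) + lineC N d 1 e q ≤ E₁) ∧
      ∃ q, s ≤ q ∧ q < e ∧ E₁ = lineA N d 1 e q * (-X) + lineC N d 1 e q) :
    Acc N d a m s (max X (Um N d s e)) (max (max acc E₀) (E₁ - Sw N d a * X)) := by
  have hSa : ∀ q, s ≤ q → 0 ≤ Sw N d (q + 1) - Sw N d a := fun q hq =>
    sub_nonneg.2 (Sw_mono N (by omega))
  have e0 : ∀ q, lineA N d 0 e q * (-Sw N d a) + lineC N d 0 e q =
      (Sw N d (q + 1) - Sw N d a) * Um N d q e - Dl N d q := fun q => by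
    simp only [lineA, lineC, if_true]; ring
  have e1 : ∀ q, lineA N d 1 e q * (-X) + lineC N d 1 e q =
      Sw N d (q + 1) * X - Dl N d q := fun q => by
    simp only [lineA, lineC, one_ne_zero, if_false]; ring
  simp only [e0, e1] at h0 h1
  refine ⟨h.nonneg.trans (le_max_left _ _), fun r hr hr' => ?_, ?_, fun T => ?_⟩
  · by_cases hre : r < e
    · exact (uc_le_Um hr hre).trans (le_max_right _ _)
    · exact (h.le r (by omega) hr').trans (le_max_left _ _)
  · rcases le_total X (Um N d s e) with h2 | h2
    · rw [max_eq_right h2]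
      obtain ⟨r, a1, a2, a3⟩ := Um_attained (N := N) (d := d) (q := s) (e := e) (by omega)
        (e - s - 1) (by omega)
      exact Or.inr ⟨r, a1, by omega, a3⟩
    · rw [max_eq_left h2]
      rcases h.att with h3 | ⟨r, a1, a2, a3⟩
      · exact Or.inl h3
      · exact Or.inr ⟨r, by omega, a2, a3⟩
  · rw [max_le_iff, max_le_iff, h.iff]
    constructor
    · rintro ⟨⟨⟨k1, k2⟩, k3⟩, k4⟩
      refine ⟨k1, fun p r b1 b2 b3 => ?_⟩
      by_cases hpe : e ≤ p
      · exact k2 p r hpe b2 b3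
      · have hS := hSa p b1
        by_cases hre : r < e
        · have := h0.1 p b1 (by omega)
          have := mul_le_mul_of_nonneg_left (uc_le_Um (N := N) (d := d) b2 hre) hS
          linarith
        · have := h1.1 p b1 (by omega)
          have := mul_le_mul_of_nonneg_left (h.le r (by omega) b3) hS
          linarith
    · rintro ⟨k1, k2⟩
      refine ⟨⟨⟨k1, fun p r b1 b2 b3 => k2 p r (by omega) b2 b3⟩, ?_⟩, ?_⟩
      · obtain ⟨q, b1, b2, b3⟩ := h0.2
        obtain ⟨r, a1, a2, a3⟩ := Um_attained (N := N) (d := d) (q := q) (e := e) (by omega)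
          (e - q - 1) (by omega)
        rw [b3, a3]
        exact k2 q r b1 a1 (by omega)
      · obtain ⟨q, b1, b2, b3⟩ := h1.2
        rw [b3]
        rcases h.att with h3 | ⟨r, a1, a2, a3⟩
        -- If `X = 0`, the term from `E₁` is just `-Dl N d q`, and the pair `(q, q)` already
        -- dominates it.
        · have := k2 q q b1 le_rfl (by omega)
          have := mul_nonneg (hSa q b1) (uc_pos N (d := d) (i := q) (by omega)).le
          rw [h3]; linarith
        · have := k2 q r b1 (by omega) a2
          rw [a3]; linarith

end Lines

end SinkRAM

namespace SinkRAM

/-! ## The data structure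

Real arrays, for the direction `d` and the kind `y` of envelope: `1 + d` prefix sums of weights,
`3 + d` prefix sums of transit times, `5 + d` inverse capacities, `7 + 2 * d + y` slopes,
`11 + 2 * d + y` intercepts, `15 + 2 * d + y` breakpoints, `19 + 2 * d + y` largest inverse
capacities of blocks.  Integer array `1 + 2 * d + y`: sizes of envelopes.

Integer registers: `0` number of vertices, `1` number of sinks, `2` number of levels.  Real
register `1`: lower bound for breakpoints. -/

/-- The memory holds the data of the block `s, …, s + 2 ^ h - 1`. -/
structure Blk (N : PathNetwork) (d y h s : ℕ) (v : VState) : Prop where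
  env : Env (v.rm (7 + 2 * d + y)) (v.rm (11 + 2 * d + y)) (v.rm (15 + 2 * d + y)) (h * N.n + s)
    (v.im (1 + 2 * d + y) (h * N.n + s)) (lineA N d y (s + 2 ^ h)) (lineC N d y (s + 2 ^ h))
    s (s + 2 ^ h) (v.rr 1) fun _ _ => False
  um : v.rm (19 + 2 * d + y) (h * N.n + s) = Um N d s (s + 2 ^ h)

/-- The memory holds the prefix sums and inverse capacities for direction `d`. -/
structure Tab (N : PathNetwork) (d : ℕ) (v : VState) : Prop where
  S : ∀ i ≤ N.n, v.rm (1 + d) i = Sw N d i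
  D : ∀ i < N.n, v.rm (3 + d) i = Dl N d i
  u : ∀ i, i + 1 < N.n → v.rm (5 + d) i = uc N d i

/-- The register `1` is a lower bound for all arguments at which envelopes are evaluated. -/
structure Low (N : PathNetwork) (d : ℕ) (v : VState) : Prop where
  nonpos : v.rr 1 ≤ 0
  S : v.rr 1 ≤ - Sw N d N.n
  u : ∀ i, i + 1 < N.n → v.rr 1 ≤ - uc N d i

structure Glob (N : PathNetwork) (k H : ℕ) (v : VState) : Prop where
  n : v.ir 0 = N.n
  k : v.ir 1 = k
  H : v.ir 2 = H

/-- The data structure is complete. -/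
structure Pre (N : PathNetwork) (k H : ℕ) (v : VState) : Prop where
  glob : Glob N k H v
  tab : ∀ d < 2, Tab N d v
  low : ∀ d < 2, Low N d v
  blk : ∀ d < 2, ∀ y < 2, ∀ h < H, ∀ s, 2 ^ h ∣ s → s + 2 ^ h < N.n → Blk N d y h s v

/-- The words are large enough. -/
structure Big (n k H V : ℕ) : Prop where
  le : 4 * (H * n) + 8 * H + 8 * n + 2 * k + 64 ≤ V
  pow_le : 2 ^ H ≤ 2 * n
  le_pow : n ≤ 2 ^ H

lemma Blk.congr {N : PathNetwork} {d y h s : ℕ} {v v' : VState} (hb : Blk N d y h s v)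
    (h1 : v'.rr 1 = v.rr 1) (h2 : v'.im (1 + 2 * d + y) = v.im (1 + 2 * d + y))
    (h3 : ∀ j, j = 7 + 2 * d + y ∨ j = 11 + 2 * d + y ∨ j = 15 + 2 * d + y ∨ j = 19 + 2 * d + y →
      v'.rm j = v.rm j) : Blk N d y h s v' := by
  constructor
  · rw [h1, h2, h3 _ (by simp), h3 _ (by simp), h3 _ (by simp)]; exact hb.env
  · rw [h3 _ (by simp)]; exact hb.um

lemma Pre.congr {N : PathNetwork} {k H : ℕ} {v v' : VState} (h : Pre N k H v)
    (h1 : ∀ d < 3, v'.ir d = v.ir d) (h2 : v'.rr 1 = v.rr 1)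
    (h3 : ∀ j, 1 ≤ j → v'.im j = v.im j) (h4 : ∀ j, 1 ≤ j → v'.rm j = v.rm j) :
    Pre N k H v' where
  glob := ⟨by rw [h1 0 (by omega), h.glob.n], by rw [h1 1 (by omega), h.glob.k],
    by rw [h1 2 (by omega), h.glob.H]⟩
  tab d hd := ⟨by rw [h4 _ (by omega)]; exact (h.tab d hd).S,
    by rw [h4 _ (by omega)]; exact (h.tab d hd).D, by rw [h4 _ (by omega)]; exact (h.tab d hd).u⟩
  low d hd := ⟨by rw [h2]; exact (h.low d hd).nonpos, by rw [h2]; exact (h.low d hd).S,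
    by rw [h2]; exact (h.low d hd).u⟩
  blk d hd y hy i hi s hs hs' := (h.blk d hd y hy i hi s hs hs').congr h2 (h3 _ (by omega))
    fun j hj => h4 j (by omega)

/-! ## Evaluating travel times -/

/-- Evaluate the envelope at address `14` at the point in the real register `6`. -/
def evalEnv (d y : ℕ) : Cmd :=
  .seq (.iset 10 (.c 0)) (.seq (.iset 11 (.ld (1 + 2 * d + y) (.r 14)))
    (.seq (bsearch 10 11 12 13
      (.ite (.rle (.ld (15 + 2 * d + y) (.add (.r 14) (.r 12))) (.r 6))
        (.iset 13 (.c 1)) (.iset 13 (.c 0))))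
      (.rset 8 (.add (.mul (.ld (7 + 2 * d + y) (.add (.r 14) (.r 10))) (.r 6))
        (.ld (11 + 2 * d + y) (.add (.r 14) (.r 10)))))))

variable {off V : ℕ} {v : VState} {N : PathNetwork} {k H : ℕ}

lemma wp_evalEnv {d y o s e : ℕ} {A C : ℕ → ℝ} {xm : ℝ} (hd : d < 2) (hy : y < 2)
    (ho : v.ir 14 = o)
    (h : Env (v.rm (7 + 2 * d + y)) (v.rm (11 + 2 * d + y)) (v.rm (15 + 2 * d + y)) o
      (v.im (1 + 2 * d + y) o) A C s e xm fun _ _ => False)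
    (hse : s < e) (he : e ≤ s + 2 ^ H) (hx : xm ≤ v.rr 6) (hV : 2 * o + 2 * e + 2 ≤ V) :
    Wp off V (evalEnv d y) v fun t v' => t ≤ 44 * H + 60 ∧
      (∀ q, s ≤ q → q < e → A q * v.rr 6 + C q ≤ v'.rr 8) ∧
      ∃ q, s ≤ q ∧ q < e ∧ v'.rr 8 = A q * v.rr 6 + C q := by
  have htop := h.top_pos hse
  have hsize := h.size
  set top := v.im (1 + 2 * d + y) o with htopd
  have d1 : 1 + 2 * d + y < 32 := by omega
  have d2 : 15 + 2 * d + y < 32 := by omega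
  have d3 : 7 + 2 * d + y < 32 := by omega
  have d4 : 11 + 2 * d + y < 32 := by omega
  have n2 : 15 + 2 * d + y ≠ 0 := by omega
  have n3 : 7 + 2 * d + y ≠ 0 := by omega
  have n4 : 11 + 2 * d + y ≠ 0 := by omega
  refine wp_seq.2 (wp_iset.2 ⟨Nat.zero_le _, wp_seq.2 (wp_iset.2 ⟨?_, wp_seq.2 ?_⟩)⟩)
  · simp [d1, ho]; omega
  refine wp_bsearch (fun a b w => a < b ∧ (a = 0 ∨ v.rm (15 + 2 * d + y) (o + a) ≤ v.rr 6) ∧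
    (b < top → v.rr 6 < v.rm (15 + 2 * d + y) (o + b))) H 18 (lo := 0) (hi := top) (by simp)
    (by simp [ho, htopd]) ?_ (by omega) (by omega) (by omega) (by omega) (by omega) ?_ ?_ ?_ ?_
  · omega
  · exact ⟨htop, Or.inl rfl, fun h => by omega⟩
  · exact fun a b w d x _ h => h
  · rintro a b w h1 h2 h3 ⟨h4, h5, h6⟩ ha hb hm hf
    have w14 : w.ir 14 = o := by rw [hf.ir 14 (by simp)]; simp [ho]
    have w6 : w.rr 6 = v.rr 6 := by rw [hf.rr 6 (by simp)]; simp
    have wr : w.rm (15 + 2 * d + y) = v.rm (15 + 2 * d + y) := by rw [hf.rm _ (by simp)]; simp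
    refine wp_ite.2 ⟨?_, fun hc => wp_iset.2 ⟨?_, ?_⟩, fun hc => wp_iset.2 ⟨?_, ?_⟩⟩
    · simp [d2, w14, hm]; omega
    · simp; omega
    · simp [w14, w6, wr, hm] at hc
      refine ⟨by simp, by simp [ha], by simp [hb], by simp [hm], fun _ => ⟨by omega, Or.inr hc, h6⟩,
        fun h => by simp at h⟩
    · simp
    · simp [w14, w6, wr, hm] at hc
      refine ⟨by simp, by simp [ha], by simp [hb], by simp [hm], fun h => by simp at h,
        fun h => ⟨by omega, h5, fun _ => hc⟩⟩
  · rintro t w a b hf ha hb h1 h2 h3 h4 h5 ⟨h6, h7, h8⟩ ht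
    have w14 : w.ir 14 = o := by rw [hf.ir 14 (by simp [bsearch])]; simp [ho]
    have w6 : w.rr 6 = v.rr 6 := by rw [hf.rr 6 (by simp [bsearch])]; simp
    have wr : w.rm = v.rm := by funext j; rw [hf.rm _ (by simp [bsearch])]; simp
    obtain rfl : b = a + 1 := by omega
    have := h.query (by omega : a < top) hx h7 h8
    refine wp_rset.2 ⟨?_, ?_, ?_⟩
    · simp [d3, d4, w14, ha]; omega
    · simp; omega
    · simpa [w14, w6, wr, ha] using this

/-- Take the block of length `pw` that ends at `e` into account. -/
def process (d : ℕ) : Cmd :=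
  .seq (.iset 14 (.add (.r 9) (.sub (.r 6) (.r 8))))
  (.seq (.rset 6 (.sub (.c 0) (.r 7)))
  (.seq (evalEnv d 0)
  (.seq (.ite (.rle (.r 4) (.r 8)) (.rset 4 (.r 8)) .skip)
  (.seq (.rset 6 (.sub (.c 0) (.r 5)))
  (.seq (evalEnv d 1)
  (.seq (.rset 8 (.sub (.r 8) (.mul (.r 7) (.r 5))))
  (.seq (.ite (.rle (.r 4) (.r 8)) (.rset 4 (.r 8)) .skip)
  (.seq (.ite (.rle (.r 5) (.ld (19 + 2 * d) (.r 14))) (.rset 5 (.ld (19 + 2 * d) (.r 14))) .skip)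
  (.iset 6 (.sub (.r 6) (.r 8)))))))))))

lemma wp_max {d x : ℕ} {Q : ℕ → VState → Prop}
    (h : ∀ t w, t ≤ 10 → w.rr d = max (v.rr d) (v.rr x) → (∀ i, i ≠ d → w.rr i = v.rr i) →
      w.ir = v.ir → w.im = v.im → w.rm = v.rm → Q t w) :
    Wp off V (.ite (.rle (.r d) (.r x)) (.rset d (.r x)) .skip) v Q := by
  refine wp_ite.2 ⟨by simp, fun hc => wp_rset.2 ⟨trivial, ?_⟩, fun hc => wp_skip.2 ?_⟩
  · refine h _ _ (by simp) ?_ (fun i hi => by simp [hi]) rfl rfl rfl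
    simp at hc
    simp [hc]
  · refine h _ _ (by simp) ?_ (fun i hi => by simp) rfl rfl rfl
    simp at hc
    rw [max_eq_left hc.le]

/-- The order of the updates matters: the envelope of kind `1` is evaluated at the largest inverse
capacity to the right of the block, before this maximum is enlarged by the block itself. Since the
block maxima are stored alike for both kinds, those of kind `0` are read. -/
lemma wp_process {d a m e h : ℕ} (hd : d < 2) (hpre : Pre N k H v) (hbig : Big N.n k H V)
    (ha : v.ir 4 = a) (he : v.ir 6 = e) (hpw : v.ir 8 = 2 ^ h) (hrow : v.ir 9 = h * N.n)
    (hh : h < H) (hae : a + 2 ^ h ≤ e) (hdvd : 2 ^ h ∣ e) (hem : e ≤ m) (hm : m < N.n)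
    (hSa : v.rr 7 = Sw N d a) (hacc : Acc N d a m e (v.rr 5) (v.rr 4)) :
    Wp off V (process d) v fun t v' => t ≤ 88 * H + 210 ∧ v'.ir 6 = e - 2 ^ h ∧
      Acc N d a m (e - 2 ^ h) (v'.rr 5) (v'.rr 4) := by
  have hp : 0 < 2 ^ h := by positivity
  obtain ⟨s, rfl⟩ : ∃ s, e = s + 2 ^ h := ⟨e - 2 ^ h, by omega⟩
  have hs : 2 ^ h ∣ s := by simpa using hdvd
  have hrown : h * N.n + N.n ≤ H * N.n := by
    have := Nat.mul_le_mul_right N.n (show h + 1 ≤ H from hh)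
    rw [Nat.add_mul] at this; omega
  have hle := hbig.le
  have hpH : 2 ^ h ≤ 2 ^ H := Nat.pow_le_pow_right (by omega) hh.le
  have hb0 := hpre.blk d hd 0 (by omega) h hh s hs (by omega)
  have hb1 := hpre.blk d hd 1 (by omega) h hh s hs (by omega)
  have hlow := hpre.low d hd
  have d1 : 19 + 2 * d < 32 := by omega
  refine wp_seq.2 (wp_iset.2 ⟨?_, wp_seq.2 (wp_rset.2 ⟨by simp, wp_seq.2 ?_⟩)⟩)
  · simp [he, hpw, hrow]; omega
  set v1 := ((v.setI 14 _).setR 6 _) with hv1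
  have e14 : v1.ir 14 = h * N.n + s := by simp [hv1, he, hpw, hrow]
  have e6 : v1.rr 6 = - Sw N d a := by simp [hv1, hSa]
  refine (wp_evalEnv (y := 0) (o := h * N.n + s) (s := s) (e := s + 2 ^ h) (H := H)
    (xm := v.rr 1) (A := lineA N d 0 (s + 2 ^ h)) (C := lineC N d 0 (s + 2 ^ h))
    hd (by omega) e14 hb0.env (by omega) (by omega) ?_ (by omega)).frame.mono ?_
  · rw [e6]
    exact hlow.S.trans (neg_le_neg (Sw_mono N (by omega)))
  rintro t2 v2 ⟨⟨ht2, hE0⟩, hf2⟩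
  refine wp_seq.2 (wp_max ?_)
  intro t3 v3 ht3 h3 h3r h3i h3m h3rm
  refine wp_seq.2 (wp_rset.2 ⟨by simp, wp_seq.2 ?_⟩)
  have v3i : ∀ i, i ∉ (evalEnv d 0).wI → v3.ir i = v1.ir i := fun i hi => by
    rw [h3i, hf2.ir i hi]
  have v3r : ∀ i, i ≠ 4 → i ∉ (evalEnv d 0).wR → v3.rr i = v1.rr i := fun i hi hi' => by
    rw [h3r i hi, hf2.rr i hi']
  have v3m : v3.im = v.im := by
    rw [h3m]; funext j; rw [hf2.im j (by simp [evalEnv, bsearch])]; rfl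
  have v3rm : v3.rm = v.rm := by
    rw [h3rm]; funext j; rw [hf2.rm j (by simp [evalEnv, bsearch])]; rfl
  have v35 : v3.rr 5 = v.rr 5 := by
    rw [v3r 5 (by omega) (by simp [evalEnv, bsearch])]; simp [hv1]
  refine (wp_evalEnv (y := 1) (o := h * N.n + s) (s := s) (e := s + 2 ^ h) (H := H)
    (xm := v.rr 1) (A := lineA N d 1 (s + 2 ^ h)) (C := lineC N d 1 (s + 2 ^ h))
    hd (by omega) ?_ ?_ (by omega) (by omega) ?_ (by omega)).frame.mono ?_
  · simp only [VState.setR_ir]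
    rw [v3i 14 (by simp [evalEnv, bsearch]), e14]
  · simp only [VState.setR_rm, VState.setR_im, v3m, v3rm]
    exact hb1.env
  · simp [v35]
    rcases hacc.att with h0 | ⟨r, h1, h2, h3⟩
    · rw [h0]; linarith [hlow.nonpos]
    · rw [h3]; linarith [hlow.u r (by omega)]
  rintro t4 v4 ⟨⟨ht4, hE1⟩, hf4⟩
  have v4i : ∀ i, i ∉ (evalEnv d 0).wI → v4.ir i = v1.ir i := fun i hi => by
    rw [hf4.ir i hi]; exact v3i i hi
  have v4rm : v4.rm = v.rm := by
    funext j; rw [hf4.rm j (by simp [evalEnv, bsearch])]; simp [v3rm]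
  have v47 : v4.rr 7 = v.rr 7 := by
    rw [hf4.rr 7 (by simp [evalEnv, bsearch])]
    simp [v3r 7 (by omega) (by simp [evalEnv, bsearch]), hv1]
  have v45 : v4.rr 5 = v.rr 5 := by
    rw [hf4.rr 5 (by simp [evalEnv, bsearch])]; simp [v35]
  have v44 : v4.rr 4 = max (v.rr 4) (v2.rr 8) := by
    rw [hf4.rr 4 (by simp [evalEnv, bsearch])]
    simp [h3, hf2.rr 4 (by simp [evalEnv, bsearch]), hv1]
  refine wp_seq.2 (wp_rset.2 ⟨by simp, wp_seq.2 (wp_max ?_)⟩)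
  intro t5 v5 ht5 h5 h5r h5i h5m h5rm
  have w5 : v5.ir 14 = h * N.n + s := by
    rw [h5i, VState.setR_ir, v4i 14 (by simp [evalEnv, bsearch]), e14]
  have w6 : v5.ir 6 = s + 2 ^ h := by
    rw [h5i, VState.setR_ir, v4i 6 (by simp [evalEnv, bsearch])]; simp [hv1, he]
  have w8 : v5.ir 8 = 2 ^ h := by
    rw [h5i, VState.setR_ir, v4i 8 (by simp [evalEnv, bsearch])]; simp [hv1, hpw]
  have w5r : v5.rr 5 = v.rr 5 := by rw [h5r 5 (by omega)]; simp [v45]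
  have hacc' := hacc.block (s := s) (by omega) (by omega) hem hm (by rw [e6] at hE0; exact hE0)
    (by simpa [v35] using hE1)
  have w4r : v5.rr 4 = max (max (v.rr 4) (v2.rr 8)) (v4.rr 8 - Sw N d a * v.rr 5) := by
    rw [h5]; simp [v44, v47, hSa, v45]
  rw [← w4r, ← w5r] at hacc'
  have hub : v5.rm (19 + 2 * d) (h * N.n + s) = Um N d s (s + 2 ^ h) := by
    rw [h5rm, VState.setR_rm, v4rm]; exact hb0.um
  refine wp_seq.2 (wp_ite.2 ⟨?_, fun hc => wp_rset.2 ⟨?_, wp_iset.2 ⟨by simp, ?_⟩⟩,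
    fun hc => wp_skip.2 (wp_iset.2 ⟨by simp, ?_⟩)⟩)
  · simp [d1, w5]; omega
  · simp [d1, w5]; omega
  · simp [w5, hub] at hc
    refine ⟨by simp; omega, by simp [w6, w8], ?_⟩
    rw [max_eq_right hc] at hacc'
    simpa [hub, w5] using hacc'
  · simp [w5, hub] at hc
    refine ⟨by simp; omega, by simp [w6, w8], ?_⟩
    rw [max_eq_left hc.le] at hacc'
    simpa using hacc'

end SinkRAM

/-! ### Evaluation of `Lt` by decomposing an interval into dyadic blocks. -/

namespace SinkRAM

variable {off V : ℕ} {v : VState} {N : PathNetwork} {k H : ℕ}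

lemma Pre.of_fr {c : Cmd} {v' : VState} (h : Pre N k H v) (hf : Fr c v v')
    (h1 : ∀ d ∈ c.wI, 3 ≤ d) (h2 : 1 ∉ c.wR) (h3 : ∀ j ∈ c.wIM, j = 0) (h4 : ∀ j ∈ c.wRM, j = 0) :
    Pre N k H v' :=
  h.congr (fun d hd => hf.ir d fun h => by have := h1 d h; omega) (hf.rr 1 h2)
    (fun j hj => hf.im j fun h => by have := h3 j h; omega)
    (fun j hj => hf.rm j fun h => by have := h4 j h; omega)

/-- Blocks are taken off the right end `e` by increasing size while they fit. At level `h`, where `2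
^ h` divides `e`, a block is removed iff the quotient is odd, and afterwards `2 ^ (h + 1)` divides
`e`. -/
def queryUp (d : ℕ) : Cmd :=
  .whl (.ile (.add (.r 7) (.c 1)) (.r 2))
    (.seq (.ite (.ile (.add (.r 4) (.r 8)) (.r 6))
      (.ite (.ile (.c 1) (.sub (.div (.r 6) (.r 8)) (.mul (.div (.div (.r 6) (.r 8)) (.c 2)) (.c 2))))
        (process d) .skip) .skip)
    (.seq (.iset 7 (.add (.r 7) (.c 1)))
    (.seq (.iset 8 (.mul (.r 8) (.c 2))) (.iset 9 (.add (.r 9) (.r 0))))))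

/-- Now `e` is a multiple of every block size that still fits, so aligned blocks can be taken off by
decreasing size. One block per level suffices, since less than `2 ^ (h + 1)` vertices remain when
level `h` is reached. -/
def queryDown (d : ℕ) : Cmd :=
  .whl (.ile (.c 1) (.r 7))
    (.seq (.iset 7 (.sub (.r 7) (.c 1)))
    (.seq (.iset 8 (.div (.r 8) (.c 2)))
    (.seq (.iset 9 (.sub (.r 9) (.r 0)))
      (.ite (.ile (.add (.r 4) (.r 8)) (.r 6)) (process d) .skip))))

/-- Store in the real register `4` the time to evacuate the vertices from (register) `4` on to the
vertex (register) `5` in direction `d`. -/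
def query (d : ℕ) : Cmd :=
  .seq (.iset 6 (.r 5)) (.seq (.iset 7 (.c 0)) (.seq (.iset 8 (.c 1)) (.seq (.iset 9 (.c 0))
  (.seq (.rset 5 (.c 0)) (.seq (.rset 4 (.sub (.c 0) (.ld (3 + d) (.r 5))))
  (.seq (.rset 7 (.ld (1 + d) (.r 4))) (.seq (queryUp d) (.seq (queryDown d)
  (.rset 4 (.add (.r 4) (.ld (3 + d) (.r 5))))))))))))

lemma process_wI (d : ℕ) : (process d).wI = [14, 10, 11, 12, 13, 13, 10, 11, 10, 11, 12, 13, 13,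
    10, 11, 6] := by simp [process, evalEnv, bsearch]

lemma process_wR (d : ℕ) : (process d).wR = [6, 8, 4, 6, 8, 8, 4, 5] := by
  simp [process, evalEnv, bsearch]

lemma process_wIM (d : ℕ) : (process d).wIM = [] := by simp [process, evalEnv, bsearch]

lemma process_wRM (d : ℕ) : (process d).wRM = [] := by simp [process, evalEnv, bsearch]

lemma wp_queryUp {d a m : ℕ} (hd : d < 2) (hpre : Pre N k H v) (hbig : Big N.n k H V)
    (ha : v.ir 4 = a) (he : v.ir 6 = m) (hh : v.ir 7 = 0) (hpw : v.ir 8 = 1) (hrow : v.ir 9 = 0)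
    (ham : a ≤ m) (hm : m < N.n) (hSa : v.rr 7 = Sw N d a)
    (hacc : Acc N d a m m (v.rr 5) (v.rr 4)) :
    Wp off V (queryUp d) v fun t w => t ≤ H * (88 * H + 300) + 7 + 1 ∧ w.ir 7 = H ∧
      w.ir 8 = 2 ^ H ∧ w.ir 9 = H * N.n ∧ ∃ e, w.ir 6 = e ∧ a ≤ e ∧ e ≤ m ∧
      (∀ h, a + 2 ^ h ≤ e → 2 ^ h ∣ e) ∧ Acc N d a m e (w.rr 5) (w.rr 4) := by
  have hle := hbig.le
  have hpl := hbig.pow_le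
  have hlp := hbig.le_pow
  refine wp_whl (fun j w => ∃ h e, j + h = H ∧ w.ir 7 = h ∧ w.ir 8 = 2 ^ h ∧ w.ir 9 = h * N.n ∧
    w.ir 6 = e ∧ a ≤ e ∧ e ≤ m ∧ (∀ h' ≤ h, a + 2 ^ h' ≤ e → 2 ^ h' ∣ e) ∧
    Acc N d a m e (w.rr 5) (w.rr 4)) H (88 * H + 270) ?_ ?_ ?_ ?_
  · refine ⟨0, m, by omega, hh, by simpa using hpw, by simpa using hrow, he, ham, le_rfl,
      fun h' hh' _ => ?_, hacc⟩
    obtain rfl : h' = 0 := by omega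
    simp
  · rintro j w hf ⟨h, e, hj, w7, -⟩
    simp [w7]; omega
  · rintro j w hf ⟨h, e, hj, w7, w8, w9, w6, hae, hem, hdiv, hacc⟩ hc
    have w4 : w.ir 4 = a := by rw [hf.ir 4 (by simp [process_wI]), ha]
    have w2 : w.ir 2 = H := by rw [hf.ir 2 (by simp [process_wI]), hpre.glob.H]
    have wp : Pre N k H w := hpre.of_fr hf (by simp [process_wI]) (by simp [process_wR])
      (by simp [process_wIM]) (by simp [process_wRM])
    have w0 := wp.glob.n
    have wS : w.rr 7 = Sw N d a := by rw [hf.rr 7 (by simp [process_wR]), hSa]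
    simp [w7, w2] at hc
    have hp : 0 < 2 ^ h := by positivity
    have hpH : 2 ^ (h + 1) ≤ 2 ^ H := Nat.pow_le_pow_right (by omega) hc
    rw [pow_succ] at hpH
    have hrown : h * N.n + N.n ≤ H * N.n := by
      have := Nat.mul_le_mul_right N.n hc
      rw [Nat.succ_mul] at this; omega
    have tail : ∀ (t : ℕ) (w' : VState) (e' : ℕ), t ≤ 88 * H + 245 → w'.ir 7 = h →
        w'.ir 8 = 2 ^ h → w'.ir 9 = h * N.n → w'.ir 0 = N.n → w'.ir 6 = e' → a ≤ e' → e' ≤ m →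
        (∀ h' ≤ h + 1, a + 2 ^ h' ≤ e' → 2 ^ h' ∣ e') →
        Acc N d a m e' (w'.rr 5) (w'.rr 4) →
        Wp off V (.seq (.iset 7 (.add (.r 7) (.c 1)))
          (.seq (.iset 8 (.mul (.r 8) (.c 2))) (.iset 9 (.add (.r 9) (.r 0))))) w'
          fun t₂ v₂ => t + t₂ ≤ 88 * H + 270 ∧ ∃ j' < j, ∃ h e, j' + h = H ∧ v₂.ir 7 = h ∧
            v₂.ir 8 = 2 ^ h ∧ v₂.ir 9 = h * N.n ∧ v₂.ir 6 = e ∧ a ≤ e ∧ e ≤ m ∧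
            (∀ h' ≤ h, a + 2 ^ h' ≤ e → 2 ^ h' ∣ e) ∧ Acc N d a m e (v₂.rr 5) (v₂.rr 4) := by
      intro t w' e' ht k7 k8 k9 k0 k6 h1 h2 h3 h4
      refine wp_seq.2 (wp_iset.2 ⟨?_, wp_seq.2 (wp_iset.2 ⟨?_, wp_iset.2 ⟨?_, ?_, ?_⟩⟩)⟩)
      · simp [k7]; omega
      · simp [k8]; omega
      · simp [k9, k0]; omega
      · simp; omega
      · exact ⟨j - 1, by omega, h + 1, e', by omega, by simp [k7], by simp [k8, pow_succ],
          by simp [k9, k0]; ring, by simp [k6], h1, h2, h3, by simpa using h4⟩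
    have hmul : e / 2 ^ h / 2 * 2 ≤ e := (Nat.div_mul_le_self _ _).trans (Nat.div_le_self _ _)
    refine wp_seq.2 (wp_ite.2 ⟨?_, fun hc1 => wp_ite.2 ⟨?_, fun hc2 => ?_, fun hc2 => ?_⟩,
      fun hc1 => ?_⟩)
    · simp [w4, w8]; omega
    · simp [w6, w8]; omega
    · simp [w4, w8, w6] at hc1 hc2
      have hd2 := hdiv h le_rfl hc1
      refine (wp_process hd wp hbig w4 w6 w8 w9 hc hc1 hd2 hem hm wS hacc).frame.mono ?_
      rintro t w' ⟨⟨ht, k6, hacc'⟩, hf'⟩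
      refine tail _ w' (e - 2 ^ h) ?_ ?_ ?_ ?_ ?_ k6 (by omega) (by omega) ?_ hacc'
      · simp; omega
      · rw [hf'.ir 7 (by simp [process_wI]), w7]
      · rw [hf'.ir 8 (by simp [process_wI]), w8]
      · rw [hf'.ir 9 (by simp [process_wI]), w9]
      · rw [hf'.ir 0 (by simp [process_wI]), w0]
      · intro h' hh' _
        have hdd : 2 ^ (h + 1) ∣ e - 2 ^ h := by
          obtain ⟨c, rfl⟩ := hd2
          rw [Nat.mul_div_cancel_left _ hp] at hc2
          obtain ⟨c', rfl⟩ : ∃ c', c = 2 * c' + 1 := ⟨c / 2, by omega⟩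
          refine ⟨c', ?_⟩
          rw [pow_succ, Nat.mul_add, mul_one, Nat.add_sub_cancel]; ring
        exact (Nat.pow_dvd_pow 2 hh').trans hdd
    · simp [w4, w8, w6] at hc1 hc2
      refine wp_skip.2 (tail _ w e ?_ w7 w8 w9 w0 w6 hae hem (fun h' hh' h1 => ?_) hacc)
      · simp
      · rcases Nat.lt_succ_iff_lt_or_eq.1 (Nat.lt_succ_of_le hh') with h2 | rfl
        · exact hdiv h' (by omega) h1
        · obtain ⟨c, rfl⟩ := hdiv h le_rfl hc1
          rw [Nat.mul_div_cancel_left _ hp] at hc2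
          obtain ⟨c', rfl⟩ : ∃ c', c = 2 * c' := ⟨c / 2, by omega⟩
          exact ⟨c', by rw [pow_succ]; ring⟩
    · simp [w4, w8, w6] at hc1
      refine wp_skip.2 (tail _ w e ?_ w7 w8 w9 w0 w6 hae hem (fun h' hh' h1 => ?_) hacc)
      · simp
      · rcases Nat.lt_succ_iff_lt_or_eq.1 (Nat.lt_succ_of_le hh') with h2 | rfl
        · exact hdiv h' (by omega) h1
        · rw [pow_succ] at h1; omega
  · rintro t j w hf ⟨h, e, hj, w7, w8, w9, w6, hae, hem, hdiv, hacc⟩ hc ht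
    have w2 : w.ir 2 = H := by rw [hf.ir 2 (by simp [process_wI]), hpre.glob.H]
    simp [w7, w2] at hc
    obtain rfl : h = H := by omega
    refine ⟨?_, w7, w8, w9, e, w6, hae, hem, fun h' h1 => ?_, hacc⟩
    · refine ht.trans (Nat.add_le_add (Nat.add_le_add (Nat.mul_le_mul_left _ ?_) ?_) le_rfl) <;>
        simp only [Cond.len, IExp.len] <;> omega
    · by_cases h2 : h' ≤ h
      · exact hdiv h' h2 h1
      · have := Nat.pow_le_pow_right (n := 2) (by omega) (show h ≤ h' by omega)
        omega

lemma wp_queryDown {d a m e : ℕ} (hd : d < 2) (hpre : Pre N k H v) (hbig : Big N.n k H V)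
    (ha : v.ir 4 = a) (he : v.ir 6 = e) (hh : v.ir 7 = H) (hpw : v.ir 8 = 2 ^ H)
    (hrow : v.ir 9 = H * N.n) (hae : a ≤ e) (hem : e ≤ m) (hm : m < N.n)
    (hdiv : ∀ h, a + 2 ^ h ≤ e → 2 ^ h ∣ e) (hSa : v.rr 7 = Sw N d a)
    (hacc : Acc N d a m e (v.rr 5) (v.rr 4)) :
    Wp off V (queryDown d) v fun t w => t ≤ H * (88 * H + 300) + 7 + 1 ∧
      Acc N d a m a (w.rr 5) (w.rr 4) := by
  have hle := hbig.le
  have hpl := hbig.pow_le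
  have hlp := hbig.le_pow
  refine wp_whl (fun h w => h ≤ H ∧ ∃ e, w.ir 7 = h ∧ w.ir 8 = 2 ^ h ∧ w.ir 9 = h * N.n ∧
    w.ir 6 = e ∧ a ≤ e ∧ e ≤ m ∧ e < a + 2 ^ h ∧ (∀ h', a + 2 ^ h' ≤ e → 2 ^ h' ∣ e) ∧
    Acc N d a m e (w.rr 5) (w.rr 4)) H (88 * H + 270) ?_ ?_ ?_ ?_
  · exact ⟨le_rfl, e, hh, hpw, hrow, he, hae, hem, by omega, hdiv, hacc⟩
  · rintro j w hf -
    simp; omega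
  · rintro h w hf ⟨hhH, e, w7, w8, w9, w6, hae, hem, heh, hdiv, hacc⟩ hc
    have w4 : w.ir 4 = a := by rw [hf.ir 4 (by simp [process_wI]), ha]
    have w2 : w.ir 2 = H := by rw [hf.ir 2 (by simp [process_wI]), hpre.glob.H]
    have w0 : w.ir 0 = N.n := by rw [hf.ir 0 (by simp [process_wI]), hpre.glob.n]
    simp [w7] at hc
    obtain ⟨h, rfl⟩ : ∃ h', h = h' + 1 := ⟨h - 1, by omega⟩
    have hp : 0 < 2 ^ h := by positivity
    have hpH : 2 ^ (h + 1) ≤ 2 ^ H := Nat.pow_le_pow_right (by omega) hhH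
    refine wp_seq.2 (wp_iset.2 ⟨?_, wp_seq.2 (wp_iset.2 ⟨?_, wp_seq.2 (wp_iset.2 ⟨?_, ?_⟩)⟩)⟩)
    · simp; omega
    · simp; omega
    · simp
    rw [pow_succ] at hpH heh w8
    set w' := ((w.setI 7 _).setI 8 _).setI 9 _ with hw'
    have k7 : w'.ir 7 = h := by simp [hw', w7]
    have k8 : w'.ir 8 = 2 ^ h := by simp [hw', w8]
    have k9 : w'.ir 9 = h * N.n := by simp [hw', w9, w0, Nat.add_mul]
    have k6 : w'.ir 6 = e := by simp [hw', w6]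
    have k4 : w'.ir 4 = a := by simp [hw', w4]
    have hf2 : Fr (queryDown d) v w' := by
      refine (hf.of_subset (c' := queryDown d) (List.Subset.refl _) (List.Subset.refl _)
        (List.Subset.refl _) (List.Subset.refl _)).trans ⟨fun i hi => ?_, fun _ _ => rfl, fun _ _ => rfl, fun _ _ => rfl⟩
      simp [queryDown, process_wI] at hi
      simp [hw', hi]
    have wp : Pre N k H w' := hpre.of_fr hf2 (by simp [queryDown, process_wI])
      (by simp [queryDown, process_wR]) (by simp [queryDown, process_wIM])
      (by simp [queryDown, process_wRM])
    have wS : w'.rr 7 = Sw N d a := by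
      rw [hf2.rr 7 (by simp [queryDown, process_wR]), hSa]
    have hacc' : Acc N d a m e (w'.rr 5) (w'.rr 4) := by simpa [hw'] using hacc
    refine wp_ite.2 ⟨?_, fun hc1 => ?_, fun hc1 => wp_skip.2 ⟨?_, ?_⟩⟩
    · simp [k4, k8]; omega
    · simp [k4, k8, k6] at hc1
      refine (wp_process hd wp hbig k4 k6 k8 k9 (by omega) hc1 (hdiv h hc1) hem hm wS
        hacc').frame.mono ?_
      rintro t u ⟨⟨ht, l6, hacc'⟩, hf'⟩
      refine ⟨by simp; omega, h, by omega, by omega, e - 2 ^ h, ?_, ?_, ?_, l6, by omega, by omega,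
        by omega, fun h' h1 => ?_, hacc'⟩
      · rw [hf'.ir 7 (by simp [process_wI]), k7]
      · rw [hf'.ir 8 (by simp [process_wI]), k8]
      · rw [hf'.ir 9 (by simp [process_wI]), k9]
      · have h2 : h' ≤ h := by
          by_contra h3
          have := Nat.pow_le_pow_right (n := 2) (by omega) (show h + 1 ≤ h' by omega)
          rw [pow_succ] at this
          omega
        exact Nat.dvd_sub (hdiv h' (by omega)) (Nat.pow_dvd_pow 2 h2)
    · simp
    · simp [k4, k8, k6] at hc1
      exact ⟨h, by omega, by omega, e, k7, k8, k9, k6, hae, hem, hc1, hdiv, hacc'⟩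
  · rintro t j w hf ⟨hj, e, w7, w8, w9, w6, hae, hem, heh, hdiv, hacc⟩ hc ht
    simp [w7] at hc
    subst hc
    obtain rfl : e = a := by simp at heh; omega
    refine ⟨?_, hacc⟩
    refine ht.trans (Nat.add_le_add (Nat.add_le_add (Nat.mul_le_mul_left _ ?_) ?_) le_rfl) <;>
      simp only [Cond.len, IExp.len] <;> omega

lemma query_wI (d : ℕ) : ∀ i ∈ (query d).wI, 6 ≤ i ∧ i < 20 := by
  simp [query, queryUp, queryDown, process_wI]

lemma query_wR (d : ℕ) : ∀ i ∈ (query d).wR, 4 ≤ i ∧ i < 10 := by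
  simp [query, queryUp, queryDown, process_wR]

lemma query_wIM (d : ℕ) : (query d).wIM = [] := by
  simp [query, queryUp, queryDown, process_wIM]

lemma query_wRM (d : ℕ) : (query d).wRM = [] := by
  simp [query, queryUp, queryDown, process_wRM]

/-- Time of a query. -/
def tq (H : ℕ) : ℕ := 2 * (H * (88 * H + 300)) + 100

theorem wp_query {d a m : ℕ} (hd : d < 2) (hpre : Pre N k H v) (hbig : Big N.n k H V)
    (ha : v.ir 4 = a) (hm : v.ir 5 = m) (ham : a ≤ m) (hmn : m < N.n) :
    Wp off V (query d) v fun t w => t ≤ tq H ∧ w.rr 4 = Lt N d a m ∧ Fr (query d) v w := by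
  suffices h : Wp off V (query d) v fun t w => t ≤ tq H ∧ w.rr 4 = Lt N d a m from
    h.frame.mono fun t w h => ⟨h.1.1, h.1.2, h.2⟩
  have hle := hbig.le
  have d1 : 3 + d < 32 := by omega
  have d2 : 1 + d < 32 := by omega
  have hD := (hpre.tab d hd).D m hmn
  have hS := (hpre.tab d hd).S a (by omega)
  refine wp_seq.2 (wp_iset.2 ⟨trivial, wp_seq.2 (wp_iset.2 ⟨Nat.zero_le _, wp_seq.2 (wp_iset.2
    ⟨?_, wp_seq.2 (wp_iset.2 ⟨Nat.zero_le _, wp_seq.2 (wp_rset.2 ⟨trivial, wp_seq.2 (wp_rset.2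
    ⟨?_, wp_seq.2 (wp_rset.2 ⟨?_, wp_seq.2 ?_⟩)⟩)⟩)⟩)⟩)⟩)⟩)
  · simp; omega
  · simp [d1, hm]; omega
  · simp [d2, ha]; omega
  set w := ((((((v.setI 6 _).setI 7 _).setI 8 _).setI 9 _).setR 5 _).setR 4 _).setR 7 _ with hw
  have wp : Pre N k H w := hpre.congr (fun i hi => by
      have h1 : i ≠ 6 := by omega
      have h2 : i ≠ 7 := by omega
      have h3 : i ≠ 8 := by omega
      have h4 : i ≠ 9 := by omega
      simp [hw, h1, h2, h3, h4]) (by simp [hw]) (fun _ _ => by simp [hw]) (fun _ _ => by simp [hw])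
  have wS : w.rr 7 = Sw N d a := by simp [hw, ha, hS]
  refine (wp_queryUp (a := a) (m := m) hd wp hbig (by simp [hw, ha]) (by simp [hw, hm])
    (by simp [hw]) (by simp [hw]) (by simp [hw]) ham hmn wS ?_).frame.mono ?_
  · have : w.rr 5 = 0 := by simp [hw]
    rw [this]
    have : w.rr 4 = - Dl N d m := by simp [hw, hm, hD]
    rw [this]
    exact Acc.init
  rintro t1 w1 ⟨⟨ht1, k7, k8, k9, e, k6, hae, hem, hdiv, hacc⟩, hf1⟩
  have wp1 : Pre N k H w1 := wp.of_fr hf1 (by simp [queryUp, process_wI])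
      (by simp [queryUp, process_wR]) (by simp [queryUp, process_wIM])
      (by simp [queryUp, process_wRM])
  refine wp_seq.2 ((wp_queryDown (a := a) (m := m) hd wp1 hbig ?_ k6 k7 k8 k9 hae hem hmn hdiv ?_
    hacc).frame.mono ?_)
  · rw [hf1.ir 4 (by simp [queryUp, process_wI])]; simp [hw, ha]
  · rw [hf1.rr 7 (by simp [queryUp, process_wR]), wS]
  rintro t2 w2 ⟨⟨ht2, hacc⟩, hf2⟩
  have e5 : w2.ir 5 = m := by
    rw [hf2.ir 5 (by simp [queryDown, process_wI]), hf1.ir 5 (by simp [queryUp, process_wI])]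
    simp [hw, hm]
  have eD : w2.rm (3 + d) m = Dl N d m := by
    rw [hf2.rm _ (by simp [queryDown, process_wRM])]
    exact (wp1.tab d hd).D m hmn
  refine wp_rset.2 ⟨?_, ?_, ?_⟩
  · simp [d1, e5]; omega
  · simp [tq]; omega
  · simp [e5, eD, hacc.final rfl]

end SinkRAM

namespace SinkRAM

variable {off V : ℕ} {v : VState} {N : PathNetwork} {k H : ℕ}

/-! ## The greedy algorithm

Comparisons of values with the time are made by a command `cmp`, which leaves `1` in the register
`15` if the value in the real register `10` is at most the time, otherwise `0`.  It may work with a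
set of times, and shrink it so that the answer is the same for all of them. -/

/-- The set `𝒯` of times and the invariant `I` depend on the real registers `p` and `q`. -/
structure CmpSpec (off V : ℕ) (N : PathNetwork) (k H : ℕ) (p q : ℕ) (I : ℝ → ℝ → Prop)
    (𝒯 : ℝ → ℝ → Set ℝ) (ρ : ℕ) (cmp : Cmd) (tc : ℕ) : Prop where
  nonneg : ∀ x y, I x y → ∀ T ∈ 𝒯 x y, 0 ≤ T
  wp : ∀ v, Pre N k H v → I (v.rr p) (v.rr q) → 0 ≤ v.rr 10 →
    Wp off V cmp v fun t w => t ≤ tc ∧ I (w.rr p) (w.rr q) ∧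
      𝒯 (w.rr p) (w.rr q) ⊆ 𝒯 (v.rr p) (v.rr q) ∧
      (1 ≤ w.ir 15 → ∀ T ∈ 𝒯 (w.rr p) (w.rr q), v.rr 10 ≤ T) ∧
      (w.ir 15 = 0 → ∀ T ∈ 𝒯 (w.rr p) (w.rr q), T < v.rr 10)
  wI : ∀ i ∈ cmp.wI, 3 ≤ i ∧ i < ρ
  wR : 1 ∉ cmp.wR
  wIM : cmp.wIM = []
  wRM : cmp.wRM = []
  -- Queries and tests overwrite the real registers 4 to 10 and 12.
  hp : p < 4 ∨ p = 11
  hq : q < 4 ∨ q = 11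
  hρ : 20 ≤ ρ

def testM (ρ : ℕ) (cmp : Cmd) : Cmd :=
  .seq (.iset 4 (.r ρ)) (.seq (.iset 5 (.r (ρ + 3))) (.seq (query 0) (.seq (.rset 10 (.r 4)) cmp)))

/-- The value to be compared is `Vt`. Its part `Rt` is a query in the direction `1`, with vertices
reflected by `i ↦ n - 1 - i`. -/
def testB (ρ : ℕ) (cmp : Cmd) : Cmd :=
  .seq (.iset 4 (.r ρ)) (.seq (.iset 5 (.add (.r (ρ + 1)) (.c 1))) (.seq (query 0)
  (.seq (.rset 12 (.sub (.r 4) (.sub (.ld 3 (.add (.r (ρ + 1)) (.c 1))) (.ld 3 (.r (ρ + 1))))))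
  (.seq (.iset 4 (.sub (.sub (.r 0) (.c 1)) (.r (ρ + 6))))
  (.seq (.iset 5 (.sub (.sub (.r 0) (.c 1)) (.r (ρ + 1)))) (.seq (query 1)
  (.seq (.rset 12 (.div (.add (.r 12) (.r 4)) (.c 2)))
  (.seq (.ite (.rle (.r 4) (.r 12)) (.rset 10 (.r 4)) (.rset 10 (.r 12))) cmp))))))))

/-- From the first vertex of a subpath (register `ρ`), find the place of the sink
(register `ρ + 1`) and the last vertex (register `ρ + 4`). -/
def greedyStep (ρ : ℕ) (cmp : Cmd) : Cmd :=
  .seq (.iset (ρ + 1) (.r ρ)) (.seq (.iset (ρ + 2) (.r 0))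
  (.seq (bsearch (ρ + 1) (ρ + 2) (ρ + 3) 15 (testM ρ cmp))
  (.seq (.iset (ρ + 4) (.r (ρ + 1))) (.seq (.iset (ρ + 5) (.r 0))
  (bsearch (ρ + 4) (ρ + 5) (ρ + 6) 15 (testB ρ cmp))))))

section

variable {p q ρ tc : ℕ} {I : ℝ → ℝ → Prop} {𝒯 : ℝ → ℝ → Set ℝ} {cmp : Cmd}

/-- The pair `(m, m)` alone shows that `Lt N 0 a (m + 1)` is at least the transit time of edge `m`,
so the mean in `Vt` is nonnegative. Comparison procedures are only specified for nonnegative values.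
-/
lemma Vt_nonneg {a m b : ℕ} (ham : a ≤ m) (hm : m + 1 < N.n) : 0 ≤ Vt N a m b := by
  have h1 := ((Lt_le_iff N).1 (le_refl (Lt N 0 a (m + 1)))).2 m m ham le_rfl (by omega)
  have h2 := mul_nonneg (sub_nonneg.2 (Sw_mono N (d := 0) (show a ≤ m + 1 by omega)))
    (uc_pos N (d := 0) hm).le
  have h3 := Rt_nonneg N (m := m) (b := b)
  exact le_min h3 (by linarith)

/-- The outcome of a test of the value `x`. -/
def Outcome (p q : ℕ) (I : ℝ → ℝ → Prop) (𝒯 : ℝ → ℝ → Set ℝ) (x : ℝ) (v w : VState) : Prop :=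
  I (w.rr p) (w.rr q) ∧ 𝒯 (w.rr p) (w.rr q) ⊆ 𝒯 (v.rr p) (v.rr q) ∧
    (1 ≤ w.ir 15 → ∀ T ∈ 𝒯 (w.rr p) (w.rr q), x ≤ T) ∧
    (w.ir 15 = 0 → ∀ T ∈ 𝒯 (w.rr p) (w.rr q), T < x)

lemma CmpSpec.rr_query (hc : CmpSpec off V N k H p q I 𝒯 ρ cmp tc) {d : ℕ} {v w : VState}
    (hf : Fr (query d) v w) : w.rr p = v.rr p ∧ w.rr q = v.rr q := by
  have hp := hc.hp
  have hq := hc.hq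
  exact ⟨hf.rr _ fun h => by have := query_wR _ _ h; omega,
    hf.rr _ fun h => by have := query_wR _ _ h; omega⟩

lemma Pre.query {d : ℕ} {w : VState} (h : Pre N k H v) (hf : Fr (query d) v w) : Pre N k H w :=
  h.of_fr hf (fun i hi => by have := query_wI _ _ hi; omega)
    (fun h => by have := query_wR _ _ h; omega) (by simp [query_wIM]) (by simp [query_wRM])

lemma wp_testM (hc : CmpSpec off V N k H p q I 𝒯 ρ cmp tc) (hbig : Big N.n k H V)
    (hpre : Pre N k H v) (hI : I (v.rr p) (v.rr q)) {a m : ℕ} (ha : v.ir ρ = a)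
    (hm : v.ir (ρ + 3) = m) (ham : a ≤ m) (hmn : m < N.n) :
    Wp off V (testM ρ cmp) v fun t w => t ≤ tq H + tc + 20 ∧
      Outcome p q I 𝒯 (Lt N 0 a m) v w := by
  have hρ := hc.hρ
  have hp := hc.hp
  have hq := hc.hq
  have p10 : p ≠ 10 := by omega
  have q10 : q ≠ 10 := by omega
  refine wp_seq.2 (wp_iset.2 ⟨trivial, wp_seq.2 (wp_iset.2 ⟨trivial, wp_seq.2 ?_⟩)⟩)
  set v1 := (v.setI 4 _).setI 5 _ with hv1
  have pre1 : Pre N k H v1 := hpre.congr (fun i hi => by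
    have h1 : i ≠ 4 := by omega
    have h2 : i ≠ 5 := by omega
    simp [hv1, h1, h2]) rfl (fun _ _ => rfl) (fun _ _ => rfl)
  have r4 : ρ + 3 ≠ 4 := by omega
  refine (wp_query (d := 0) (a := a) (m := m) (by omega) pre1 hbig (by simp [hv1, ha])
    (by simp [hv1, r4, hm]) ham hmn).mono ?_
  rintro t2 v2 ⟨ht2, h4, hf2⟩
  obtain ⟨ep, eq⟩ := hc.rr_query hf2
  refine wp_seq.2 (wp_rset.2 ⟨trivial, ?_⟩)
  have pre2 : Pre N k H (v2.setR 10 ((RExp.r 4).eval v2)) :=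
    (pre1.query hf2).congr (fun i _ => rfl) (by simp) (fun _ _ => rfl) (fun _ _ => rfl)
  refine (hc.wp _ pre2 ?_ ?_).mono ?_
  · simp only [VState.setR_rr, p10, q10, if_false, ep, eq]; exact hI
  · simp [h4, Lt_nonneg]
  · rintro t3 v3 ⟨ht3, h5, h6, h7, h8⟩
    simp only [VState.setR_rr, p10, q10, if_false, ep, eq, if_true, RExp.eval, h4] at h6 h7 h8
    exact ⟨by simp; omega, h5, h6, h7, h8⟩

lemma wp_testB (hc : CmpSpec off V N k H p q I 𝒯 ρ cmp tc) (hbig : Big N.n k H V)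
    (hpre : Pre N k H v) (hI : I (v.rr p) (v.rr q)) {a m b : ℕ} (ha : v.ir ρ = a)
    (hm : v.ir (ρ + 1) = m) (hb : v.ir (ρ + 6) = b) (ham : a ≤ m) (hmb : m < b) (hbn : b < N.n) :
    Wp off V (testB ρ cmp) v fun t w => t ≤ 2 * tq H + tc + 100 ∧
      Outcome p q I 𝒯 (Vt N a m b) v w := by
  have hρ := hc.hρ
  have hp := hc.hp
  have hq := hc.hq
  have hle := hbig.le
  have p10 : p ≠ 10 := by omega
  have q10 : q ≠ 10 := by omega
  have p12 : p ≠ 12 := by omega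
  have q12 : q ≠ 12 := by omega
  have r1 : ρ + 1 ≠ 4 := by omega
  have r2 : ρ + 1 ≠ 5 := by omega
  have r3 : ρ + 6 ≠ 4 := by omega
  have r4 : ρ + 6 ≠ 5 := by omega
  have r5 : ρ ≠ 4 := by omega
  refine wp_seq.2 (wp_iset.2 ⟨trivial, wp_seq.2 (wp_iset.2 ⟨?_, wp_seq.2 ?_⟩)⟩)
  · simp [r1, hm]; omega
  set v1 := (v.setI 4 _).setI 5 _ with hv1
  have pre1 : Pre N k H v1 := hpre.congr (fun i hi => by
    have h1 : i ≠ 4 := by omega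
    have h2 : i ≠ 5 := by omega
    simp [hv1, h1, h2]) rfl (fun _ _ => rfl) (fun _ _ => rfl)
  refine (wp_query (d := 0) (a := a) (m := m + 1) (by omega) pre1 hbig (by simp [hv1, ha])
    (by simp [hv1, r1, hm]) (by omega) (by omega)).mono ?_
  rintro t2 v2 ⟨ht2, h4, hf2⟩
  obtain ⟨ep, eq⟩ := hc.rr_query hf2
  have pre2 := pre1.query hf2
  have g1 : v2.ir (ρ + 1) = m := by
    rw [hf2.ir _ fun h => by have := query_wI _ _ h; omega]; simp [hv1, r1, r2, hm]
  have g6 : v2.ir (ρ + 6) = b := by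
    rw [hf2.ir _ fun h => by have := query_wI _ _ h; omega]; simp [hv1, r3, r4, hb]
  have g0 := pre2.glob.n
  have gD := (pre2.tab 0 (by omega)).D
  refine wp_seq.2 (wp_rset.2 ⟨?_, wp_seq.2 (wp_iset.2 ⟨?_, wp_seq.2 (wp_iset.2 ⟨?_,
    wp_seq.2 ?_⟩)⟩)⟩)
  · simp [g1]; omega
  · simp; omega
  · simp; omega
  set v3 := ((v2.setR 12 _).setI 4 _).setI 5 _ with hv3
  have pre3 : Pre N k H v3 := pre2.congr (fun i hi => by
    have h1 : i ≠ 4 := by omega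
    have h2 : i ≠ 5 := by omega
    simp [hv3, h1, h2]) (by simp [hv3]) (fun _ _ => rfl) (fun _ _ => rfl)
  refine (wp_query (d := 1) (a := N.n - 1 - b) (m := N.n - 1 - m) (by omega) pre3 hbig
    (by simp [hv3, g0, g6]) (by simp [hv3, g0, g1, r1]) (by omega) (by omega)).mono ?_
  rintro t4 v4 ⟨ht4, h44, hf4⟩
  obtain ⟨ep4, eq4⟩ := hc.rr_query hf4
  have pre4 := pre3.query hf4
  have e12 : v4.rr 12 = Lt N 0 a (m + 1) - (Dl N 0 (m + 1) - Dl N 0 m) := by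
    rw [hf4.rr 12 fun h => by have := query_wR _ _ h; omega]
    have e1 := gD (m + 1) (by omega)
    have e2 := gD m (by omega)
    simp only [add_zero] at e1 e2
    simp [hv3, h4, g1, e1, e2]
  have e4 : v4.rr 4 = Rt N m b := h44
  refine wp_seq.2 (wp_rset.2 ⟨⟨⟨trivial, trivial⟩, trivial⟩, wp_seq.2 ?_⟩)
  set v5 := v4.setR 12 _ with hv5
  have f12 : v5.rr 12 = (Lt N 0 a (m + 1) + Rt N m b - (Dl N 0 (m + 1) - Dl N 0 m)) / 2 := by
    simp [hv5, e12, e4]; ring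
  have f4 : v5.rr 4 = Rt N m b := by simp [hv5, e4]
  have fp : v5.rr p = v.rr p := by
    simp [hv5, p12, ep4, hv3, ep, hv1]
  have fq : v5.rr q = v.rr q := by
    simp [hv5, q12, eq4, hv3, eq, hv1]
  have final : ∀ (t : ℕ) (x : ℝ), t ≤ 12 → x = Vt N a m b →
      Wp off V cmp (v5.setR 10 x) fun t' w =>
        (IExp.r ρ).len + 2 + ((((IExp.r (ρ + 1)).add (IExp.c 1)).len + 2) + (t2 + (
          (((RExp.r 4).sub ((RExp.ld 3 ((IExp.r (ρ + 1)).add (IExp.c 1))).sub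
            (RExp.ld 3 (IExp.r (ρ + 1))))).len + 2) +
          (((((IExp.r 0).sub (IExp.c 1)).sub (IExp.r (ρ + 6))).len + 2) +
          (((((IExp.r 0).sub (IExp.c 1)).sub (IExp.r (ρ + 1))).len + 2) + (t4 +
          ((((RExp.r 12).add (RExp.r 4)).div (RExp.c 2)).len + 2 + (t + t')))))))) ≤
          2 * tq H + tc + 100 ∧ Outcome p q I 𝒯 (Vt N a m b) v w := by
    intro t x ht hx
    have pre5 : Pre N k H (v5.setR 10 x) := pre4.congr (fun i _ => rfl) (by simp [hv5])
      (fun _ _ => rfl) (fun _ _ => rfl)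
    refine (hc.wp _ pre5 ?_ ?_).mono ?_
    · simp only [VState.setR_rr, p10, q10, if_false, fp, fq]; exact hI
    · simp [hx, Vt_nonneg ham (show m + 1 < N.n by omega)]
    · rintro t6 v6 ⟨ht6, h5, h6, h7, h8⟩
      simp only [VState.setR_rr, p10, q10, if_false, fp, fq, if_true, hx] at h6 h7 h8
      exact ⟨by simp; omega, h5, h6, h7, h8⟩
  refine wp_ite.2 ⟨⟨trivial, trivial⟩, fun hle => wp_rset.2 ⟨trivial, ?_⟩,
    fun hle => wp_rset.2 ⟨trivial, ?_⟩⟩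
  · simp only [Cond.Holds, RExp.eval, f4, f12] at hle
    exact final _ _ (by simp) (by simp only [RExp.eval, f4]; exact (min_eq_left hle).symm)
  · simp only [Cond.Holds, RExp.eval, f4, f12, not_le] at hle
    exact final _ _ (by simp) (by simp only [RExp.eval, f12]; exact (min_eq_right hle.le).symm)

/-- Time of a greedy step. -/
def tg (H tc : ℕ) : ℕ := 2 * (H * (2 * tq H + tc + 126)) + 60

lemma testM_wI (ρ : ℕ) (cmp : Cmd) :
    (testM ρ cmp).wI = 4 :: 5 :: ((query 0).wI ++ cmp.wI) := by simp [testM]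

lemma testB_wI (ρ : ℕ) (cmp : Cmd) :
    (testB ρ cmp).wI = 4 :: 5 :: ((query 0).wI ++ 4 :: 5 :: ((query 1).wI ++ cmp.wI)) := by
  simp [testB]

lemma greedyStep_wI (hc : CmpSpec off V N k H p q I 𝒯 ρ cmp tc) :
    ∀ i ∈ (greedyStep ρ cmp).wI, 3 ≤ i ∧ i < ρ + 7 ∧ i ≠ ρ := by
  have hρ := hc.hρ
  have h1 := hc.wI
  have h2 := query_wI 0
  have h3 := query_wI 1
  have key : ∀ i ∈ (testM ρ cmp).wI ++ (testB ρ cmp).wI, 3 ≤ i ∧ i < ρ := by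
    intro i hi
    simp only [testM_wI, testB_wI, List.mem_append, List.mem_cons] at hi
    have h1 := h1 i
    have h2 := h2 i
    have h3 := h3 i
    rcases hi with (hi | hi | hi | hi) | hi | hi | hi | hi | hi | hi | hi <;>
      first | omega | (have := h1 hi; omega) | (have := h2 hi; omega)
  intro i hi
  have key := key i
  simp only [greedyStep, bsearch, Cmd.wI, List.mem_append, List.mem_cons,
    List.not_mem_nil, or_false] at hi key
  by_cases h : i ∈ (testM ρ cmp).wI ∨ i ∈ (testB ρ cmp).wI
  · have := key h
    rcases hi with hi | hi | hi | hi | hi | hi <;> omega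
  · rw [not_or] at h
    simp only [h.1, h.2, false_or] at hi
    omega

lemma greedyStep_wIM (hc : CmpSpec off V N k H p q I 𝒯 ρ cmp tc) :
    (greedyStep ρ cmp).wIM = [] := by
  simp [greedyStep, bsearch, testM, testB, query_wIM, hc.wIM]

lemma greedyStep_wRM (hc : CmpSpec off V N k H p q I 𝒯 ρ cmp tc) :
    (greedyStep ρ cmp).wRM = [] := by
  simp [greedyStep, bsearch, testM, testB, query_wRM, hc.wRM]

lemma greedyStep_wR (ρ : ℕ) (cmp : Cmd) : ∀ i ∈ (greedyStep ρ cmp).wR, 4 ≤ i ∧ i < 10 ∨ i = 10 ∨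
    i = 12 ∨ i ∈ cmp.wR := by
  intro i hi
  have h2 := query_wR 0 i
  have h3 := query_wR 1 i
  simp only [greedyStep, bsearch, Cmd.wR, testM, testB, List.mem_append, List.mem_cons,
    List.not_mem_nil, or_false, false_or] at hi
  grind

end

end SinkRAM

/-! ### Correctness of greedy steps and of the greedy division. -/

namespace SinkRAM

variable {off V : ℕ} {v : VState} {N : PathNetwork} {k H : ℕ}
variable {p q ρ tc : ℕ} {I : ℝ → ℝ → Prop} {𝒯 : ℝ → ℝ → Set ℝ} {cmp : Cmd}

lemma Pre.setI {d x : ℕ} (h : Pre N k H v) (hd : 3 ≤ d) : Pre N k H (v.setI d x) :=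
  h.congr (fun i hi => by have : i ≠ d := by omega
                          simp [this]) rfl (fun _ _ => rfl) (fun _ _ => rfl)

lemma Fr.low {c : Cmd} {w : VState} (hf : Fr c v w) (h : ∀ i ∈ c.wI, 3 ≤ i ∧ i < ρ) {i : ℕ}
    (hi : ρ ≤ i) : w.ir i = v.ir i :=
  hf.ir i fun hc => by have := h i hc; omega

lemma testM_low (hc : CmpSpec off V N k H p q I 𝒯 ρ cmp tc) :
    ∀ i ∈ (testM ρ cmp).wI, 3 ≤ i ∧ i < ρ := by
  have hρ := hc.hρ
  intro i hi
  have h1 := hc.wI i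
  have h2 := query_wI 0 i
  simp only [testM_wI, List.mem_append, List.mem_cons] at hi
  rcases hi with hi | hi | hi | hi
  · omega
  · omega
  · have := h2 hi; omega
  · exact h1 hi

lemma testB_low (hc : CmpSpec off V N k H p q I 𝒯 ρ cmp tc) :
    ∀ i ∈ (testB ρ cmp).wI, 3 ≤ i ∧ i < ρ := by
  have hρ := hc.hρ
  intro i hi
  have h1 := hc.wI i
  have h2 := query_wI 0 i
  simp only [testB_wI, List.mem_append, List.mem_cons] at hi
  rcases hi with hi | hi | hi | hi | hi | hi | hi <;>
    first | omega | (have := h1 hi; omega) | (have := h2 hi; omega)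

lemma testM_wR (hc : CmpSpec off V N k H p q I 𝒯 ρ cmp tc) : 1 ∉ (testM ρ cmp).wR := by
  intro h
  have := query_wR 0 1
  have := hc.wR
  simp_all [testM]

lemma testB_wR (hc : CmpSpec off V N k H p q I 𝒯 ρ cmp tc) : 1 ∉ (testB ρ cmp).wR := by
  intro h
  have := query_wR 0 1
  have := query_wR 1 1
  have := hc.wR
  simp_all [testB]

lemma Pre.testM (hc : CmpSpec off V N k H p q I 𝒯 ρ cmp tc) {w : VState} (h : Pre N k H v)
    (hf : Fr (testM ρ cmp) v w) : Pre N k H w :=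
  h.of_fr hf (fun i hi => (testM_low hc i hi).1) (testM_wR hc)
    (by simp [SinkRAM.testM, query_wIM, hc.wIM]) (by simp [SinkRAM.testM, query_wRM, hc.wRM])

lemma Pre.testB (hc : CmpSpec off V N k H p q I 𝒯 ρ cmp tc) {w : VState} (h : Pre N k H v)
    (hf : Fr (testB ρ cmp) v w) : Pre N k H w :=
  h.of_fr hf (fun i hi => (testB_low hc i hi).1) (testB_wR hc)
    (by simp [SinkRAM.testB, query_wIM, hc.wIM]) (by simp [SinkRAM.testB, query_wRM, hc.wRM])

/-- `GStep` only speaks about two adjacent candidates for `m` and for `b`, so the binary searches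
need not know that the searched values are monotone. The right end `n` is a sentinel that is never
tested. A comparison may shrink the set of times, but what was learnt earlier holds for all times of
the larger set. -/
theorem wp_greedyStep (hc : CmpSpec off V N k H p q I 𝒯 ρ cmp tc) (hbig : Big N.n k H V)
    (hpre : Pre N k H v) (hI : I (v.rr p) (v.rr q)) {a : ℕ} (ha : v.ir ρ = a) (han : a < N.n) :
    Wp off V (greedyStep ρ cmp) v fun t w => t ≤ tg H tc ∧ I (w.rr p) (w.rr q) ∧
      𝒯 (w.rr p) (w.rr q) ⊆ 𝒯 (v.rr p) (v.rr q) ∧ w.ir ρ = a ∧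
      ∃ m b, w.ir (ρ + 1) = m ∧ w.ir (ρ + 4) = b ∧ a ≤ m ∧ m ≤ b ∧ b < N.n ∧
        ∀ T ∈ 𝒯 (w.rr p) (w.rr q), GStep N T a m b := by
  have hρ := hc.hρ
  have hV := hbig.le
  have hH := hbig.le_pow
  refine wp_seq.2 (wp_iset.2 ⟨trivial, wp_seq.2 (wp_iset.2 ⟨trivial, wp_seq.2 ?_⟩)⟩)
  set v1 := (v.setI (ρ + 1) _).setI (ρ + 2) _ with hv1
  have pre1 : Pre N k H v1 := (hpre.setI (by omega)).setI (by omega)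
  refine wp_bsearch (fun lo hi w => Pre N k H w ∧ w.ir ρ = a ∧ I (w.rr p) (w.rr q) ∧
    𝒯 (w.rr p) (w.rr q) ⊆ 𝒯 (v.rr p) (v.rr q) ∧ ∀ T ∈ 𝒯 (w.rr p) (w.rr q),
    Lt N 0 a lo ≤ T ∧ (hi < N.n → T < Lt N 0 a hi)) H (tq H + tc + 20) (lo := a) (hi := N.n)
    (by simp [hv1, ha]) (by simp [hv1, hpre.glob.n]) (by omega) (by omega) (by omega) (by omega)
    (by omega) (by omega) ?_ ?_ ?_ ?_
  · refine ⟨pre1, by simp [hv1, ha], hI, subset_rfl, fun T hT => ⟨?_, fun h => by omega⟩⟩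
    exact (Lt_le_iff N).2 ⟨hc.nonneg _ _ hI T hT, fun p r h1 h2 h3 => by omega⟩
  · rintro lo hi w d x hd ⟨h1, h2, h3⟩
    refine ⟨h1.setI (by omega), ?_, h3⟩
    have : ρ ≠ d := by omega
    simp [this, h2]
  · rintro lo hi w hlo hlh hhi ⟨h1, h2, h3, h4, h5⟩ hL hR hM hf
    refine ((wp_testM hc hbig h1 h3 h2 hM (by omega) (by omega)).frame).mono ?_
    rintro t w' ⟨⟨ht, h6, h7, h8, h9⟩, hf'⟩
    have hl := fun i hi => hf'.low (testM_low hc) (i := i) hi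
    have pre2 := h1.testM hc hf'
    have ea : w'.ir ρ = a := by rw [hl _ le_rfl, h2]
    refine ⟨ht, by rw [hl _ (by omega), hL], by rw [hl _ (by omega), hR],
      by rw [hl _ (by omega), hM], fun hF => ⟨pre2, ea, h6, h7.trans h4, fun T hT =>
      ⟨h8 hF T hT, (h5 T (h7 hT)).2⟩⟩, fun hF => ⟨pre2, ea, h6, h7.trans h4, fun T hT =>
      ⟨(h5 T (h7 hT)).1, fun _ => h9 hF T hT⟩⟩⟩
  rintro t2 v2 m m' hf2 hm hm' ham hmn hmm hlt - ⟨pre2, ea2, I2, sub2, h2⟩ ht2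
  obtain rfl : m' = m + 1 := by have := hlt han; omega
  refine wp_seq.2 (wp_iset.2 ⟨trivial, wp_seq.2 (wp_iset.2 ⟨trivial, ?_⟩)⟩)
  set v3 := (v2.setI (ρ + 4) _).setI (ρ + 5) _ with hv3
  have pre3 : Pre N k H v3 := (pre2.setI (by omega)).setI (by omega)
  refine wp_bsearch (fun lo hi w => Pre N k H w ∧ w.ir ρ = a ∧ w.ir (ρ + 1) = m ∧
    I (w.rr p) (w.rr q) ∧ 𝒯 (w.rr p) (w.rr q) ⊆ 𝒯 (v2.rr p) (v2.rr q) ∧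
    ∀ T ∈ 𝒯 (w.rr p) (w.rr q),
    (m < lo → Vt N a m lo ≤ T) ∧ (hi < N.n → T < Vt N a m hi)) H (2 * tq H + tc + 100) (lo := m)
    (hi := N.n) (by simp [hv3, hm]) (by simp [hv3, pre2.glob.n]) (by omega) (by omega) (by omega)
    (by omega) (by omega) (by omega) ?_ ?_ ?_ ?_
  · exact ⟨pre3, by simp [hv3, ea2], by simp [hv3, hm], I2, subset_rfl, fun T hT =>
      ⟨fun h => by omega, fun h => by omega⟩⟩
  · rintro lo hi w d x hd ⟨h1, h2, h3, h4⟩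
    refine ⟨h1.setI (by omega), ?_, ?_, h4⟩
    · have : ρ ≠ d := by omega
      simp [this, h2]
    · have : ρ + 1 ≠ d := by omega
      simp [this, h3]
  · rintro lo hi w hlo hlh hhi ⟨h1, h2, h2', h3, h4, h5⟩ hL hR hM hf
    refine ((wp_testB hc hbig h1 h3 h2 h2' hM ham (by omega) (by omega)).frame).mono ?_
    rintro t w' ⟨⟨ht, h6, h7, h8, h9⟩, hf'⟩
    have hl := fun i hi => hf'.low (testB_low hc) (i := i) hi
    have pre2 := h1.testB hc hf'
    have ea : w'.ir ρ = a := by rw [hl _ le_rfl, h2]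
    have em : w'.ir (ρ + 1) = m := by rw [hl _ (by omega), h2']
    refine ⟨ht, by rw [hl _ (by omega), hL], by rw [hl _ (by omega), hR],
      by rw [hl _ (by omega), hM], fun hF => ⟨pre2, ea, em, h6, h7.trans h4, fun T hT =>
      ⟨fun _ => h8 hF T hT, (h5 T (h7 hT)).2⟩⟩, fun hF => ⟨pre2, ea, em, h6, h7.trans h4,
      fun T hT => ⟨(h5 T (h7 hT)).1, fun _ => h9 hF T hT⟩⟩⟩
  rintro t4 v4 b b' hf4 hb hb' hmb hbn hbb hlt4 - ⟨pre4, ea4, em4, I4, sub4, h4⟩ ht4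
  obtain rfl : b' = b + 1 := by have := hlt4 (by omega); omega
  refine ⟨?_, I4, sub4.trans sub2, ea4, m, b, em4, hb, ham, hmb, by omega, fun T hT => ?_⟩
  · simp only [IExp.len, tg]
    have e1 : tq H + tc + 20 + 26 ≤ 2 * tq H + tc + 126 := by omega
    have e2 := Nat.mul_le_mul_left H e1
    have e3 : 2 * tq H + tc + 100 + 26 = 2 * tq H + tc + 126 := by omega
    rw [e3] at ht4
    omega
  · obtain ⟨f1, f2⟩ := h4 T hT
    obtain ⟨f3, f4⟩ := h2 T (sub4 hT)
    exact ⟨ham, hmb, by omega, f3, f4, f1, f2⟩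

/-! ### Greedy partition -/

/-- Perform a greedy step for each sink, followed by `x`, or `y` if there are no vertices left. -/
def greedyLoop (ρ : ℕ) (cmp x y : Cmd) : Cmd :=
  .seq (.iset ρ (.c 0)) (.seq (.iset (ρ + 7) (.c 0))
  (.whl (.ile (.add (.r (ρ + 7)) (.c 1)) (.r 1))
    (.seq (.ite (.ile (.add (.r ρ) (.c 1)) (.r 0))
      (.seq (greedyStep ρ cmp) (.seq x (.iset ρ (.add (.r (ρ + 4)) (.c 1))))) y)
      (.iset (ρ + 7) (.add (.r (ρ + 7)) (.c 1))))))

/-- The command `x` may follow a greedy step. -/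
structure After (ρ p q : ℕ) (x : Cmd) : Prop where
  wI : ∀ i ∈ x.wI, 3 ≤ i ∧ i < ρ
  wR : ∀ i ∈ x.wR, i ≠ 1 ∧ i ≠ p ∧ i ≠ q
  wIM : ∀ j ∈ x.wIM, j = 0
  wRM : ∀ j ∈ x.wRM, j = 0

lemma After.skip : After ρ p q .skip := ⟨by simp, by simp, by simp, by simp⟩

lemma After.pre {x : Cmd} {w : VState} (hx : After ρ p q x) (h : Pre N k H v) (hf : Fr x v w) :
    Pre N k H w :=
  h.of_fr hf (fun i hi => (hx.wI i hi).1) (fun h => (hx.wR 1 h).1 rfl) hx.wIM hx.wRM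

lemma greedyStep_one (hc : CmpSpec off V N k H p q I 𝒯 ρ cmp tc) : 1 ∉ (greedyStep ρ cmp).wR := by
  intro h
  have := greedyStep_wR ρ cmp 1 h
  have := hc.wR
  simp_all

/-- `K` describes only the output arrays. With trivial `x`, `y` and `K` this serves the feasibility
test and the parametric search, and with `K` a `Chain` it serves the output of the sinks. -/
theorem wp_greedyLoop (hc : CmpSpec off V N k H p q I 𝒯 ρ cmp tc) (hbig : Big N.n k H V)
    (hpre : Pre N k H v) (hI : I (v.rr p) (v.rr q)) {x y : Cmd} (hx : After ρ p q x)
    (hy : After ρ p q y) (tx : ℕ) (K : ℕ → ℕ → (ℕ → ℕ) → (ℕ → ℝ) → Prop)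
    (hK : K 0 0 (v.im 0) (v.rm 0))
    (stepx : ∀ j w a m b, Pre N k H w → I (w.rr p) (w.rr q) → j < k → w.ir (ρ + 7) = j →
      w.ir ρ = a → w.ir (ρ + 1) = m → w.ir (ρ + 4) = b → a ≤ m → m ≤ b → b < N.n →
      (∀ T ∈ 𝒯 (w.rr p) (w.rr q), GStep N T a m b) → K j a (w.im 0) (w.rm 0) →
      Wp off V x w fun t w' => t ≤ tx ∧ K (j + 1) (b + 1) (w'.im 0) (w'.rm 0))
    (stepy : ∀ j w a, Pre N k H w → I (w.rr p) (w.rr q) → j < k → w.ir (ρ + 7) = j →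
      N.n ≤ a → K j a (w.im 0) (w.rm 0) →
      Wp off V y w fun t w' => t ≤ tx ∧ K (j + 1) a (w'.im 0) (w'.rm 0)) :
    Wp off V (greedyLoop ρ cmp x y) v fun t w => t ≤ k * (tg H tc + tx + 40) + 20 ∧
      Pre N k H w ∧ I (w.rr p) (w.rr q) ∧ 𝒯 (w.rr p) (w.rr q) ⊆ 𝒯 (v.rr p) (v.rr q) ∧
      ∃ a, w.ir ρ = a ∧ (∀ T ∈ 𝒯 (w.rr p) (w.rr q), Reach N T k a) ∧
        K k a (w.im 0) (w.rm 0) := by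
  have hρ := hc.hρ
  have hV := hbig.le
  refine wp_seq.2 (wp_iset.2 ⟨Nat.zero_le _, wp_seq.2 (wp_iset.2 ⟨Nat.zero_le _, ?_⟩)⟩)
  set v1 := (v.setI ρ _).setI (ρ + 7) _ with hv1
  have pre1 : Pre N k H v1 := (hpre.setI (by omega)).setI (by omega)
  refine wp_whl (fun i w => ∃ j a, i + j = k ∧ w.ir (ρ + 7) = j ∧ w.ir ρ = a ∧ a ≤ N.n ∧
    Pre N k H w ∧ I (w.rr p) (w.rr q) ∧ 𝒯 (w.rr p) (w.rr q) ⊆ 𝒯 (v.rr p) (v.rr q) ∧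
    (∀ T ∈ 𝒯 (w.rr p) (w.rr q), Reach N T j a) ∧ K j a (w.im 0) (w.rm 0)) k
    (tg H tc + tx + 30) ?_ ?_ ?_ ?_
  · exact ⟨0, 0, rfl, by simp [hv1], by simp [hv1], Nat.zero_le _, pre1, hI, subset_rfl,
      fun T _ => .zero, hK⟩
  · rintro i w - ⟨j, a, h1, h2, h3, h4, h5, -⟩
    simp [h2]; omega
  · rintro i w - ⟨j, a, h1, h2, h3, h4, h5, h6, h7, h8, h9⟩ hb
    have gn := h5.glob.n
    have gk := h5.glob.k
    simp only [Cond.Holds, IExp.eval, h2, gk] at hb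
    refine wp_seq.2 (wp_ite.2 ⟨?_, fun hl => wp_seq.2 ?_, fun hl => ?_⟩)
    · simp [h3]; omega
    · simp only [Cond.Holds, IExp.eval, h3, gn] at hl
      refine (wp_greedyStep hc hbig h5 h6 h3 (by omega)).frame.mono ?_
      rintro t2 v2 ⟨⟨ht2, I2, s2, a2, m, b, em, eb, ham, hmb, hbn, hg⟩, hf2⟩
      have pre2 : Pre N k H v2 := h5.of_fr hf2 (fun i hi => (greedyStep_wI hc i hi).1)
        (greedyStep_one hc) (by simp [greedyStep_wIM hc]) (by simp [greedyStep_wRM hc])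
      have e7 : v2.ir (ρ + 7) = j := by
        rw [hf2.ir _ fun h => by have := greedyStep_wI hc _ h; omega, h2]
      refine wp_seq.2 ((stepx j v2 a m b pre2 I2 (by omega) e7 a2 em eb ham hmb hbn hg (by
        rw [hf2.im _ (by simp [greedyStep_wIM hc]), hf2.rm _ (by simp [greedyStep_wRM hc])]
        exact h9)).frame.mono ?_)
      rintro t3 v3 ⟨⟨ht3, K3⟩, hf3⟩
      have pre3 := hx.pre pre2 hf3
      have e7' : v3.ir (ρ + 7) = j := by rw [hf3.low hx.wI (by omega), e7]
      have eb' : v3.ir (ρ + 4) = b := by rw [hf3.low hx.wI (by omega), eb]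
      have ep : v3.rr p = v2.rr p := hf3.rr _ fun h => (hx.wR _ h).2.1 rfl
      have eq : v3.rr q = v2.rr q := hf3.rr _ fun h => (hx.wR _ h).2.2 rfl
      refine wp_iset.2 ⟨?_, wp_iset.2 ⟨?_, ?_, i - 1, by omega, j + 1, b + 1, by omega, ?_, ?_, ?_, ?_,
        ?_, ?_, ?_, ?_⟩⟩
      · simp [eb']; omega
      · simp [e7']; omega
      · simp; omega
      · simp [e7']
      · simp [eb']
      · omega
      · exact (pre3.setI (by omega)).setI (by omega)
      · simpa [ep, eq] using I2
      · simpa [ep, eq] using s2.trans h7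
      · intro T hT
        have hT' : T ∈ 𝒯 (v2.rr p) (v2.rr q) := by simpa [ep, eq] using hT
        exact .step (h8 T (s2 hT')) (hg T hT')
      · exact K3
    · simp only [Cond.Holds, IExp.eval, h3, gn] at hl
      refine (stepy j w a h5 h6 (by omega) h2 (by omega) h9).frame.mono ?_
      rintro t3 v3 ⟨⟨ht3, K3⟩, hf3⟩
      have pre3 := hy.pre h5 hf3
      have e7' : v3.ir (ρ + 7) = j := by rw [hf3.low hy.wI (by omega), h2]
      have ea' : v3.ir ρ = a := by rw [hf3.low hy.wI (by omega), h3]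
      have ep : v3.rr p = w.rr p := hf3.rr _ fun h => (hy.wR _ h).2.1 rfl
      have eq : v3.rr q = w.rr q := hf3.rr _ fun h => (hy.wR _ h).2.2 rfl
      refine wp_iset.2 ⟨?_, ?_, i - 1, by omega, j + 1, a, by omega, ?_, ?_, ?_, ?_,
        ?_, ?_, ?_, ?_⟩
      · simp [e7']; omega
      · simp; omega
      · simp [e7']
      · simp [ea']
      · omega
      · exact pre3.setI (by omega)
      · simpa [ep, eq] using h6
      · simpa [ep, eq] using h7
      · intro T hT
        have hT' : T ∈ 𝒯 (w.rr p) (w.rr q) := by simpa [ep, eq] using hT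
        exact .stay (h8 T hT') (by omega)
      · exact K3
  · rintro t i w - ⟨j, a, h1, h2, h3, h4, h5, h6, h7, h8, h9⟩ hb ht
    have gk := h5.glob.k
    simp only [Cond.Holds, IExp.eval, h2, gk] at hb
    obtain rfl : j = k := by omega
    refine ⟨?_, h5, h6, h7, a, h3, h8, h9⟩
    simp only [Cond.len, IExp.len] at ht ⊢
    have e : tg H tc + tx + 30 + (2 + (1 + 1) + (2 + 1)) + 1 ≤ tg H tc + tx + 40 := by omega
    have := Nat.mul_le_mul_left j e
    omega

end SinkRAM

/-! ### Feasibility test, parametric search and output of the sinks. -/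

namespace SinkRAM

variable {off V : ℕ} {v : VState} {N : PathNetwork} {k H : ℕ}

/-! ### Test whether a time suffices -/

def cmpT : Cmd := .ite (.rle (.r 10) (.r 11)) (.iset 15 (.c 1)) (.iset 15 (.c 0))

lemma cmpT_spec {T : ℝ} (hV : 1 ≤ V) (hT : 0 ≤ T) : CmpSpec off V N k H 11 11 (fun x _ => x = T)
    (fun _ _ => {T}) 20 cmpT 12 where
  nonneg x y _ T' hT' := by rw [Set.mem_singleton_iff.1 hT']; exact hT
  wp v _ hv _ := by
    refine wp_ite.2 ⟨⟨trivial, trivial⟩, fun h => wp_iset.2 ⟨hV, ?_⟩,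
      fun h => wp_iset.2 ⟨Nat.zero_le _, ?_⟩⟩
    · simp only [Cond.Holds, RExp.eval, hv] at h
      simp [hv, h]
    · simp only [Cond.Holds, RExp.eval, hv, not_le] at h
      simp [hv, h]
  wI := by simp [cmpT]
  wR := by simp [cmpT]
  wIM := by simp [cmpT]
  wRM := by simp [cmpT]
  hp := by simp
  hq := by simp
  hρ := by simp

/-- Leave `0` in the register `15` if the time in the real register `11` suffices, otherwise
`1`. -/
def feas : Cmd :=
  .seq (greedyLoop 20 cmpT .skip .skip)
    (.ite (.ile (.r 0) (.r 20)) (.iset 15 (.c 0)) (.iset 15 (.c 1)))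

def tf (k H : ℕ) : ℕ := k * (tg H 12 + 40) + 40

lemma feas_wI : ∀ i ∈ feas.wI, 3 ≤ i ∧ i < 28 := by
  intro i hi
  -- Which registers are written is a matter of syntax. A network with one vertex is supplied only
  -- because the general statement asks for a `CmpSpec`.
  have := greedyStep_wI (cmpT_spec (off := 0) (V := 1)
    (N := ⟨1, le_rfl, 1, by simp, 0, by simp, 1, by simp, 1, by simp⟩) (k := 0) (H := 0)
    le_rfl (le_refl 0)) i
  simp only [feas, greedyLoop, Cmd.wI, List.mem_append, List.mem_cons, List.not_mem_nil,
    or_false, false_or] at hi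
  rcases hi with (hi | hi | (hi | hi) | hi) | hi <;> first | omega | (have := this hi; omega)

lemma feas_wR : ∀ i ∈ feas.wR, 4 ≤ i ∧ i < 10 ∨ i = 10 ∨ i = 12 := by
  intro i hi
  have := greedyStep_wR 20 cmpT i
  simp only [feas, greedyLoop, Cmd.wR, List.mem_append, List.not_mem_nil,
    or_false, false_or] at hi
  have := this hi
  simpa [cmpT] using this

lemma greedyStep_cmpT_wIM (ρ : ℕ) : (greedyStep ρ cmpT).wIM = [] := by
  simp [greedyStep, bsearch, testM, testB, query_wIM, cmpT]

lemma greedyStep_cmpT_wRM (ρ : ℕ) : (greedyStep ρ cmpT).wRM = [] := by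
  simp [greedyStep, bsearch, testM, testB, query_wRM, cmpT]

lemma feas_wIM : feas.wIM = [] := by simp [feas, greedyLoop, greedyStep_cmpT_wIM]

lemma feas_wRM : feas.wRM = [] := by simp [feas, greedyLoop, greedyStep_cmpT_wRM]

theorem wp_feas (hbig : Big N.n k H V) (hpre : Pre N k H v) (hT : 0 ≤ v.rr 11) :
    Wp off V feas v fun t w => t ≤ tf k H ∧ Pre N k H w ∧
      ((w.ir 15 = 0 ∧ Feas N k (v.rr 11)) ∨ (w.ir 15 = 1 ∧ ¬ Feas N k (v.rr 11))) := by
  refine wp_seq.2 ((wp_greedyLoop (cmpT_spec (by have := hbig.le; omega) hT) hbig hpre rfl .skip .skip 0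
    (fun _ _ _ _ => True) trivial (fun _ _ _ _ _ _ _ _ _ _ _ _ _ _ _ _ _ => by simp)
    (fun _ _ _ _ _ _ _ _ _ => by simp)).mono ?_)
  rintro t w ⟨ht, pre, -, -, a, ha, hr, -⟩
  have hr := hr _ rfl
  have hn := pre.glob.n
  have hV := hbig.le
  refine wp_ite.2 ⟨⟨trivial, trivial⟩, fun h => wp_iset.2 ⟨Nat.zero_le _, ?_, pre.setI (by omega),
    Or.inl ⟨by simp, ?_⟩⟩, fun h => wp_iset.2 ⟨by simp; omega, ?_, pre.setI (by omega),
    Or.inr ⟨by simp, ?_⟩⟩⟩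
  · simp only [Cond.len, IExp.len, tf]; rw [add_zero] at ht; omega
  · simp only [Cond.Holds, IExp.eval, hn, ha] at h
    exact hr.feas hT h
  · simp only [Cond.len, IExp.len, tf]; rw [add_zero] at ht; omega
  · simp only [Cond.Holds, IExp.eval, hn, ha] at h
    exact hr.not_feas (by omega)

/-! ### Parametric search -/

/-- Compare the value in the real register `10` with the optimal time, which is at most real
register `2` and at least real register `3`. -/
def cmpP : Cmd :=
  .seq (.rset 11 (.r 10)) (.seq feas (.ite (.ile (.c 1) (.r 15))
    (.ite (.rle (.r 3) (.r 11)) (.rset 3 (.r 11)) .skip)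
    (.ite (.rle (.r 11) (.r 2)) (.rset 2 (.r 11)) .skip)))

lemma wp_cmpP (hbig : Big N.n k H V) (hpre : Pre N k H v) (hT : 0 ≤ v.rr 10) :
    Wp off V cmpP v fun t w => t ≤ tf k H + 20 ∧ Pre N k H w ∧
      ((w.ir 15 = 0 ∧ Feas N k (v.rr 10) ∧ w.rr 2 = min (v.rr 2) (v.rr 10) ∧ w.rr 3 = v.rr 3) ∨
      (w.ir 15 = 1 ∧ ¬ Feas N k (v.rr 10) ∧ w.rr 2 = v.rr 2 ∧
        w.rr 3 = max (v.rr 3) (v.rr 10))) := by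
  refine wp_seq.2 (wp_rset.2 ⟨trivial, wp_seq.2 ?_⟩)
  have pre1 : Pre N k H (v.setR 11 (v.rr 10)) :=
    hpre.congr (fun _ _ => rfl) (by simp) (fun _ _ => rfl) (fun _ _ => rfl)
  refine (wp_feas hbig pre1 (by simpa using hT)).frame.mono ?_
  rintro t w ⟨⟨ht, pre, h⟩, hf⟩
  have e2 : w.rr 2 = v.rr 2 := by
    rw [hf.rr 2 fun h => by have := feas_wR _ h; omega]; simp
  have e3 : w.rr 3 = v.rr 3 := by
    rw [hf.rr 3 fun h => by have := feas_wR _ h; omega]; simp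
  have e11 : w.rr 11 = v.rr 10 := by
    rw [hf.rr 11 fun h => by have := feas_wR _ h; omega]; simp
  have hV := hbig.le
  simp only [VState.setR_rr, if_true] at h
  have hset : ∀ i, i ≠ 1 → Pre N k H (w.setR i (w.rr 11)) := fun i hi =>
    pre.congr (fun _ _ => rfl) (by simp [hi.symm]) (fun _ _ => rfl) (fun _ _ => rfl)
  refine wp_ite.2 ⟨by simp; omega, fun hc => wp_ite.2 ⟨⟨trivial, trivial⟩, fun hl =>
    wp_rset.2 ⟨trivial, ?_, hset _ (by simp), ?_⟩, fun hl => wp_skip.2 ⟨?_, pre, ?_⟩⟩,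
    fun hc => wp_ite.2 ⟨⟨trivial, trivial⟩, fun hl =>
    wp_rset.2 ⟨trivial, ?_, hset _ (by simp), ?_⟩, fun hl => wp_skip.2 ⟨?_, pre, ?_⟩⟩⟩
  · simp; omega
  · simp only [Cond.Holds, IExp.eval, RExp.eval, e3, e11] at hc hl
    rcases h with h | h
    · omega
    · exact Or.inr ⟨h.1, h.2, by simp [e2], by simp [e11, hl]⟩
  · simp; omega
  · simp only [Cond.Holds, IExp.eval, RExp.eval, e3, e11, not_le] at hc hl
    rcases h with h | h
    · omega
    · exact Or.inr ⟨h.1, h.2, by simp [e2], by simp [e3, hl.le]⟩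
  · simp; omega
  · simp only [Cond.Holds, IExp.eval, RExp.eval, e2, e11] at hc hl
    rcases h with h | h
    · exact Or.inl ⟨h.1, h.2, by simp [e11, hl], by simp [e3]⟩
    · omega
  · simp; omega
  · simp only [Cond.Holds, IExp.eval, RExp.eval, e2, e11, not_le] at hc hl
    rcases h with h | h
    · exact Or.inl ⟨h.1, h.2, by simp [e2, hl.le], by simp [e3]⟩
    · omega

/-- The times under consideration are those with `y ≤ T < x`, where `x` is feasible and `y` is not.
A feasible value lowers `x` and then exceeds all remaining times. An infeasible value raises `y` and
then is at most all of them. One feasibility test thus decides the comparison for the whole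
interval. The alternative `x ≤ 0` covers the optimum `0`, when no infeasible `y ≥ 0` exists. The
inner test uses integer registers below 28, so the search keeps its own ones from 40 on. -/
lemma cmpP_spec (hbig : Big N.n k H V) : CmpSpec off V N k H 2 3
    (fun x y => Feas N k x ∧ 0 ≤ y ∧ (¬ Feas N k y ∨ x ≤ 0)) (fun x y => {T | y ≤ T ∧ T < x})
    40 cmpP (tf k H + 20) where
  nonneg x y h T hT := h.2.1.trans hT.1
  wp v hpre hv h10 := by
    refine (wp_cmpP hbig hpre h10).mono ?_
    rintro t w ⟨ht, -, ⟨h1, h2, h3, h4⟩ | ⟨h1, h2, h3, h4⟩⟩ <;> rw [h3, h4] <;>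
      obtain ⟨h5, h6, h7⟩ := hv
    · refine ⟨ht, ⟨?_, h6, h7.imp_right fun h => (min_le_left _ _).trans h⟩,
        fun T hT => ⟨hT.1, hT.2.trans_le (min_le_left _ _)⟩, fun h => by omega,
        fun _ T hT => hT.2.trans_le (min_le_right _ _)⟩
      rcases min_choice (v.rr 2) (v.rr 10) with h | h <;> rw [h] <;> assumption
    · refine ⟨ht, ⟨h5, h6.trans (le_max_left _ _), ?_⟩,
        fun T hT => ⟨(le_max_left _ _).trans hT.1, hT.2⟩,
        fun _ T hT => (le_max_right _ _).trans hT.1, fun h => by omega⟩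
      rcases max_choice (v.rr 3) (v.rr 10) with h | h <;> rw [h]
      · exact h7
      · exact Or.inl h2
  wI i hi := by
    have := feas_wI i
    simp only [cmpP, Cmd.wI, List.mem_append, List.not_mem_nil, or_false, false_or] at hi
    have := this hi
    omega
  wR h := by
    have := feas_wR 1
    simp only [cmpP, Cmd.wR, List.mem_append, List.mem_cons, List.not_mem_nil, or_false] at h
    rcases h with h | h | h | h
    · omega
    · have := this h; omega
    · omega
    · omega
  wIM := by simp [cmpP, feas_wIM]
  wRM := by simp [cmpP, feas_wRM]
  hp := by simp
  hq := by simp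
  hρ := by simp

/-- Compute the optimal time in the real register `2`. -/
def optTime : Cmd :=
  .seq (.iset 4 (.c 0)) (.seq (.iset 5 (.sub (.r 0) (.c 1))) (.seq (query 0)
  (.seq (.rset 2 (.r 4)) (.seq (.rset 3 (.c 0)) (.seq (.rset 10 (.c 0)) (.seq cmpP
  (greedyLoop 40 cmpP .skip .skip)))))))

def tp (k H : ℕ) : ℕ := tq H + tf k H + k * (tg H (tf k H + 20) + 40) + 80

/-- In the end the greedy algorithm makes the same choices for all `T` with `y ≤ T < x`. If they
miss a vertex, all these times are infeasible. If they cover the path and the interval is nonempty,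
then `y` would be feasible, contrary to the invariant. Times below `y` are infeasible by
monotonicity, so `x` is optimal. -/
theorem wp_optTime (hk : 1 ≤ k) (hbig : Big N.n k H V) (hpre : Pre N k H v) :
    Wp off V optTime v fun t w => t ≤ tp k H ∧ Pre N k H w ∧ Feas N k (w.rr 2) ∧
      ∀ T < w.rr 2, 0 ≤ T → ¬ Feas N k T := by
  have hV := hbig.le
  have hn := hpre.glob.n
  have hn1 := N.n_pos
  refine wp_seq.2 (wp_iset.2 ⟨Nat.zero_le _, wp_seq.2 (wp_iset.2 ⟨?_, wp_seq.2 ?_⟩)⟩)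
  · simp; omega
  set v1 := (v.setI 4 _).setI 5 _ with hv1
  have pre1 : Pre N k H v1 := (hpre.setI (by omega)).setI (by omega)
  refine (wp_query (d := 0) (a := 0) (m := N.n - 1) (by omega) pre1 hbig (by simp [hv1])
    (by simp [hv1, hn]) (by omega) (by omega)).mono ?_
  rintro t2 v2 ⟨ht2, h4, hf2⟩
  have pre2 := pre1.query hf2
  refine wp_seq.2 (wp_rset.2 ⟨trivial, wp_seq.2 (wp_rset.2 ⟨trivial, wp_seq.2 (wp_rset.2 ⟨trivial,
    wp_seq.2 ?_⟩)⟩)⟩)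
  set v3 := ((v2.setR 2 _).setR 3 _).setR 10 _ with hv3
  have pre3 : Pre N k H v3 :=
    pre2.congr (fun _ _ => rfl) (by simp [hv3]) (fun _ _ => rfl) (fun _ _ => rfl)
  have e2 : v3.rr 2 = Lt N 0 0 (N.n - 1) := by simp [hv3, h4]
  have e3 : v3.rr 3 = 0 := by simp [hv3]
  have e10 : v3.rr 10 = 0 := by simp [hv3]
  have hF := feas_last (N := N) hk
  -- Testing the value `0` establishes the invariant: either `0` is infeasible and serves as `y`, or
  -- `x` becomes at most `0`.
  refine (wp_cmpP hbig pre3 e10.ge).mono ?_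
  rintro t4 v4 ⟨ht4, pre4, h⟩
  have I4 : Feas N k (v4.rr 2) ∧ 0 ≤ v4.rr 3 ∧ (¬ Feas N k (v4.rr 3) ∨ v4.rr 2 ≤ 0) := by
    rw [e2, e3, e10] at h
    rcases h with ⟨-, h1, h2, h3⟩ | ⟨-, h1, h2, h3⟩ <;> rw [h2, h3]
    · refine ⟨?_, le_rfl, Or.inr (min_le_right _ _)⟩
      rcases min_choice (Lt N 0 0 (N.n - 1)) 0 with h | h <;> rw [h] <;> assumption
    · exact ⟨hF, by simp, by simp [h1]⟩
  refine (wp_greedyLoop (cmpP_spec hbig) hbig pre4 I4 .skip .skip 0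
    (fun _ _ _ _ => True) trivial (fun _ _ _ _ _ _ _ _ _ _ _ _ _ _ _ _ _ => by simp)
    (fun _ _ _ _ _ _ _ _ _ => by simp)).mono ?_
  rintro t w ⟨ht, pre, ⟨i1, i2, i3⟩, -, a, ha, hr, -⟩
  refine ⟨?_, pre, i1, fun T hT h0 hTF => ?_⟩
  · rw [add_zero] at ht
    simp only [IExp.len, RExp.len, tp]
    omega
  · rcases i3 with i3 | i3
    · have hlt : w.rr 3 ≤ T := by
        by_contra hc
        exact i3 (hTF.mono (not_le.1 hc).le)
      rcases Nat.lt_or_ge a N.n with han | han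
      · exact (hr T ⟨hlt, hT⟩).not_feas han hTF
      · exact i3 ((hr _ ⟨le_rfl, hlt.trans_lt hT⟩).feas i2 han)
    · linarith

/-! ### Output -/

/-- Store the sink of a subpath. -/
def storeX : Cmd :=
  .seq (.ist 0 (.r 27) (.r 21))
  (.seq (.iset 4 (.sub (.sub (.r 0) (.c 1)) (.r 24)))
  (.seq (.iset 5 (.sub (.sub (.r 0) (.c 1)) (.r 21))) (.seq (query 1)
  (.ite (.rle (.r 4) (.r 11)) (.rst 0 (.r 27) (.c 0))
  (.seq (.rset 12 (.sub (.ld 3 (.add (.r 21) (.c 1))) (.ld 3 (.r 21))))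
  (.seq (.iset 4 (.r 20)) (.seq (.iset 5 (.add (.r 21) (.c 1))) (.seq (query 0)
  (.rst 0 (.r 27) (.div (.add (.sub (.r 11) (.r 4)) (.r 12)) (.r 12)))))))))))

/-- Store a sink without evacuees. -/
def storeY : Cmd := .seq (.ist 0 (.r 27) (.c 0)) (.rst 0 (.r 27) (.c 0))

lemma after_storeX : After 20 11 11 storeX where
  wI i hi := by
    have := query_wI 0 i
    simp only [storeX, Cmd.wI, List.mem_append, List.mem_cons, List.not_mem_nil, or_false,
      false_or] at hi
    rcases hi with hi | hi | hi | hi | hi | hi <;> first | omega | (have := this hi; omega)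
  wR i hi := by
    have := query_wR 0 i
    simp only [storeX, Cmd.wR, List.mem_append, List.mem_cons, List.not_mem_nil, or_false,
      false_or] at hi
    rcases hi with hi | hi | hi <;> first | omega | (have := this hi; omega)
  wIM := by simp [storeX, query_wIM]
  wRM := by simp [storeX, query_wRM]

lemma after_storeY : After 20 11 11 storeY :=
  ⟨by simp [storeY], by simp [storeY], by simp [storeY], by simp [storeY]⟩

lemma wp_storeX (hbig : Big N.n k H V) (hpre : Pre N k H v) (hoff : k ≤ off) {j a m b : ℕ} {T : ℝ}
    (hT : v.rr 11 = T) (h0 : 0 ≤ T) (hj : v.ir 27 = j) (hjk : j < k) (ha : v.ir 20 = a)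
    (hm : v.ir 21 = m) (hb : v.ir 24 = b) (hg : GStep N T a m b) :
    Wp off V storeX v fun t w => t ≤ 2 * tq H + 80 ∧ (w.im 0 j = m ∧ ∀ i ≠ j, w.im 0 i = v.im 0 i) ∧
      (w.rm 0 j = (sinkAt N T a m b).frac ∧ ∀ i ≠ j, w.rm 0 i = v.rm 0 i) := by
  have hV := hbig.le
  have hn := hpre.glob.n
  obtain ⟨ham, hmb, hbn, -⟩ := hg
  refine wp_seq.2 (wp_ist.2 ⟨⟨trivial, trivial, by omega, ?_, ?_⟩, wp_seq.2 (wp_iset.2 ⟨?_, wp_seq.2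
    (wp_iset.2 ⟨?_, wp_seq.2 ?_⟩)⟩)⟩)
  · simp [hj]; omega
  · simp [hj]; omega
  · simp; omega
  · simp; omega
  set v1 := ((v.stI 0 _ _).setI 4 _).setI 5 _ with hv1
  have pre1 : Pre N k H v1 := hpre.congr (fun i hi => by
    have h1 : i ≠ 4 := by omega
    have h2 : i ≠ 5 := by omega
    simp [hv1, h1, h2]) rfl (fun j hj => by
      funext i
      have : j ≠ 0 := by omega
      simp [hv1, this]) (fun _ _ => rfl)
  refine (wp_query (d := 1) (a := N.n - 1 - b) (m := N.n - 1 - m) (by omega) pre1 hbig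
    (by simp [hv1, hn, hb]) (by simp [hv1, hn, hm]) (by omega) (by omega)).mono ?_
  rintro t2 v2 ⟨ht2, h4, hf2⟩
  have pre2 := pre1.query hf2
  have er : ∀ i, 20 ≤ i → v2.ir i = v.ir i := fun i hi => by
    rw [hf2.ir _ fun h => by have := query_wI _ _ h; omega]
    have h1 : i ≠ 4 := by omega
    have h2 : i ≠ 5 := by omega
    simp [hv1, h1, h2]
  have e11 : v2.rr 11 = T := by
    rw [hf2.rr _ fun h => by have := query_wR _ _ h; omega]
    simpa [hv1] using hT
  have eim : v2.im 0 = v1.im 0 := hf2.im 0 (by simp [query_wIM])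
  have erm : v2.rm 0 = v.rm 0 := hf2.rm 0 (by simp [query_wRM])
  have e4 : v2.rr 4 = Rt N m b := h4
  have final : v1.im 0 j = m ∧ ∀ i ≠ j, v1.im 0 i = v.im 0 i := by
    refine ⟨by simp [hv1, hj, hm], fun i hi => by simp [hv1, hj, hi]⟩
  refine wp_ite.2 ⟨⟨trivial, trivial⟩, fun hc => wp_rst.2 ⟨⟨trivial, trivial, by omega, ?_, ?_⟩, ?_,
    ?_, ?_⟩, fun hc => wp_seq.2 (wp_rset.2 ⟨?_, wp_seq.2 (wp_iset.2 ⟨trivial, wp_seq.2 (wp_iset.2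
    ⟨?_, wp_seq.2 ?_⟩)⟩)⟩)⟩
  · simp [er, hj]; omega
  · simp [er, hj]; omega
  · simp; omega
  · simpa [eim] using final
  · simp only [Cond.Holds, RExp.eval, e4, e11] at hc
    refine ⟨by simp [er, hj, sinkAt, hc], fun i hi => by simp [er, hj, hi, erm]⟩
  · simp [er, hm]; omega
  · simp [er, hm]; omega
  simp only [Cond.Holds, RExp.eval, e4, e11] at hc
  have hmlt : m < b := by
    rcases Nat.eq_or_lt_of_le hmb with rfl | h
    · exact (hc (Rt_self h0 hbn le_rfl)).elim
    · exact h
  set v3 := ((v2.setR 12 _).setI 4 _).setI 5 _ with hv3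
  have pre3 : Pre N k H v3 := pre2.congr (fun i hi => by
    have h1 : i ≠ 4 := by omega
    have h2 : i ≠ 5 := by omega
    simp [hv3, h1, h2]) (by simp [hv3]) (fun _ _ => rfl) (fun _ _ => rfl)
  refine (wp_query (d := 0) (a := a) (m := m + 1) (by omega) pre3 hbig
    (by simp [hv3, er, ha]) (by simp [hv3, er, hm]) (by omega) (by omega)).mono ?_
  rintro t4 v4 ⟨ht4, h44, hf4⟩
  have g12 : v4.rr 12 = Dl N 0 (m + 1) - Dl N 0 m := by
    rw [hf4.rr 12 fun h => by have := query_wR _ _ h; omega]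
    have gD := (pre2.tab 0 (by omega)).D
    have e1 := gD (m + 1) (by omega)
    have e2 := gD m (by omega)
    simp only [add_zero] at e1 e2
    simp [hv3, er, hm, e1, e2]
  have g11 : v4.rr 11 = T := by
    rw [hf4.rr _ fun h => by have := query_wR _ _ h; omega]
    simpa [hv3] using e11
  have g27 : v4.ir 27 = j := by
    rw [hf4.ir _ fun h => by have := query_wI _ _ h; omega]
    simp [hv3, er, hj]
  have gim : v4.im 0 = v1.im 0 := by rw [hf4.im 0 (by simp [query_wIM])]; exact eim
  have grm : v4.rm 0 = v.rm 0 := by rw [hf4.rm 0 (by simp [query_wRM])]; exact erm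
  refine wp_rst.2 ⟨⟨trivial, by simp, by omega, ?_, ?_⟩, ?_, ?_, ?_⟩
  · simp [g27]; omega
  · simp [g27]; omega
  · simp; omega
  · simpa [gim] using final
  · exact ⟨by simp [g27, g11, g12, h44, sinkAt, hc], fun i hi => by simp [g27, hi, grm]⟩

/-- The whole computation, after the preparation of the data structure. -/
def solve : Cmd :=
  .seq optTime (.seq (.rset 11 (.r 2)) (greedyLoop 20 cmpT storeX storeY))

def ts (k H : ℕ) : ℕ := tp k H + k * (tg H 12 + (2 * tq H + 80) + 40) + 40

/-- The output overwrites the input in array `0`. This is harmless, since `Pre` refers only to the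
tables in the other arrays. -/
theorem wp_solve (hk : 1 ≤ k) (hoff : k ≤ off) (hbig : Big N.n k H V) (hpre : Pre N k H v) :
    Wp off V solve v fun t w => t ≤ ts k H ∧
      N.IsOptimalSink fun j : Fin k => ⟨w.im 0 j, w.rm 0 j⟩ := by
  have hV := hbig.le
  refine wp_seq.2 ((wp_optTime hk hbig hpre).mono ?_)
  rintro t1 v1 ⟨ht1, pre1, hF, hmin⟩
  refine wp_seq.2 (wp_rset.2 ⟨trivial, ?_⟩)
  obtain ⟨T, hT⟩ : ∃ T, T = v1.rr 2 := ⟨_, rfl⟩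
  rw [← hT] at hF hmin
  have h0 : 0 ≤ T := hF.nonneg
  have pre2 : Pre N k H (v1.setR 11 (v1.rr 2)) :=
    pre1.congr (fun _ _ => rfl) (by simp) (fun _ _ => rfl) (fun _ _ => rfl)
  refine (wp_greedyLoop (cmpT_spec (by omega) h0) hbig pre2 (by simp [hT]) after_storeX after_storeY
    (2 * tq H + 80) (fun j a im rm => Chain N T (fun i => ⟨im i, rm i⟩) j a) .zero ?_ ?_).mono ?_
  · intro j w a m b pre hI hj h1 h2 h3 h4 ham hmb hbn hg hc
    have hg := hg T rfl
    refine (wp_storeX hbig pre hoff hI h0 h1 hj h2 h3 h4 hg).mono ?_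
    rintro t w' ⟨ht, ⟨i1, i2⟩, i3, i4⟩
    have hon := hg.onPath h0
    have e : (⟨w'.im 0 j, w'.rm 0 j⟩ : Location) = sinkAt N T a m b := by
      rw [i1, i3]
      simp only [sinkAt]
      split_ifs <;> rfl
    exact ⟨ht, .step (hc.congr fun i hi => by rw [i2 i (by omega), i4 i (by omega)])
      (ham.trans hmb) hbn (e ▸ hon.1) (e ▸ hon.2)⟩
  · intro j w a pre hI hj h1 ha hc
    refine wp_seq.2 (wp_ist.2 ⟨⟨trivial, Nat.zero_le _, by omega, ?_, ?_⟩, wp_rst.2 ⟨⟨trivial,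
      trivial, by omega, ?_, ?_⟩, ?_, ?_⟩⟩)
    · simp [h1]; omega
    · simp [h1]; omega
    · simp [h1]; omega
    · simp [h1]; omega
    · simp
    · refine .stay (hc.congr fun i hi => ?_) ?_ ha
      · have : i ≠ j := by omega
        simp [h1, this]
      · have := N.n_pos
        simp [h1, PathNetwork.OnPath]; omega
  · rintro t w ⟨ht, pre, -, -, a, ha, hr, hc⟩
    have hna : N.n ≤ a := by
      by_contra hlt
      exact (hr T rfl).not_feas (by omega) hF
    obtain ⟨hS, hE⟩ := hc.sinksEvacuate hna
    refine ⟨?_, isOptimalSink_of hS hE hmin⟩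
    simp only [RExp.len, ts]
    omega

end SinkRAM

namespace SinkRAM

variable {off V : ℕ} {v : VState} {N : PathNetwork} {k H : ℕ}

/-! ## Preparation -/

/-- The array `0` and the real register `0` hold the input. -/
structure Raw (N : PathNetwork) (v : VState) : Prop where
  n : v.ir 0 = N.n
  τ : v.rr 0 = N.τ
  weight : ∀ i < N.n, v.rm 0 i = N.weight i
  len : ∀ i, i + 1 < N.n → v.rm 0 (N.n + i) = N.len i
  cap : ∀ i, i + 1 < N.n → v.rm 0 (N.n + (N.n - 1 + i)) = N.cap i

lemma Raw.of_fr {c : Cmd} {w : VState} (h : Raw N v) (hf : Fr c v w) (h1 : 0 ∉ c.wI)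
    (h2 : 0 ∉ c.wR) (h3 : 0 ∉ c.wRM) : Raw N w :=
  ⟨by rw [hf.ir 0 h1, h.n], by rw [hf.rr 0 h2, h.τ], by rw [hf.rm 0 h3]; exact h.weight,
    by rw [hf.rm 0 h3]; exact h.len, by rw [hf.rm 0 h3]; exact h.cap⟩

lemma Tab.of_fr {c : Cmd} {w : VState} {d : ℕ} (h : Tab N d v) (hf : Fr c v w)
    (h1 : 1 + d ∉ c.wRM) (h2 : 3 + d ∉ c.wRM) (h3 : 5 + d ∉ c.wRM) : Tab N d w :=
  ⟨by rw [hf.rm _ h1]; exact h.S, by rw [hf.rm _ h2]; exact h.D, by rw [hf.rm _ h3]; exact h.u⟩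

lemma Low.mono {w : VState} {d : ℕ} (h : Low N d v) (hw : w.rr 1 ≤ v.rr 1) : Low N d w :=
  ⟨hw.trans h.nonpos, hw.trans h.S, fun i hi => hw.trans (h.u i hi)⟩

/-- Compute the number of levels. -/
def levels : Cmd :=
  .seq (.iset 2 (.c 0)) (.seq (.iset 3 (.c 1)) (.whl (.ile (.add (.r 3) (.c 1)) (.r 0))
    (.seq (.iset 3 (.mul (.r 3) (.c 2))) (.iset 2 (.add (.r 2) (.c 1))))))

lemma wp_levels (hn : v.ir 0 = N.n) (hV : 4 * N.n + 8 ≤ V) :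
    Wp off V levels v fun t w => t ≤ 30 * N.n + 30 ∧
      ∃ H, w.ir 2 = H ∧ N.n ≤ 2 ^ H ∧ 2 ^ H ≤ 2 * N.n := by
  have hn1 := N.n_pos
  refine wp_seq.2 (wp_iset.2 ⟨Nat.zero_le _, wp_seq.2 (wp_iset.2 ⟨by simp; omega, ?_⟩)⟩)
  -- This variant bounds the number of rounds only linearly, which is enough within the preparation.
  refine wp_whl (fun j w => j = N.n - w.ir 3 ∧ ∃ H, w.ir 2 = H ∧ w.ir 3 = 2 ^ H ∧ 2 ^ H ≤ 2 * N.n)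
    (N.n - 1) 20 ⟨by simp, 0, by simp, by simp, by simp; omega⟩ ?_ ?_ ?_
  · rintro j w hf ⟨h1, H, h2, h3, h4⟩
    simp [h3]; omega
  · rintro j w hf ⟨h1, H, h2, h3, h4⟩ hc
    have e0 : w.ir 0 = N.n := by rw [hf.ir 0 (by simp)]; simp [hn]
    simp only [Cond.Holds, IExp.eval, h3, e0] at hc
    have hH : H < 2 ^ H := Nat.lt_two_pow_self
    refine wp_seq.2 (wp_iset.2 ⟨?_, wp_iset.2 ⟨?_, ?_, _, ?_, rfl, H + 1, ?_, ?_, ?_⟩⟩)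
    · simp [h3]; omega
    · simp [h2]; omega
    · simp
    · simp [h1, h3]; omega
    · simp [h2]
    · simp [h3, pow_succ]
    · rw [pow_succ]; omega
  · rintro t j w hf ⟨h1, H, h2, h3, h4⟩ hc ht
    have e0 : w.ir 0 = N.n := by rw [hf.ir 0 (by simp)]; simp [hn]
    simp only [Cond.Holds, IExp.eval, h3, e0] at hc
    refine ⟨?_, H, h2, by omega, h4⟩
    simp only [Cond.len, IExp.len] at ht ⊢
    omega

/-- The index of a vertex or edge in the input. -/
def rawIdx (d e : ℕ) : IExp := if d = 0 then .r 3 else .sub (.sub (.r 0) (.c e)) (.r 3)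

lemma rawIdx_eval (d e : ℕ) (v : VState) : (rawIdx d e).eval v =
    if d = 0 then v.ir 3 else v.ir 0 - e - v.ir 3 := by
  unfold rawIdx; split_ifs <;> rfl

lemma rawIdx_ok (d : ℕ) {e : ℕ} (he : e ≤ V) (v : VState) : (rawIdx d e).Ok off V v := by
  unfold rawIdx; split_ifs
  · trivial
  · exact ⟨⟨trivial, he⟩, trivial⟩

lemma rawIdx_len (d e : ℕ) : (rawIdx d e).len ≤ 10 := by
  unfold rawIdx; split_ifs <;> simp only [IExp.len] <;> omega

/-- Compute prefix sums of weights. -/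
def fillS (d : ℕ) : Cmd :=
  .seq (.iset 3 (.c 0)) (.seq (.rst (1 + d) (.c 0) (.c 0))
  (.whl (.ile (.add (.r 3) (.c 1)) (.r 0))
    (.seq (.rst (1 + d) (.add (.r 3) (.c 1)) (.add (.ld (1 + d) (.r 3)) (.ld 0 (rawIdx d 1))))
      (.iset 3 (.add (.r 3) (.c 1))))))

lemma wp_fillS {d : ℕ} (hd : d < 2) (hr : Raw N v) (hV : 4 * N.n + 8 ≤ V) (hoff : 3 * N.n ≤ off) :
    Wp off V (fillS d) v fun t w => t ≤ 60 * N.n + 30 ∧ ∀ i ≤ N.n, w.rm (1 + d) i = Sw N d i := by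
  have hn1 := N.n_pos
  have d1 : 1 + d < 32 := by omega
  refine wp_seq.2 (wp_iset.2 ⟨Nat.zero_le _, wp_seq.2 (wp_rst.2 ⟨⟨Nat.zero_le _, trivial, d1,
    Nat.zero_le _, by simp⟩, ?_⟩)⟩)
  have n0 : ¬ (0 = 1 + d) := by omega
  set v1 := (v.setI 3 _).stR (1 + d) _ _ with hv1
  have hr1 : Raw N v1 := ⟨by simp [hv1, hr.n], by simp [hv1, hr.τ], by simpa [hv1, n0] using hr.weight,
    by simpa [hv1, n0] using hr.len, by simpa [hv1, n0] using hr.cap⟩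
  refine wp_whl (fun j w => ∃ i, i + j = N.n ∧ w.ir 3 = i ∧ ∀ i' ≤ i, w.rm (1 + d) i' = Sw N d i')
    N.n 50 ⟨0, by simp, by simp [hv1], fun i' hi' => ?_⟩ ?_ ?_ ?_
  · obtain rfl : i' = 0 := by omega
    simp [hv1, Sw]
  · rintro j w hf ⟨i, h1, h2, h3⟩
    simp [h2]; omega
  · rintro j w hf ⟨i, h1, h2, h3⟩ hc
    have hr' : Raw N w := hr1.of_fr hf (by simp) (by simp) (by simp; omega)
    simp only [Cond.Holds, IExp.eval, h2, hr'.n] at hc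
    have hidx : (rawIdx d 1).eval w < N.n := by
      rw [rawIdx_eval, h2, hr'.n]; split_ifs <;> omega
    have hw : w.rm 0 ((rawIdx d 1).eval w) = wt N d i := by
      rw [hr'.weight _ hidx, rawIdx_eval, h2, hr'.n, wt]
      split_ifs <;> rfl
    have hl := rawIdx_len d 1
    refine wp_seq.2 (wp_rst.2 ⟨⟨?_, ⟨⟨trivial, d1, ?_, by simp⟩, rawIdx_ok _ (by omega) _, by simp,
      by omega, fun _ => by omega⟩, d1, ?_, by simp⟩, wp_iset.2 ⟨?_, ?_, j - 1, by omega, i + 1,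
      by omega, ?_, fun i' hi' => ?_⟩⟩)
    · simp [h2]; omega
    · simp [h2]; omega
    · simp [h2]; omega
    · simp [h2]; omega
    · simp; omega
    · simp [h2]
    · have e1 := h3 i le_rfl
      rcases Nat.lt_or_eq_of_le hi' with h | rfl
      · have : i' ≠ i + 1 := by omega
        simp [h2, this, h3 i' (by omega)]
      · simp [h2, e1, hw, Sw, Finset.sum_range_succ]
  · rintro t j w hf ⟨i, h1, h2, h3⟩ hc ht
    have hr' : Raw N w := hr1.of_fr hf (by simp) (by simp) (by simp; omega)
    simp only [Cond.Holds, IExp.eval, h2, hr'.n] at hc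
    obtain rfl : i = N.n := by omega
    refine ⟨?_, h3⟩
    simp only [Cond.len, IExp.len] at ht ⊢
    simp
    omega

/-- Compute prefix sums of transit times, and inverse capacities. -/
def fillE (d : ℕ) : Cmd :=
  .seq (.iset 3 (.c 0)) (.seq (.rst (3 + d) (.c 0) (.c 0))
  (.whl (.ile (.add (.r 3) (.c 2)) (.r 0))
    (.seq (.rset 2 (.div (.c 1) (.ld 0 (.add (.r 0) (.add (.sub (.r 0) (.c 1)) (rawIdx d 2))))))
    (.seq (.rset 3 (.mul (.r 0) (.ld 0 (.add (.r 0) (rawIdx d 2)))))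
    (.seq (.rst (3 + d) (.add (.r 3) (.c 1)) (.add (.ld (3 + d) (.r 3)) (.r 3)))
    (.seq (.rst (5 + d) (.r 3) (.r 2))
    (.seq (.rset 1 (.sub (.r 1) (.r 2)))
      (.iset 3 (.add (.r 3) (.c 1))))))))))

/-- Register `1` is lowered by every inverse capacity in turn. As these are positive, it ends below
the negative of each of them, which `Low` demands, without any comparison. -/
lemma wp_fillE {d : ℕ} (hd : d < 2) (hr : Raw N v) (hx : v.rr 1 ≤ 0) (hV : 4 * N.n + 8 ≤ V)
    (hoff : 3 * N.n ≤ off) : Wp off V (fillE d) v fun t w => t ≤ 120 * N.n + 30 ∧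
      (∀ i < N.n, w.rm (3 + d) i = Dl N d i) ∧ (∀ i, i + 1 < N.n → w.rm (5 + d) i = uc N d i) ∧
      w.rr 1 ≤ v.rr 1 ∧ ∀ i, i + 1 < N.n → w.rr 1 ≤ - uc N d i := by
  have hn1 := N.n_pos
  have d3 : 3 + d < 32 := by omega
  have d5 : 5 + d < 32 := by omega
  refine wp_seq.2 (wp_iset.2 ⟨Nat.zero_le _, wp_seq.2 (wp_rst.2 ⟨⟨Nat.zero_le _, trivial, d3,
    Nat.zero_le _, by simp⟩, ?_⟩)⟩)
  have n0 : ¬ (0 = 3 + d) := by omega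
  set v1 := (v.setI 3 _).stR (3 + d) _ _ with hv1
  have hr1 : Raw N v1 := ⟨by simp [hv1, hr.n], by simp [hv1, hr.τ], by simpa [hv1, n0] using hr.weight,
    by simpa [hv1, n0] using hr.len, by simpa [hv1, n0] using hr.cap⟩
  refine wp_whl (fun j w => ∃ i, i + j = N.n - 1 ∧ w.ir 3 = i ∧
    (∀ i' ≤ i, w.rm (3 + d) i' = Dl N d i') ∧ (∀ i' < i, w.rm (5 + d) i' = uc N d i') ∧
    w.rr 1 ≤ v.rr 1 ∧ ∀ i' < i, w.rr 1 ≤ - uc N d i')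
    (N.n - 1) 100 ⟨0, by simp, by simp [hv1], fun i' hi' => ?_, by simp,
      by simp [hv1], by simp⟩ ?_ ?_ ?_
  · obtain rfl : i' = 0 := by omega
    simp [hv1, Dl]
  · rintro j w hf ⟨i, h1, h2, h3⟩
    simp [h2]; omega
  · rintro j w hf ⟨i, h1, h2, h3, h4, h5, h6⟩ hc
    have hr' : Raw N w := hr1.of_fr hf (by simp) (by simp) (by simp; omega)
    simp only [Cond.Holds, IExp.eval, h2, hr'.n] at hc
    have hidx : (rawIdx d 2).eval w + 1 < N.n := by
      rw [rawIdx_eval, h2, hr'.n]; split_ifs <;> omega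
    have hl := rawIdx_len d 2
    have hu := uc_pos N (d := d) (i := i) (by omega)
    refine wp_seq.2 (wp_rset.2 ⟨⟨trivial, ⟨trivial, ⟨⟨trivial, ?_⟩, rawIdx_ok _ (by omega) _, ?_⟩,
      ?_⟩, by simp, ?_, fun _ => ?_⟩, ?_⟩)
    · simp; omega
    · simp [hr'.n]; omega
    · simp [hr'.n]; omega
    · simp [hr'.n]; omega
    · simp [hr'.n]; omega
    have e2 : (RExp.div (.c 1) (.ld 0 (.add (.r 0) (.add (.sub (.r 0) (.c 1))
        (rawIdx d 2))))).eval w = uc N d i := by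
      simp only [RExp.eval, IExp.eval, hr'.n]
      rw [hr'.cap _ hidx, rawIdx_eval, h2, hr'.n, uc]
      split_ifs <;> simp
    rw [e2]
    have hi1 : (rawIdx d 2).eval (w.setR 2 (uc N d i)) = (rawIdx d 2).eval w := by
      rw [rawIdx_eval, rawIdx_eval]; rfl
    refine wp_seq.2 (wp_rset.2 ⟨⟨trivial, ⟨trivial, rawIdx_ok _ (by omega) _, ?_⟩, by simp, ?_,
      fun _ => ?_⟩, ?_⟩)
    · simp [hi1, hr'.n]; omega
    · simp [hi1, hr'.n]; omega
    · simp [hi1, hr'.n]; omega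
    have e3 : (RExp.mul (.r 0) (.ld 0 (.add (.r 0) (rawIdx d 2)))).eval (w.setR 2 (uc N d i)) =
        dl N d i := by
      simp only [RExp.eval, IExp.eval, hr'.n, hi1, VState.setR_rm, VState.setR_ir]
      rw [hr'.len _ hidx, rawIdx_eval, h2, hr'.n, dl]
      split_ifs <;> simp [hr'.τ]
    rw [e3]
    refine wp_seq.2 (wp_rst.2 ⟨⟨?_, ⟨⟨trivial, d3, ?_, by simp⟩, trivial⟩, d3, ?_, by simp⟩, wp_seq.2
      (wp_rst.2 ⟨⟨trivial, trivial, d5, ?_, by simp⟩, wp_seq.2 (wp_rset.2 ⟨⟨trivial, trivial⟩,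
      wp_iset.2 ⟨?_, ?_, j - 1, by omega, i + 1, by omega, ?_, fun i' hi' => ?_,
      fun i' hi' => ?_, ?_, fun i' hi' => ?_⟩⟩)⟩)⟩)
    · simp [h2]; omega
    · simp [h2]; omega
    · simp [h2]; omega
    · simp [h2]; omega
    · simp [h2]; omega
    · simp; omega
    · simp [h2]
    · have e1 := h3 i le_rfl
      rcases Nat.lt_or_eq_of_le hi' with h | rfl
      · have : i' ≠ i + 1 := by omega
        simp [h2, this, h3 i' (by omega)]
      · simp [h2, e1, Dl_succ]
    · rcases Nat.lt_succ_iff_lt_or_eq.1 hi' with h | rfl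
      · have : i' ≠ i := by omega
        simp [h2, this, h4 i' h]
      · simp [h2]
    · simp; linarith
    · rcases Nat.lt_succ_iff_lt_or_eq.1 hi' with h | rfl
      · simp; linarith [h6 i' h]
      · simp; linarith
  · rintro t j w hf ⟨i, h1, h2, h3, h4, h5, h6⟩ hc ht
    have hr' : Raw N w := hr1.of_fr hf (by simp) (by simp) (by simp; omega)
    simp only [Cond.Holds, IExp.eval, h2, hr'.n] at hc
    refine ⟨?_, fun i' hi' => h3 i' (by omega), fun i' hi' => h4 i' (by omega), h5,
      fun i' hi' => h6 i' (by omega)⟩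
    simp only [Cond.len, IExp.len] at ht ⊢
    simp
    omega

def fill (d : ℕ) : Cmd :=
  .seq (fillS d) (.seq (fillE d) (.rset 1 (.sub (.r 1) (.ld (1 + d) (.r 0)))))

lemma wp_fill {d : ℕ} (hd : d < 2) (hr : Raw N v) (hx : v.rr 1 ≤ 0) (hV : 4 * N.n + 8 ≤ V)
    (hoff : 3 * N.n ≤ off) : Wp off V (fill d) v fun t w => t ≤ 180 * N.n + 80 ∧
      Tab N d w ∧ Low N d w ∧ w.rr 1 ≤ v.rr 1 := by
  refine wp_seq.2 ((wp_fillS hd hr hV hoff).frame.mono ?_)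
  rintro t1 v1 ⟨⟨ht1, h1⟩, hf1⟩
  have hr1 : Raw N v1 := hr.of_fr hf1 (by simp [fillS]) (by simp [fillS]) (by simp [fillS]; omega)
  have e1 : v1.rr 1 = v.rr 1 := hf1.rr 1 (by simp [fillS])
  refine wp_seq.2 ((wp_fillE hd hr1 (e1.trans_le hx) hV hoff).frame.mono ?_)
  rintro t2 v2 ⟨⟨ht2, h2, h3, h4, h5⟩, hf2⟩
  have hr2 : Raw N v2 := hr1.of_fr hf2 (by simp [fillE]) (by simp [fillE]) (by simp [fillE]; omega)
  have e2 : v2.rm (1 + d) = v1.rm (1 + d) := hf2.rm _ (by simp [fillE])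
  have hS : v2.rm (1 + d) N.n = Sw N d N.n := by rw [e2]; exact h1 _ le_rfl
  have hpos : 0 ≤ Sw N d N.n := by
    have := Sw_mono N (d := d) (Nat.zero_le N.n)
    simpa [Sw] using this
  refine wp_rset.2 ⟨⟨trivial, trivial, by omega, by simp [hr2.n]; omega, by simp⟩, ?_, ⟨?_, ?_, ?_⟩,
    ⟨?_, ?_, fun i hi => ?_⟩, ?_⟩
  · simp; omega
  · intro i hi
    simp only [VState.setR_rm, e2]
    exact h1 i hi
  · exact h2
  · exact h3
  all_goals simp only [VState.setR_rr, if_true, RExp.eval, IExp.eval, hr2.n, hS]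
  · linarith
  · linarith
  · linarith [h5 i hi]
  · linarith

end SinkRAM

namespace SinkRAM

variable {off V : ℕ} {v w : VState} {N : PathNetwork} {k H d y h p q : ℕ}

/-! ### Construction of the envelopes -/

/-- First line of the block of `q` at level `h`. -/
def blkStart (h q : ℕ) : ℕ := q / 2 ^ h * 2 ^ h

/-- End of the block of `q` at level `h`. -/
def blkEnd (N : PathNetwork) (h q : ℕ) : ℕ := min (blkStart h q + 2 ^ h) (N.n - 1)

lemma dvd_blkStart : 2 ^ h ∣ blkStart h q := Dvd.intro_left _ rfl

lemma blkStart_le : blkStart h q ≤ q := Nat.div_mul_le_self _ _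

lemma lt_blkStart_add : q < blkStart h q + 2 ^ h := by
  have := Nat.lt_div_mul_add (a := q) (b := 2 ^ h) (by positivity)
  exact this

lemma add_le_of_dvd_of_lt {m s s' : ℕ} (h : m ∣ s) (h' : m ∣ s') (hlt : s < s') : s + m ≤ s' := by
  obtain ⟨c, rfl⟩ := h
  obtain ⟨c', rfl⟩ := h'
  have : c < c' := lt_of_mul_lt_mul_left hlt (Nat.zero_le _)
  calc m * c + m = m * (c + 1) := by ring
    _ ≤ m * c' := Nat.mul_le_mul_left _ this

lemma blkStart_eq {s : ℕ} (hs : 2 ^ h ∣ s) (h1 : s ≤ q) (h2 : q < s + 2 ^ h) :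
    blkStart h q = s := by
  have h3 := blkStart_le (h := h) (q := q)
  have h4 := lt_blkStart_add (h := h) (q := q)
  rcases Nat.lt_trichotomy (blkStart h q) s with hlt | heq | hlt
  · have := add_le_of_dvd_of_lt dvd_blkStart hs hlt
    omega
  · exact heq
  · have := add_le_of_dvd_of_lt hs dvd_blkStart hlt
    omega

/-- The blocks of lower levels, and those of level `h` that start at `p` or later, are stored. -/
def Done (N : PathNetwork) (d y h p : ℕ) (w : VState) : Prop :=
  ∀ h' s, 2 ^ h' ∣ s → s + 2 ^ h' < N.n → (h' < h ∨ h' = h ∧ p ≤ s) → Blk N d y h' s w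

/-- Finished blocks do not meet the cells of the block at `s`: those of lower levels lie in earlier
rows, and those of the same level start at a later multiple of `2 ^ h`. -/
lemma Done.agree (hD : Done N d y h p v) {s : ℕ} (hs : 2 ^ h ∣ s) (hsp : s < p)
    (h1 : w.rr 1 = v.rr 1)
    (h2 : ∀ i, i < h * N.n + s ∨ h * N.n + s + 2 ^ h ≤ i →
      w.im (1 + 2 * d + y) i = v.im (1 + 2 * d + y) i)
    (h3 : ∀ j, j = 7 + 2 * d + y ∨ j = 11 + 2 * d + y ∨ j = 15 + 2 * d + y ∨ j = 19 + 2 * d + y →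
      ∀ i, i < h * N.n + s ∨ h * N.n + s + 2 ^ h ≤ i → w.rm j i = v.rm j i) :
    Done N d y h p w := by
  intro h' s' hd hn hh
  have hb := hD h' s' hd hn hh
  have key : ∀ i < 2 ^ h', h' * N.n + s' + i < h * N.n + s ∨
      h * N.n + s + 2 ^ h ≤ h' * N.n + s' + i := by
    intro i hi
    rcases hh with hh | ⟨rfl, hh⟩
    · have := Nat.mul_le_mul_right N.n (Nat.succ_le_of_lt hh)
      rw [Nat.succ_mul] at this
      omega
    · have := add_le_of_dvd_of_lt hs hd (by omega)
      omega
  have hp : 0 < 2 ^ h' := by positivity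
  have hsz := hb.env.size
  have k0 := key 0 hp
  rw [add_zero] at k0
  constructor
  · rw [h1, h2 _ k0]
    exact hb.env.congr (fun i hi => h3 _ (by simp) _ (key i (by omega)))
      (fun i hi => h3 _ (by simp) _ (key i (by omega)))
      (fun i hi => h3 _ (by simp) _ (key i (by omega)))
  · rw [h3 _ (by simp) _ k0]; exact hb.um

/-- The blocks of level `h` are being constructed; the lines with index at least `p` have been
processed. -/
structure Cur (N : PathNetwork) (d y h p : ℕ) (w : VState) : Prop where
  pos : w.ir 6 = p
  le : p + 1 ≤ N.n
  pw : w.ir 4 = 2 ^ h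
  row : w.ir 5 = h * N.n
  done : Done N d y h p w
  -- `q` is the line to be inserted next. Lines already popped on its behalf lie below it wherever
  -- they are missed.
  cur : ∀ q, p = q + 1 → w.rr 2 = Um N d p (blkEnd N h q) ∧
    Env (w.rm (7 + 2 * d + y)) (w.rm (11 + 2 * d + y)) (w.rm (15 + 2 * d + y))
      (h * N.n + blkStart h q) (w.ir 7) (lineA N d y (blkEnd N h q)) (lineC N d y (blkEnd N h q))
      p (blkEnd N h q) (w.rr 1)
      fun z x => z ≤ lineA N d y (blkEnd N h q) q * x + lineC N d y (blkEnd N h q) q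

/-- Go on to the next line. -/
def advance (d y : ℕ) : Cmd :=
  .seq (.rset 2 (.r 3)) (.seq (.iset 6 (.sub (.r 6) (.c 1)))
  (.ite (.ile (.r 6) (.mul (.div (.r 6) (.r 4)) (.r 4)))
    (.seq (.ist (1 + 2 * d + y) (.r 8) (.r 7)) (.seq (.rst (19 + 2 * d + y) (.r 8) (.r 2))
      (.seq (.iset 7 (.c 0)) (.rset 2 (.c 0))))) .skip))

lemma wp_advance (hd : d < 2) (hy : y < 2) (hq : q + 1 < N.n) (hV : h * N.n + 2 * N.n + 4 ≤ V)
    (pos : v.ir 6 = q + 1) (pw : v.ir 4 = 2 ^ h) (row : v.ir 5 = h * N.n)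
    (hU : v.rr 3 = Um N d q (blkEnd N h q)) (h8 : v.ir 8 = h * N.n + blkStart h q)
    (hE : Env (v.rm (7 + 2 * d + y)) (v.rm (11 + 2 * d + y)) (v.rm (15 + 2 * d + y))
      (h * N.n + blkStart h q) (v.ir 7) (lineA N d y (blkEnd N h q)) (lineC N d y (blkEnd N h q))
      q (blkEnd N h q) (v.rr 1) fun _ _ => False)
    (hD : Done N d y h (q + 1) v) :
    Wp off V (advance d y) v fun t w => t ≤ 60 ∧ Cur N d y h q w ∧ w.ir 7 ≤ v.ir 7 := by
  have hst := blkStart_le (h := h) (q := q)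
  have hlt := lt_blkStart_add (h := h) (q := q)
  have dI : 1 + 2 * d + y < 32 := by omega
  have dU : 19 + 2 * d + y < 32 := by omega
  have n1 : 7 + 2 * d + y ≠ 19 + 2 * d + y := by omega
  have n2 : 11 + 2 * d + y ≠ 19 + 2 * d + y := by omega
  have n3 : 15 + 2 * d + y ≠ 19 + 2 * d + y := by omega
  refine wp_seq.2 (wp_rset.2 ⟨trivial, wp_seq.2 (wp_iset.2 ⟨by simp; omega, wp_ite.2 ⟨?_,
    fun hc => wp_seq.2 (wp_ist.2 ⟨⟨trivial, trivial, dI, ?_, by simp⟩, wp_seq.2 (wp_rst.2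
    ⟨⟨trivial, trivial, dU, ?_, by simp⟩, wp_seq.2 (wp_iset.2 ⟨Nat.zero_le _, wp_rset.2
    ⟨trivial, ?_, ?_, ?_⟩⟩)⟩)⟩), fun hc => wp_skip.2 ⟨?_, ?_, ?_⟩⟩⟩)⟩)
  · simp only [Cond.Ok, IExp.Ok, IExp.eval, true_and, VState.setI_ir, VState.setR_ir]
    simp only [pos, pw]
    simp only [if_true, Nat.add_sub_cancel]
    have : q / 2 ^ h * 2 ^ h ≤ q := hst
    simpa using (by omega : q / 2 ^ h * 2 ^ h ≤ V)
  · simp [h8]; omega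
  · simp [h8]; omega
  · simp
  -- `q` is the first line of its block, so the block is complete and its size and maximum are
  -- stored. The preceding block ends at `q` and starts with an empty stack.
  · have hqs : q = blkStart h q := by
      simp [pos, pw] at hc
      exact le_antisymm hc hst
    set w := VState.setR _ 2 _ with hw
    have h7 : ∀ j, j = 7 + 2 * d + y ∨ j = 11 + 2 * d + y ∨ j = 15 + 2 * d + y →
        w.rm j = v.rm j := by
      intro j hj
      funext i
      have : j ≠ 19 + 2 * d + y := by omega
      simp [hw, this]
    have hwr : w.rr 1 = v.rr 1 := by simp [hw]
    have hwi : w.im (1 + 2 * d + y) (h * N.n + q) = v.ir 7 := by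
      simp [hw, h8, ← hqs]
    have hwu : w.rm (19 + 2 * d + y) (h * N.n + q) = Um N d q (blkEnd N h q) := by
      simp [hw, h8, ← hqs, hU]
    have hpow : 0 < 2 ^ h := by positivity
    have hD' : Done N d y h (q + 1) w := by
      refine hD.agree (hqs ▸ dvd_blkStart) (Nat.lt_succ_self q) hwr (fun i hi => ?_)
        (fun j hj i hi => ?_)
      · have : i ≠ h * N.n + q := by omega
        simp [hw, h8, ← hqs, this]
      · have : i ≠ h * N.n + q := by omega
        simp [hw, h8, ← hqs, this]
    refine ⟨by simp [hw, pos], by omega, by simp [hw, pw], by simp [hw, row], ?_, ?_⟩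
    · intro h' s' hdv hn hh
      by_cases he : h' = h ∧ s' = q
      · obtain ⟨rfl, rfl⟩ := he
        have hbe : blkEnd N h' s' = s' + 2 ^ h' := by
          rw [blkEnd, ← hqs]; omega
        rw [hbe, ← hqs] at hE
        refine ⟨?_, ?_⟩
        · rw [h7 _ (by simp), h7 _ (by simp), h7 _ (by simp), hwr, hwi]
          exact hE
        · rw [hwu, hbe]
      · exact hD' h' s' hdv hn (by omega)
    · rintro q' hqq
      have hs' : blkStart h q' + 2 ^ h = q := by
        have h1 := blkStart_le (h := h) (q := q')
        have h2 := lt_blkStart_add (h := h) (q := q')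
        have := add_le_of_dvd_of_lt dvd_blkStart (hqs ▸ dvd_blkStart : 2 ^ h ∣ q)
          (show blkStart h q' < q by omega)
        omega
      have hbe : blkEnd N h q' = q := by rw [blkEnd, hs']; omega
      rw [hbe]
      refine ⟨by simp [hw, Um_self], ?_⟩
      have : w.ir 7 = 0 := by simp [hw]
      rw [this]
      exact Env.empty q
  · simp
  · simp
  · have hne : ¬ q ≤ blkStart h q := by
      intro h'
      apply hc
      simp [pos, pw]
      exact h'
    refine ⟨by simp [pos], by omega, by simp [pw], by simp [row], ?_, ?_⟩
    · intro h' s' hdv hn hh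
      refine (hD h' s' hdv hn ?_).congr (by simp) rfl (fun _ _ => rfl)
      rcases hh with hh | ⟨rfl, hh⟩
      · exact Or.inl hh
      · refine Or.inr ⟨rfl, ?_⟩
        rcases Nat.eq_or_lt_of_le hh with rfl | hh
        · exact (hne (blkStart_eq hdv le_rfl (by have : 0 < 2 ^ h' := by positivity
                                                 omega)).ge).elim
        · exact hh
    · rintro q' hqq
      have hs' : blkStart h q' = blkStart h q := blkStart_eq dvd_blkStart (by omega) (by omega)
      have hbe : blkEnd N h q' = blkEnd N h q := by rw [blkEnd, hs', blkEnd]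
      rw [hbe, hs']
      refine ⟨by simp [hU], ?_⟩
      -- A complete envelope misses nothing, so it may be regarded as missing only what lies below
      -- the next line.
      simpa using hE.weaken fun _ _ hf => hf.elim
  · simp

/-- The line with index `q`, where register `6` is `q + 1`. -/
def lineCmd (d y : ℕ) : Cmd :=
  if y = 0 then .seq (.rset 4 (.r 3))
    (.rset 5 (.sub (.mul (.ld (1 + d) (.r 6)) (.r 3)) (.ld (3 + d) (.sub (.r 6) (.c 1)))))
  else .seq (.rset 4 (.sub (.c 0) (.ld (1 + d) (.r 6))))
    (.rset 5 (.sub (.c 0) (.ld (3 + d) (.sub (.r 6) (.c 1)))))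

def loadLine (d y : ℕ) : Cmd :=
  .seq (.rset 3 (.ld (5 + d) (.sub (.r 6) (.c 1))))
  (.seq (.ite (.rle (.r 3) (.r 2)) (.rset 3 (.r 2)) .skip)
  (.seq (.iset 8 (.add (.r 5) (.mul (.div (.sub (.r 6) (.c 1)) (.r 4)) (.r 4)))) (lineCmd d y)))

lemma lineCmd_w (d y : ℕ) : (lineCmd d y).wI = [] ∧ (lineCmd d y).wR = [4, 5] ∧
    (lineCmd d y).wIM = [] ∧ (lineCmd d y).wRM = [] := by
  unfold lineCmd; split_ifs <;> simp

lemma wp_loadLine (hd : d < 2) (hq : q + 1 < N.n) (hV : h * N.n + 2 * N.n + 4 ≤ V)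
    (ht : Tab N d v) (pos : v.ir 6 = q + 1) (pw : v.ir 4 = 2 ^ h) (row : v.ir 5 = h * N.n) {e : ℕ}
    (hqe : q < e) (hU : v.rr 2 = Um N d (q + 1) e) :
    Wp off V (loadLine d y) v fun t w => t ≤ 100 ∧ w.rr 3 = Um N d q e ∧
      w.rr 4 = lineA N d y e q ∧ w.rr 5 = lineC N d y e q ∧ w.ir 8 = h * N.n + blkStart h q := by
  have d1 : 1 + d < 32 := by omega
  have d3 : 3 + d < 32 := by omega
  have d5 : 5 + d < 32 := by omega
  have e1 := ht.u q hq
  have e2 := ht.D q (by omega)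
  have e3 := ht.S (q + 1) (by omega)
  have hst := blkStart_le (h := h) (q := q)
  refine wp_seq.2 (wp_rset.2 ⟨⟨⟨trivial, by simp; omega⟩, d5, by simp [pos]; omega, by simp⟩,
    wp_seq.2 (wp_max ?_)⟩)
  intro t1 w1 ht1 h3 hr hi him hrm
  have h3 : w1.rr 3 = Um N d q e := by
    rw [h3, Um_succ hqe]; simp [pos, e1, hU, max_comm]
  have hi : w1.ir = v.ir := hi
  have hrm : w1.rm = v.rm := hrm
  refine wp_seq.2 (wp_iset.2 ⟨?_, ?_⟩)
  · simp only [IExp.Ok, IExp.eval, true_and, hi]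
    rw [pos, pw, row, Nat.add_sub_cancel]
    have : q / 2 ^ h * 2 ^ h ≤ q := hst
    exact ⟨⟨⟨by omega, trivial⟩, by omega⟩, by omega⟩
  have h8 : (IExp.add (.r 5) (.mul (.div (.sub (.r 6) (.c 1)) (.r 4)) (.r 4))).eval w1 =
      h * N.n + blkStart h q := by simp [hi, pos, pw, row, blkStart]
  rw [h8]
  unfold lineCmd
  split_ifs with hy0
  · subst hy0
    refine wp_seq.2 (wp_rset.2 ⟨trivial, wp_rset.2 ⟨?_, ?_, ?_⟩⟩)
    · simp [hi, pos, d1, d3]; omega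
    · simp; omega
    · simp [hi, pos, hrm, h3, e2, e3, lineA, lineC]
  · refine wp_seq.2 (wp_rset.2 ⟨?_, wp_rset.2 ⟨?_, ?_, ?_⟩⟩)
    · simp [hi, pos, d1]; omega
    · simp [hi, pos, d3]; omega
    · simp; omega
    · simp [hi, pos, hrm, h3, e2, e3, lineA, lineC, hy0]

/-- Address of the top of the envelope. -/
def topIx : IExp := .sub (.add (.r 8) (.r 7)) (.c 1)

def pushFirst (d y : ℕ) : Cmd :=
  .seq (.rst (15 + 2 * d + y) (.r 8) (.r 1)) (.seq (.rst (7 + 2 * d + y) (.r 8) (.r 4))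
    (.seq (.rst (11 + 2 * d + y) (.r 8) (.r 5)) (.iset 7 (.c 1))))

def pushTop (d y : ℕ) : Cmd :=
  .seq (.rst (15 + 2 * d + y) (.add (.r 8) (.r 7)) (.div (.sub (.ld (11 + 2 * d + y) topIx) (.r 5))
    (.sub (.r 4) (.ld (7 + 2 * d + y) topIx))))
  (.seq (.rst (7 + 2 * d + y) (.add (.r 8) (.r 7)) (.r 4))
  (.seq (.rst (11 + 2 * d + y) (.add (.r 8) (.r 7)) (.r 5)) (.iset 7 (.add (.r 7) (.c 1)))))

lemma wp_pushTop {o top : ℕ} {a b : ℝ} (hd : d < 2) (hy : y < 2) (htop : v.ir 7 = top + 1)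
    (h8 : v.ir 8 = o) (hV : o + top + 2 ≤ V) (ha : v.rr 4 = a) (hb : v.rr 5 = b) :
    Wp off V (pushTop d y) v fun t w => t ≤ 100 ∧ w.ir 7 = top + 2 ∧
      (∀ j i, i ≠ o + (top + 1) → w.rm j i = v.rm j i) ∧
      w.rm (7 + 2 * d + y) (o + (top + 1)) = a ∧ w.rm (11 + 2 * d + y) (o + (top + 1)) = b ∧
      w.rm (15 + 2 * d + y) (o + (top + 1)) = (v.rm (11 + 2 * d + y) (o + top) - b) /
        (a - v.rm (7 + 2 * d + y) (o + top)) := by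
  have j7 : 7 + 2 * d + y < 32 := by omega
  have j11 : 11 + 2 * d + y < 32 := by omega
  have j15 : 15 + 2 * d + y < 32 := by omega
  have hix : topIx.eval v = o + top := by simp [topIx, h8, htop]
  have hok : topIx.Ok off V v := by simp [topIx, h8, htop]; omega
  refine wp_seq.2 (wp_rst.2 ⟨⟨?_, ⟨⟨⟨hok, j11, by omega, by simp⟩, trivial⟩, trivial,
    hok, j7, by omega, by simp⟩, j15, ?_, by simp⟩, wp_seq.2 (wp_rst.2 ⟨⟨?_,
    trivial, j7, ?_, by simp⟩, wp_seq.2 (wp_rst.2 ⟨⟨?_,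
    trivial, j11, ?_, by simp⟩, wp_iset.2 ⟨?_, ?_, ?_, ?_, ?_, ?_, ?_⟩⟩)⟩)⟩)
  · simp [h8, htop]; omega
  · simp [h8, htop]; omega
  · simp [h8, htop]; omega
  · simp [h8, htop]; omega
  · simp [h8, htop]; omega
  · simp [h8, htop]; omega
  · simp [htop]; omega
  · simp [topIx]
  · simp [htop]
  · intro j i hi
    simp [h8, htop, hi]
  · simp [h8, htop, ha]
  · simp [h8, htop, hb]
  · simp [h8, htop, ha, hb, hix]

lemma wp_pushFirst {o : ℕ} {a b : ℝ} (hd : d < 2) (hy : y < 2)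
    (h8 : v.ir 8 = o) (hV : o + 1 ≤ V) (ha : v.rr 4 = a) (hb : v.rr 5 = b) :
    Wp off V (pushFirst d y) v fun t w => t ≤ 100 ∧ w.ir 7 = 1 ∧
      (∀ j i, i ≠ o → w.rm j i = v.rm j i) ∧ w.rm (7 + 2 * d + y) o = a ∧
      w.rm (11 + 2 * d + y) o = b ∧ w.rm (15 + 2 * d + y) o = v.rr 1 := by
  have j7 : 7 + 2 * d + y < 32 := by omega
  have j11 : 11 + 2 * d + y < 32 := by omega
  have j15 : 15 + 2 * d + y < 32 := by omega
  refine wp_seq.2 (wp_rst.2 ⟨⟨trivial, trivial, j15, ?_, by simp⟩, wp_seq.2 (wp_rst.2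
    ⟨⟨trivial, trivial, j7, ?_, by simp⟩, wp_seq.2 (wp_rst.2 ⟨⟨trivial,
    trivial, j11, ?_, by simp⟩, wp_iset.2 ⟨?_, ?_, ?_, ?_, ?_, ?_, ?_⟩⟩)⟩)⟩)
  · simp [h8]; omega
  · simp [h8]; omega
  · simp [h8]; omega
  · simp; omega
  · simp
  · simp
  · intro j i hi
    simp [h8, hi]
  · simp [h8, ha]
  · simp [h8, hb]
  · simp [h8]

/-- Remove the top of the envelope, or add a line. -/
def buildStep (d y : ℕ) : Cmd :=
  .seq (loadLine d y) (.ite (.ile (.c 1) (.r 7))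
    (.ite (.rle (.add (.mul (.ld (7 + 2 * d + y) topIx) (.ld (15 + 2 * d + y) topIx))
        (.ld (11 + 2 * d + y) topIx)) (.add (.mul (.r 4) (.ld (15 + 2 * d + y) topIx)) (.r 5)))
      (.iset 7 (.sub (.r 7) (.c 1)))
      (.seq (.ite (.rle (.r 4) (.ld (7 + 2 * d + y) topIx)) .skip (pushTop d y)) (advance d y)))
    (.seq (pushFirst d y) (advance d y)))

/-- The potential is twice the number of lines left plus the size of the stack. Removing the top
lowers it by one. Finishing a line lowers the first part by two and raises the second by at most
one. -/
lemma wp_buildStep (hd : d < 2) (hy : y < 2) (hV : h * N.n + 4 * N.n + 4 ≤ V)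
    (ht : Tab N d v) (hc : Cur N d y h p v) (hp : 1 ≤ p) :
    Wp off V (buildStep d y) v fun t w => t ≤ 600 ∧ ∃ p', Cur N d y h p' w ∧
      2 * p' + w.ir 7 < 2 * p + v.ir 7 := by
  obtain ⟨q, rfl⟩ : ∃ q, p = q + 1 := ⟨p - 1, by omega⟩
  obtain ⟨pos, hle, pw, row, hD, hcur⟩ := hc
  obtain ⟨hU, hE⟩ := hcur q rfl
  have hst := blkStart_le (h := h) (q := q)
  have hlt := lt_blkStart_add (h := h) (q := q)
  have hqe : q < blkEnd N h q := by rw [blkEnd]; omega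
  have hen : blkEnd N h q ≤ blkStart h q + 2 ^ h ∧ blkEnd N h q ≤ N.n - 1 := by
    rw [blkEnd]; omega
  set e := blkEnd N h q with he
  set s := blkStart h q with hs
  have hsz := hE.size
  have j7 : 7 + 2 * d + y < 32 := by omega
  have j11 : 11 + 2 * d + y < 32 := by omega
  have j15 : 15 + 2 * d + y < 32 := by omega
  refine wp_seq.2 ((wp_loadLine (y := y) hd (by omega) (by omega) ht pos pw row hqe hU).frame.mono
    ?_)
  rintro t1 w ⟨⟨ht1, u3, u4, u5, u8⟩, hf⟩
  have g : ∀ i, i ≠ 8 → w.ir i = v.ir i := fun i hi => hf.ir i (by simp [loadLine, lineCmd_w, hi])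
  have gim : w.im = v.im := funext fun j => hf.im j (by simp [loadLine, lineCmd_w])
  have grm : w.rm = v.rm := funext fun j => hf.rm j (by simp [loadLine, lineCmd_w])
  have g1 : w.rr 1 = v.rr 1 := hf.rr 1 (by simp [loadLine, lineCmd_w])
  have g7 := g 7 (by simp)
  have hD' : Done N d y h (q + 1) w := fun h' s' a1 a2 a3 =>
    (hD h' s' a1 a2 a3).congr g1 (by rw [gim]) (fun j _ => by rw [grm])
  rw [← g1, ← g7, ← grm] at hE
  rw [← g7] at hsz ⊢
  rw [← g 6 (by simp)] at pos
  rw [← g 4 (by simp)] at pw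
  rw [← g 5 (by simp)] at row
  clear_value e
  -- Common end of the three ways to finish a line: it is redundant, it is pushed on a nonempty
  -- stack, or it is the first of its stack.
  have final : ∀ (c : Cmd) (tt : ℕ) (w' : VState), tt ≤ 200 → Fr c w w' →
      (∀ i ∈ c.wI, i = 7) → c.wR = [] → c.wIM = [] →
      (∀ j i, i < h * N.n + s ∨ h * N.n + s + 2 ^ h ≤ i → w'.rm j i = w.rm j i) →
      w'.ir 7 ≤ w.ir 7 + 1 →
      Env (w'.rm (7 + 2 * d + y)) (w'.rm (11 + 2 * d + y)) (w'.rm (15 + 2 * d + y))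
        (h * N.n + s) (w'.ir 7) (lineA N d y e) (lineC N d y e) q e (w'.rr 1) (fun _ _ => False) →
      Wp off V (advance d y) w' fun t' w'' => t1 + (tt + t') ≤ 400 ∧ ∃ p', Cur N d y h p' w'' ∧
        2 * p' + w''.ir 7 < 2 * (q + 1) + w.ir 7 := by
    intro c tt w' htt hf' f1 f2 f3 hag h7 hE'
    have k : ∀ i, i ≠ 7 → w'.ir i = w.ir i := fun i hi => hf'.ir i fun hm => hi (f1 i hm)
    have kr : w'.rr = w.rr := funext fun i => hf'.rr i (by simp [f2])
    have ki : w'.im = w.im := funext fun i => hf'.im i (by simp [f3])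
    have hD2 : Done N d y h (q + 1) w' := hD'.agree (s := s) dvd_blkStart (by omega) (by rw [kr])
      (fun i _ => by rw [ki]) (fun j _ i hi => hag j i hi)
    subst he
    refine (wp_advance hd hy (by omega) (by omega) (by rw [k 6 (by simp), pos])
      (by rw [k 4 (by simp), pw]) (by rw [k 5 (by simp), row]) (by rw [kr, u3])
      (by rw [k 8 (by simp), u8]) hE' hD2).mono ?_
    rintro t' w'' ⟨ht', hC, h7'⟩
    exact ⟨by omega, q, hC, by omega⟩
  have hpow : 0 < 2 ^ h := by positivity
  refine wp_ite.2 ⟨by simp; omega, fun hc => ?_, fun hc => wp_seq.2 ?_⟩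
  · obtain ⟨top, htop⟩ : ∃ top, w.ir 7 = top + 1 := by
      simp at hc; exact ⟨w.ir 7 - 1, by omega⟩
    have hix : topIx.eval w = h * N.n + s + top := by simp [topIx, u8, htop]; omega
    have hok : topIx.Ok off V w := by simp [topIx, u8]; omega
    rw [htop] at hE hsz
    refine wp_ite.2 ⟨⟨⟨⟨⟨hok, j7, by omega, by simp⟩, ⟨hok, j15, by omega, by simp⟩⟩,
      ⟨hok, j11, by omega, by simp⟩⟩, ⟨trivial, hok, j15, by omega, by simp⟩,
      trivial⟩, fun hdom => wp_iset.2 ⟨by simp; omega, ?_, q + 1, ⟨?_, ?_, ?_, ?_, ?_, ?_⟩, ?_⟩,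
      fun hlt' => wp_seq.2 ?_⟩
    · simp [topIx]; omega
    · simp [pos]
    · omega
    · simp [pw]
    · simp [row]
    · exact fun h' s' a1 a2 a3 => (hD' h' s' a1 a2 a3).congr rfl rfl (fun j _ => rfl)
    · intro q' hq'
      obtain rfl : q' = q := by omega
      rw [← he]
      have hU' : w.rr 2 = v.rr 2 := hf.rr 2 (by simp [loadLine, lineCmd_w])
      refine ⟨by simp [hU', hU], ?_⟩
      simp only [Cond.Holds, RExp.eval, hix, u4, u5] at hdom
      have := hE.pop (fun q'' a1 a2 => lineA_anti (by omega)) hdom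
      simpa [htop] using this
    · simp [htop]
    simp only [Cond.Holds, RExp.eval, hix, u4, u5, not_le] at hlt'
    refine wp_ite.2 ⟨⟨trivial, hok, j7, by omega, by simp⟩, fun hk => wp_skip.2 ?_,
      fun hk => ?_⟩
    · simp only [Cond.Holds, RExp.eval, hix, u4] at hk
      refine (final .skip 0 w (by omega) (Fr.refl _ _) (by simp) rfl rfl
        (fun _ _ _ => rfl) (by omega) ?_).mono ?_
      · rw [htop]
        exact hE.keep hk (fun q' a1 a2 => lineA_anti (by omega)) hlt'
      · rintro t' w' ⟨b1, b2⟩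
        exact ⟨by simp [topIx]; omega, b2⟩
    · simp only [Cond.Holds, RExp.eval, hix, u4, not_le] at hk
      have hwf := wp_pushTop (off := off) (V := V) hd hy htop u8 (by omega) u4 u5
      refine hwf.frame.mono ?_
      rintro t2 w2 ⟨⟨ht2, c7, cag, cA, cC, cX⟩, hf2⟩
      have c1 : w2.rr 1 = w.rr 1 := hf2.rr 1 (by simp [pushTop])
      refine (final (pushTop d y) t2 w2 (by omega) hf2 (by simp [pushTop]) (by simp [pushTop])
        (by simp [pushTop]) (fun j i hi => cag j i (by omega)) (by omega)
        ?_).mono ?_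
      · have ag : ∀ j, ∀ i < top + 1, w2.rm j (h * N.n + s + i) = w.rm j (h * N.n + s + i) :=
          fun j i hi => cag j _ (by omega)
        have hE2 := hE.congr (ag (7 + 2 * d + y)) (ag (11 + 2 * d + y)) (ag (15 + 2 * d + y))
        rw [c7, c1]
        refine hE2.push ?_ ?_ cA cC ?_
        · rw [ag _ _ (by omega)]; exact hk
        · rw [ag _ _ (by omega), ag _ _ (by omega), ag _ _ (by omega)]; exact hlt'
        · rw [ag (11 + 2 * d + y) top (by omega), ag (7 + 2 * d + y) top (by omega)]; exact cX
      · rintro t' w' ⟨b1, b2⟩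
        exact ⟨by simp [topIx]; omega, b2⟩
  · have htop : w.ir 7 = 0 := by simp at hc; exact hc
    rw [htop] at hE
    have hwf := wp_pushFirst (off := off) (V := V) hd hy u8 (by omega) u4 u5
    refine hwf.frame.mono ?_
    rintro t2 w2 ⟨⟨ht2, c7, cag, cA, cC, cX⟩, hf2⟩
    have c1 : w2.rr 1 = w.rr 1 := hf2.rr 1 (by simp [pushFirst])
    refine (final (pushFirst d y) t2 w2 (by omega) hf2 (by simp [pushFirst])
      (by simp [pushFirst]) (by simp [pushFirst])
      (fun j i hi => cag j i (by omega)) (by omega) ?_).mono ?_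
    · have hE2 := hE.congr (al' := w2.rm (7 + 2 * d + y)) (be' := w2.rm (11 + 2 * d + y))
        (xi' := w2.rm (15 + 2 * d + y)) (by simp) (by simp) (by simp)
      rw [c7, c1]
      exact hE2.push_first cA cC cX
    · rintro t' w' ⟨b1, b2⟩
      exact ⟨by simp; omega, b2⟩

end SinkRAM

/-! ### All levels, directions and kinds of envelopes. -/

namespace SinkRAM

variable {off V : ℕ} {v w : VState} {N : PathNetwork} {k H d y h : ℕ}

lemma loadLine_wI : (loadLine d y).wI = [8] := by simp [loadLine, lineCmd_w]

lemma loadLine_wR : (loadLine d y).wR = [3, 3, 4, 5] := by simp [loadLine, lineCmd_w]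

lemma loadLine_wIM : (loadLine d y).wIM = [] := by simp [loadLine, lineCmd_w]

lemma loadLine_wRM : (loadLine d y).wRM = [] := by simp [loadLine, lineCmd_w]

lemma buildStep_wI : ∀ i ∈ (buildStep d y).wI, 6 ≤ i ∧ i ≤ 8 := by
  simp [buildStep, loadLine_wI, pushTop, pushFirst, advance]

lemma buildStep_wR : ∀ i ∈ (buildStep d y).wR, 2 ≤ i ∧ i ≤ 5 := by
  simp [buildStep, loadLine_wR, pushTop, pushFirst, advance]

lemma buildStep_wIM : ∀ j ∈ (buildStep d y).wIM, j = 1 + 2 * d + y := by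
  simp [buildStep, loadLine_wIM, pushTop, pushFirst, advance]

lemma buildStep_wRM : ∀ j ∈ (buildStep d y).wRM, j = 7 + 2 * d + y ∨ j = 11 + 2 * d + y ∨
    j = 15 + 2 * d + y ∨ j = 19 + 2 * d + y := by
  simp [buildStep, loadLine_wRM, pushTop, pushFirst, advance]

/-- Construct the blocks of a level. -/
def buildLevel (d y : ℕ) : Cmd :=
  .seq (.iset 6 (.sub (.r 0) (.c 1))) (.seq (.iset 7 (.c 0)) (.seq (.rset 2 (.c 0))
    (.whl (.ile (.c 1) (.r 6)) (buildStep d y))))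

/-- The potential of `wp_buildStep` starts at `2 * (n - 1)`, so all blocks of one level together
take linear time. Truncated blocks at the right end of the path are built as well, but never claimed
or used. -/
lemma wp_buildLevel (hd : d < 2) (hy : y < 2) (hV : h * N.n + 4 * N.n + 4 ≤ V) (hn : v.ir 0 = N.n)
    (ht : Tab N d v) (pw : v.ir 4 = 2 ^ h) (row : v.ir 5 = h * N.n)
    (hD : ∀ h' s, 2 ^ h' ∣ s → s + 2 ^ h' < N.n → h' < h → Blk N d y h' s v) :
    Wp off V (buildLevel d y) v fun t w => t ≤ 1300 * N.n + 50 ∧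
      ∀ h' s, 2 ^ h' ∣ s → s + 2 ^ h' < N.n → h' < h + 1 → Blk N d y h' s w := by
  have hn1 := N.n_pos
  refine wp_seq.2 (wp_iset.2 ⟨⟨trivial, by simp; omega⟩, wp_seq.2 (wp_iset.2 ⟨Nat.zero_le _, wp_seq.2
    (wp_rset.2 ⟨trivial, ?_⟩)⟩)⟩)
  set v1 := VState.setR _ 2 _ with hv1
  have ht1 : Tab N d v1 := ⟨ht.S, ht.D, ht.u⟩
  have hc1 : Cur N d y h (N.n - 1) v1 := by
    refine ⟨by simp [hv1, hn], by omega, by simp [hv1, pw], by simp [hv1, row], ?_, fun q hq => ?_⟩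
    · intro h' s h1 h2 h3
      refine (hD h' s h1 h2 (h3.resolve_right fun h4 => ?_)).congr (by simp [hv1]) rfl
        (fun _ _ => rfl)
      have : 0 < 2 ^ h' := by positivity
      omega
    · have hlt := lt_blkStart_add (h := h) (q := q)
      have he : blkEnd N h q = N.n - 1 := by rw [blkEnd]; omega
      rw [he]
      refine ⟨by simp [hv1, Um_self], ?_⟩
      have : v1.ir 7 = 0 := by simp [hv1]
      rw [this]
      exact Env.empty _
  refine wp_whl (fun j w => ∃ p, Cur N d y h p w ∧ j = 2 * p + w.ir 7) (2 * (N.n - 1)) 600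
    ⟨_, hc1, by simp [hv1]⟩ ?_ ?_ ?_
  · rintro j w - ⟨p, hc, -⟩
    simp; omega
  · rintro j w hf ⟨p, hc, rfl⟩ hp
    simp only [Cond.Holds, IExp.eval, hc.pos] at hp
    have ht' : Tab N d w := ht1.of_fr hf (fun h => by have := buildStep_wRM _ h; omega)
      (fun h => by have := buildStep_wRM _ h; omega) (fun h => by have := buildStep_wRM _ h; omega)
    refine (wp_buildStep hd hy hV ht' hc hp).mono ?_
    rintro t w' ⟨h1, p', h2, h3⟩
    exact ⟨h1, _, h3, p', h2, rfl⟩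
  · rintro t j w hf ⟨p, hc, -⟩ hp ht
    simp only [Cond.Holds, IExp.eval, hc.pos] at hp
    refine ⟨?_, fun h' s h1 h2 h3 => hc.done h' s h1 h2 (by omega)⟩
    simp only [Cond.len, IExp.len, RExp.len] at ht ⊢
    omega

/-- Construct all blocks for a direction and a kind of envelope. -/
def build (d y : ℕ) : Cmd :=
  .seq (.iset 3 (.c 0)) (.seq (.iset 4 (.c 1)) (.seq (.iset 5 (.c 0))
    (.whl (.ile (.add (.r 3) (.c 1)) (.r 2)) (.seq (buildLevel d y)
      (.seq (.iset 3 (.add (.r 3) (.c 1))) (.seq (.iset 4 (.mul (.r 4) (.c 2)))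
        (.iset 5 (.add (.r 5) (.r 0)))))))))

lemma build_wI : ∀ i ∈ (build d y).wI, 3 ≤ i ∧ i ≤ 8 := by
  intro i hi
  have := buildStep_wI (d := d) (y := y) i
  simp only [build, buildLevel, Cmd.wI, List.mem_append, List.mem_cons, List.not_mem_nil, or_false,
    false_or] at hi
  rcases hi with hi | hi | hi | (hi | hi | hi) | hi | hi | hi <;>
    first | omega | (have := this hi; omega)

lemma build_wR : ∀ i ∈ (build d y).wR, 2 ≤ i ∧ i ≤ 5 := by
  intro i hi
  have := buildStep_wR (d := d) (y := y) i
  simp only [build, buildLevel, Cmd.wR, List.mem_append, List.mem_cons, List.not_mem_nil, or_false,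
    false_or] at hi
  rcases hi with hi | hi <;> first | omega | (have := this hi; omega)

lemma build_wIM : ∀ j ∈ (build d y).wIM, j = 1 + 2 * d + y := by
  intro j hj
  refine buildStep_wIM j ?_
  simpa [build, buildLevel] using hj

lemma build_wRM : ∀ j ∈ (build d y).wRM, j = 7 + 2 * d + y ∨ j = 11 + 2 * d + y ∨
    j = 15 + 2 * d + y ∨ j = 19 + 2 * d + y := by
  intro j hj
  refine buildStep_wRM j ?_
  simpa [build, buildLevel] using hj

lemma wp_build (hd : d < 2) (hy : y < 2) (hbig : Big N.n k H V) (hn : v.ir 0 = N.n)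
    (hH : v.ir 2 = H) (ht : Tab N d v) :
    Wp off V (build d y) v fun t w => t ≤ H * (1300 * N.n + 100) + 30 ∧
      ∀ h < H, ∀ s, 2 ^ h ∣ s → s + 2 ^ h < N.n → Blk N d y h s w := by
  have hn1 := N.n_pos
  have hV := hbig.le
  refine wp_seq.2 (wp_iset.2 ⟨Nat.zero_le _, wp_seq.2 (wp_iset.2 ⟨by simp; omega, wp_seq.2
    (wp_iset.2 ⟨Nat.zero_le _, ?_⟩)⟩)⟩)
  set v1 := VState.setI _ 5 _ with hv1
  have ht1 : Tab N d v1 := ⟨ht.S, ht.D, ht.u⟩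
  have key : ∀ (v' : VState), Fr (.seq (buildLevel d y)
      (.seq (.iset 3 (.add (.r 3) (.c 1))) (.seq (.iset 4 (.mul (.r 4) (.c 2)))
        (.iset 5 (.add (.r 5) (.r 0)))))) v1 v' → v'.ir 0 = N.n ∧ v'.ir 2 = H ∧ Tab N d v' := by
    intro v' hf
    have a1 : ∀ i, i < 3 → v'.ir i = v1.ir i := fun i hi => hf.ir i fun h => by
      have := buildStep_wI (d := d) (y := y) i
      simp [buildLevel] at h
      rcases h with (h | h | h) | h | h | h <;> first | omega | (have := this h; omega)
    have a2 : ∀ j, j < 7 → v'.rm j = v1.rm j := fun j hj => hf.rm j fun h => by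
      have := buildStep_wRM (d := d) (y := y) j (by simpa [buildLevel] using h)
      omega
    refine ⟨by rw [a1 0 (by omega)]; simp [hv1, hn], by rw [a1 2 (by omega)]; simp [hv1, hH], ?_⟩
    exact ⟨by rw [a2 _ (by omega)]; exact ht1.S, by rw [a2 _ (by omega)]; exact ht1.D,
      by rw [a2 _ (by omega)]; exact ht1.u⟩
  refine wp_whl (fun j w => ∃ h, h + j = H ∧ w.ir 3 = h ∧ w.ir 4 = 2 ^ h ∧ w.ir 5 = h * N.n ∧
    ∀ h' s, 2 ^ h' ∣ s → s + 2 ^ h' < N.n → h' < h → Blk N d y h' s w) H (1300 * N.n + 80)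
    ⟨0, by simp, by simp [hv1], by simp [hv1], by simp [hv1], fun h' s _ _ h3 => by omega⟩ ?_ ?_ ?_
  · rintro j w - ⟨h, h1, h2, -⟩
    simp [h2]; omega
  · rintro j w hf ⟨h, h1, h2, h3, h4, h5⟩ hc
    obtain ⟨k0, k2, kT⟩ := key w hf
    simp only [Cond.Holds, IExp.eval, h2, k2] at hc
    have hHn := Nat.mul_le_mul_right N.n hc
    rw [Nat.succ_mul] at hHn
    have hpow : 2 ^ h * 2 ≤ 2 ^ H := by
      rw [← pow_succ]; exact Nat.pow_le_pow_right (by omega) hc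
    have hpl := hbig.pow_le
    refine wp_seq.2 ((wp_buildLevel hd hy (by omega) k0 kT h3 h4 h5).frame.mono ?_)
    rintro t w' ⟨⟨ht', hB⟩, hf'⟩
    have b : ∀ i, i < 6 → w'.ir i = w.ir i := fun i hi => hf'.ir i fun h => by
      have := buildStep_wI (d := d) (y := y) i
      simp [buildLevel] at h
      rcases h with h | h | h <;> first | omega | (have := this h; omega)
    have b0 := b 0 (by omega)
    have b3 := b 3 (by omega)
    have b4 := b 4 (by omega)
    have b5 := b 5 (by omega)
    refine wp_seq.2 (wp_iset.2 ⟨?_, wp_seq.2 (wp_iset.2 ⟨?_, wp_iset.2 ⟨?_, ?_, j - 1, by omega, h + 1,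
      by omega, ?_, ?_, ?_, ?_⟩⟩)⟩)
    · simp [b3, h2]; omega
    · simp [b4, h3]; omega
    · simp [b5, h4, b0, k0]; omega
    · simp; omega
    · simp [b3, h2]
    · simp [b4, h3, pow_succ]
    · simp [b5, h4, b0, k0, Nat.succ_mul]
    · exact fun h' s a1 a2 a3 => (hB h' s a1 a2 a3).congr rfl rfl (fun _ _ => rfl)
  · rintro t j w hf ⟨h, h1, h2, h3, h4, h5⟩ hc ht
    obtain ⟨k0, k2, kT⟩ := key w hf
    simp only [Cond.Holds, IExp.eval, h2, k2] at hc
    obtain rfl : h = H := by omega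
    refine ⟨?_, fun h' hh s h6 h7 => h5 h' s h6 h7 hh⟩
    simp only [Cond.len, IExp.len] at ht ⊢
    have e : 1300 * N.n + 80 + (2 + (1 + 1) + (2 + 1)) + 1 ≤ 1300 * N.n + 100 := by omega
    have := Nat.mul_le_mul_left h e
    omega

/-- Construct the data structure. -/
def prepare : Cmd :=
  .seq levels (.seq (fill 0) (.seq (fill 1)
    (.seq (build 0 0) (.seq (build 0 1) (.seq (build 1 0) (build 1 1))))))

/-- The sizes of words that are needed do not depend on the number of levels. -/
lemma Big.of_le {n k H V : ℕ} (hV : 8 * (n * n) + 24 * n + 2 * k + 64 ≤ V) (h1 : n ≤ 2 ^ H)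
    (h2 : 2 ^ H ≤ 2 * n) : Big n k H V := by
  have hH : H ≤ 2 * n := Nat.lt_two_pow_self.le.trans h2
  have := Nat.mul_le_mul_right n hH
  have e : 2 * n * n = 2 * (n * n) := by ring
  exact ⟨by omega, h2, h1⟩

lemma fill_wI : ∀ i ∈ (fill d).wI, i = 3 := by simp [fill, fillS, fillE]

lemma fill_wR : ∀ i ∈ (fill d).wR, 1 ≤ i := by simp [fill, fillS, fillE]

lemma fill_wRM : ∀ j ∈ (fill d).wRM, j = 1 + d ∨ j = 3 + d ∨ j = 5 + d := by
  simp [fill, fillS, fillE]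

/-- A part of the data structure survives the construction of another one. -/
lemma Blk.of_build {d' y' s : ℕ} (hb : Blk N d y h s v) (hf : Fr (build d' y') v w)
    (hd : d < 2) (hy : y < 2) (hd' : d' < 2) (hy' : y' < 2) (hne : ¬ (d = d' ∧ y = y')) :
    Blk N d y h s w :=
  hb.congr (hf.rr 1 fun h => by have := build_wR _ h; omega)
    (hf.im _ fun h => by have := build_wIM _ h; omega)
    (fun j hj => hf.rm j fun h => by have := build_wRM _ h; omega)

theorem wp_prepare (hr : Raw N v) (hk : v.ir 1 = k) (hx : v.rr 1 = 0) (hoff : 3 * N.n ≤ off)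
    (hV : 8 * (N.n * N.n) + 24 * N.n + 2 * k + 64 ≤ V) :
    Wp off V prepare v fun t w => ∃ H, t ≤ 4 * (H * (1300 * N.n + 100)) + 400 * N.n + 400 ∧
      Big N.n k H V ∧ Pre N k H w := by
  refine wp_seq.2 ((wp_levels hr.n (by omega)).frame.mono ?_)
  rintro t1 w1 ⟨⟨ht1, H, hH1, hn1, hn2⟩, hf1⟩
  have hbig : Big N.n k H V := .of_le hV hn1 hn2
  have hr1 : Raw N w1 := hr.of_fr hf1 (by simp [levels]) (by simp [levels]) (by simp [levels])
  have k1 : w1.ir 1 = k := by rw [hf1.ir 1 (by simp [levels]), hk]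
  have x1 : w1.rr 1 = 0 := by rw [hf1.rr 1 (by simp [levels]), hx]
  refine wp_seq.2 ((wp_fill (d := 0) (by omega) hr1 x1.le (by omega) hoff).frame.mono ?_)
  rintro t2 w2 ⟨⟨ht2, tab2, low2, x2⟩, hf2⟩
  have i2 : ∀ i, i ≠ 3 → w2.ir i = w1.ir i := fun i hi => hf2.ir i fun h => hi (fill_wI i h)
  have hr2 : Raw N w2 := hr1.of_fr hf2 (fun h => by have := fill_wI _ h; omega)
    (fun h => by have := fill_wR _ h; omega) (fun h => by have := fill_wRM _ h; omega)
  refine wp_seq.2 ((wp_fill (d := 1) (by omega) hr2 (x2.trans x1.le) (by omega) hoff).frame.mono ?_)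
  rintro t3 w3 ⟨⟨ht3, tab3', low3', x3⟩, hf3⟩
  have i3 : ∀ i, i ≠ 3 → w3.ir i = w1.ir i := fun i hi => by
    rw [hf3.ir i fun h => hi (fill_wI i h), i2 i hi]
  have tab3 : ∀ d < 2, Tab N d w3 := by
    intro d hd
    obtain rfl | rfl : d = 0 ∨ d = 1 := by omega
    · exact tab2.of_fr hf3 (by simp [fill, fillS, fillE]) (by simp [fill, fillS, fillE])
        (by simp [fill, fillS, fillE])
    · exact tab3'
  have low3 : ∀ d < 2, Low N d w3 := by
    intro d hd
    obtain rfl | rfl : d = 0 ∨ d = 1 := by omega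
    · exact low2.mono x3
    · exact low3'
  have base : ∀ {d y : ℕ} {v w : VState}, Fr (build d y) v w → Glob N k H v ∧
      (∀ d < 2, Tab N d v) ∧ (∀ d < 2, Low N d v) → Glob N k H w ∧
      (∀ d < 2, Tab N d w) ∧ (∀ d < 2, Low N d w) := by
    intro d y v w hf ⟨hg, ht, hl⟩
    have a : ∀ i < 3, w.ir i = v.ir i := fun i hi => hf.ir i fun h => by
      have := build_wI _ h; omega
    refine ⟨⟨by rw [a 0 (by omega), hg.n], by rw [a 1 (by omega), hg.k],
      by rw [a 2 (by omega), hg.H]⟩, fun d hd => (ht d hd).of_fr hf ?_ ?_ ?_,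
      fun d hd => (hl d hd).mono (hf.rr 1 fun h => by have := build_wR _ h; omega).le⟩ <;>
    · intro h
      have := build_wRM _ h
      omega
  have b3 : Glob N k H w3 ∧ (∀ d < 2, Tab N d w3) ∧ (∀ d < 2, Low N d w3) :=
    ⟨⟨by rw [i3 0 (by omega), hr1.n], by rw [i3 1 (by omega), k1],
      by rw [i3 2 (by omega), hH1]⟩, tab3, low3⟩
  refine wp_seq.2 ((wp_build (y := 0) (by omega) (by omega) hbig b3.1.n b3.1.H
    (b3.2.1 0 (by omega))).frame.mono ?_)
  rintro t4 w4 ⟨⟨ht4, hb4⟩, hf4⟩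
  have b4 := base hf4 b3
  refine wp_seq.2 ((wp_build (y := 1) (by omega) (by omega) hbig b4.1.n b4.1.H
    (b4.2.1 0 (by omega))).frame.mono ?_)
  rintro t5 w5 ⟨⟨ht5, hb5⟩, hf5⟩
  have b5 := base hf5 b4
  refine wp_seq.2 ((wp_build (y := 0) (by omega) (by omega) hbig b5.1.n b5.1.H
    (b5.2.1 1 (by omega))).frame.mono ?_)
  rintro t6 w6 ⟨⟨ht6, hb6⟩, hf6⟩
  have b6 := base hf6 b5
  refine (wp_build (y := 1) (by omega) (by omega) hbig b6.1.n b6.1.H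
    (b6.2.1 1 (by omega))).frame.mono ?_
  rintro t7 w7 ⟨⟨ht7, hb7⟩, hf7⟩
  have b7 := base hf7 b6
  refine ⟨H, by omega, hbig, b7.1, b7.2.1, b7.2.2, fun d hd y hy h hh s h1 h2 => ?_⟩
  obtain rfl | rfl : d = 0 ∨ d = 1 := by omega
  · obtain rfl | rfl : y = 0 ∨ y = 1 := by omega
    · exact (((hb4 h hh s h1 h2).of_build hf5 (by omega) (by omega) (by omega) (by omega)
        (by omega)).of_build hf6 (by omega) (by omega) (by omega) (by omega)
        (by omega)).of_build hf7 (by omega) (by omega) (by omega) (by omega) (by omega)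
    · exact ((hb5 h hh s h1 h2).of_build hf6 (by omega) (by omega) (by omega) (by omega)
        (by omega)).of_build hf7 (by omega) (by omega) (by omega) (by omega) (by omega)
  · obtain rfl | rfl : y = 0 ∨ y = 1 := by omega
    · exact (hb6 h hh s h1 h2).of_build hf7 (by omega) (by omega) (by omega) (by omega) (by omega)
    · exact hb7 h hh s h1 h2

end SinkRAM

namespace SinkRAM

variable {N : PathNetwork} {k H : ℕ}

/-! ## The program -/

lemma raw_initState (N : PathNetwork) (k : ℕ) : Raw N (initState N k) where
  n := by simp [initState]
  τ := by simp [initState]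
  weight i hi := by simp [initState, addr, PathNetwork.input, hi]
  len i hi := by
    have h1 : N.n + i < N.n + (N.n - 1) := by omega
    simp [initState, addr, PathNetwork.input, h1]
  cap i hi := by
    have h1 : ¬ N.n - 1 + i < N.n - 1 := by omega
    have h2 : N.n + (N.n - 1 + i) < N.n + (N.n - 1) + (N.n - 1) := by omega
    have h3 : N.n + (N.n - 1 + i) - (N.n + (N.n - 1)) = i := by omega
    simp [initState, addr, PathNetwork.input, h1, h2, h3]

def main : Cmd := .seq prepare solve

/-- A bound for all words in arrays. -/
def wordBound (n k : ℕ) : ℕ := 8 * (n * n) + 24 * n + 2 * k + 64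

theorem wp_main (N : PathNetwork) (hk : 1 ≤ k) :
    Wp (3 * N.n + k) (wordBound N.n k) main (initState N k) fun t w =>
      (∃ H, t ≤ 4 * (H * (1300 * N.n + 100)) + 400 * N.n + 400 + ts k H ∧ 2 ^ H ≤ 2 * N.n) ∧
        N.IsOptimalSink fun j : Fin k => ⟨w.im 0 j, w.rm 0 j⟩ := by
  refine wp_seq.2 ((wp_prepare (raw_initState N k) (by simp [initState]) (by simp [initState])
    (by omega) le_rfl).mono ?_)
  rintro t v ⟨H, ht, hbig, hpre⟩
  refine (wp_solve hk (by omega) hbig hpre).mono ?_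
  rintro t' w ⟨ht', h⟩
  exact ⟨⟨H, by omega, hbig.pow_le⟩, h⟩

/-- Because `n + k ≥ 2`, the constant factor `2 ^ 11` is absorbed by eleven further powers of `n +
k`. -/
lemma wordBound_le {n : ℕ} (hn : 1 ≤ n) (hk : 1 ≤ k) :
    3 * n + k + 32 * wordBound n k + 64 ≤ (n + k) ^ 13 := by
  have h2 : 2 ^ 11 ≤ (n + k) ^ 11 := Nat.pow_le_pow_left (by omega) 11
  calc 3 * n + k + 32 * wordBound n k + 64 ≤ 2 ^ 11 * (n + k) ^ 2 := by
        unfold wordBound; nlinarith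
    _ ≤ (n + k) ^ 11 * (n + k) ^ 2 := Nat.mul_le_mul_right _ h2
    _ = (n + k) ^ 13 := by ring

/-- The dominating term comes from `tp`: `k` parametric greedy steps with about `2 * H` comparisons,
each costing a feasibility test of order `k * H ^ 3`. Passing to `Y = H + 1 ≥ 1` lets lower powers
be absorbed by higher ones. -/
lemma ts_le (hk : 1 ≤ k) (H : ℕ) : ts k H ≤ 23000 * (k ^ 2 * (H + 1) ^ 4) := by
  obtain ⟨Y, hY⟩ : ∃ Y, Y = H + 1 := ⟨_, rfl⟩
  rw [← hY]
  have hHY : H ≤ Y := by omega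
  have hY1 : 1 ≤ Y := by omega
  have p2 : Y ≤ Y ^ 2 := Nat.le_self_pow (by omega) Y
  have p3 : Y ^ 2 ≤ Y ^ 3 := Nat.pow_le_pow_right hY1 (by omega)
  have p4 : Y ^ 3 ≤ Y ^ 4 := Nat.pow_le_pow_right hY1 (by omega)
  have hq : tq H ≤ 876 * Y ^ 2 := by
    have : tq H ≤ 2 * (Y * (88 * Y + 300)) + 100 := by unfold tq; gcongr
    have e : Y * (88 * Y + 300) = 88 * Y ^ 2 + 300 * Y := by ring
    omega
  have hg : ∀ tc, tg H tc ≤ 2 * (1878 * Y ^ 3 + Y * tc) + 60 := fun tc => by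
    have h1 : tg H tc ≤ 2 * (Y * (2 * (876 * Y ^ 2) + tc + 126)) + 60 := by unfold tg; gcongr
    have e : Y * (2 * (876 * Y ^ 2) + tc + 126) = 1752 * Y ^ 3 + Y * tc + 126 * Y := by ring
    omega
  have hg1 : tg H 12 ≤ 3840 * Y ^ 3 := by have := hg 12; omega
  have k1 : k ≤ k * Y ^ 3 := Nat.le_mul_of_pos_right _ (by positivity)
  have k2 : k * Y ^ 3 ≤ k * Y ^ 4 := Nat.mul_le_mul_left _ p4
  have k3 : k * Y ^ 4 ≤ k ^ 2 * Y ^ 4 := Nat.mul_le_mul_right _ (Nat.le_self_pow (by omega) k)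
  have k4 : Y ^ 4 ≤ k * Y ^ 4 := Nat.le_mul_of_pos_left _ hk
  have hf : tf k H ≤ 3920 * (k * Y ^ 3) := by
    have h1 : tf k H ≤ k * (3840 * Y ^ 3 + 40) + 40 := by unfold tf; gcongr
    have e : k * (3840 * Y ^ 3 + 40) = 3840 * (k * Y ^ 3) + 40 * k := by ring
    omega
  have hg2 : tg H (tf k H + 20) ≤ 11700 * (k * Y ^ 4) := by
    have h1 := hg (tf k H + 20)
    have h2 : Y * (tf k H + 20) ≤ Y * (3920 * (k * Y ^ 3) + 20) := by gcongr
    have e : Y * (3920 * (k * Y ^ 3) + 20) = 3920 * (k * Y ^ 4) + 20 * Y := by ring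
    omega
  have hp : tp k H ≤ 16700 * (k ^ 2 * Y ^ 4) := by
    have h1 : k * (tg H (tf k H + 20) + 40) ≤ k * (11700 * (k * Y ^ 4) + 40) := by gcongr
    have e : k * (11700 * (k * Y ^ 4) + 40) = 11700 * (k ^ 2 * Y ^ 4) + 40 * k := by ring
    unfold tp
    omega
  have h1 : k * (tg H 12 + (2 * tq H + 80) + 40) ≤ k * (3840 * Y ^ 3 + (1752 * Y ^ 3 + 80) + 40) :=
    Nat.mul_le_mul_left _ (by omega)
  have e : k * (3840 * Y ^ 3 + (1752 * Y ^ 3 + 80) + 40) = 5592 * (k * Y ^ 3) + 120 * k := by ring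
  unfold ts
  omega

lemma time_le {n t : ℕ} (hn : 2 ≤ n) (hk : 1 ≤ k) (hH : 2 ^ H ≤ 2 * n)
    (ht : t ≤ 4 * (H * (1300 * n + 100)) + 400 * n + 400 + ts k H) :
    ((t + 4 : ℕ) : ℝ) ≤
      20000000 * (n * Real.log n + (k : ℝ) ^ 2 * Real.log n ^ 4) := by
  have h1 := ts_le hk H
  have h2 : t + 4 ≤ 6500 * (n * (H + 1)) + 23000 * (k ^ 2 * (H + 1) ^ 4) := by nlinarith
  have h3 : ((t + 4 : ℕ) : ℝ) ≤ 6500 * (n * ((H : ℝ) + 1)) + 23000 * ((k : ℝ) ^ 2 * ((H : ℝ) + 1) ^ 4) := by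
    exact_mod_cast h2
  have hn' : (2 : ℝ) ≤ n := by exact_mod_cast hn
  have hl2 : (0.69 : ℝ) < Real.log 2 := by linarith [Real.log_two_gt_d9]
  have hln : Real.log 2 ≤ Real.log n := Real.log_le_log (by norm_num) hn'
  have hHl : (H : ℝ) * Real.log 2 ≤ 2 * Real.log n := by
    have h4 : ((2 : ℝ) ^ H) ≤ 2 * n := by exact_mod_cast hH
    have h5 := Real.log_le_log (by positivity) h4
    rw [Real.log_pow, Real.log_mul (by norm_num) (by positivity)] at h5
    linarith
  -- From `2 ^ H ≤ 2 * n ≤ n ^ 2` one has `H * log 2 ≤ 2 * log n`, and `log 2 ≤ log n` takes care of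
  -- the `1`. The constant works since `3 / 0.69 < 5`.
  have hY : (H : ℝ) + 1 ≤ 5 * Real.log n := by
    have hH0 : (0 : ℝ) ≤ H := Nat.cast_nonneg H
    nlinarith
  have hL : 0 ≤ Real.log n := by linarith
  calc ((t + 4 : ℕ) : ℝ)
      ≤ 6500 * (n * ((H : ℝ) + 1)) + 23000 * ((k : ℝ) ^ 2 * ((H : ℝ) + 1) ^ 4) := h3
    _ ≤ 6500 * (n * (5 * Real.log n)) + 23000 * ((k : ℝ) ^ 2 * (5 * Real.log n) ^ 4) := by gcongr
    _ ≤ 20000000 * (n * Real.log n + (k : ℝ) ^ 2 * Real.log n ^ 4) := by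
        have a1 : 0 ≤ (n : ℝ) * Real.log n := by positivity
        have a2 : 0 ≤ (k : ℝ) ^ 2 * Real.log n ^ 4 := by positivity
        nlinarith

end SinkRAM

theorem mainTheorem1 :
    ∃ (P : RealRAM.Program) (C : ℝ) (c : ℕ), ∀ (N : PathNetwork) (k : ℕ), 1 ≤ k →
      ∃ T : ℕ,
        (2 ≤ N.n → (T : ℝ) ≤ C * (N.n * Real.log N.n + (k : ℝ) ^ 2 * Real.log N.n ^ 4)) ∧
        (∀ t ≤ T, (RealRAM.run P (N.input k) t).WordsLe ((N.n + k) ^ c)) ∧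
        RealRAM.Halted P (RealRAM.run P (N.input k) T) ∧
        N.IsOptimalSink ((RealRAM.run P (N.input k) T).output k) := by
  refine ⟨SinkRAM.prelude ++ SinkRAM.main.code 4, 20000000, 13, fun N k hk => ?_⟩
  obtain ⟨t, w, ⟨⟨H, ht, hH⟩, hopt⟩, hwords, hhalt, hout⟩ := SinkRAM.realize (SinkRAM.wp_main N hk)
  refine ⟨t + 4, fun hn => SinkRAM.time_le hn hk hH ht, fun m hm a => ?_, hhalt, hout ▸ hopt⟩
  have hle := SinkRAM.wordBound_le N.n_pos hk
  exact ⟨(hwords m hm a).1.trans hle, (hwords m hm a).2.trans hle⟩
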